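/- Let $n\ge 3$ and let $\Omega\subset\mathbb{R}^n$ be a bounded domain (a connected open set) with $0\in\partial\Omega$ whose boundary is smooth near $0$, i.e. some $C^\infty$ diffeomorphism $\Phi$ from an open neighbourhood $U$ of $0$ onto an open set $V\subset\mathbb{R}^n$ maps $U\cap\Omega$ onto $V\cap\mathbb{R}^n_+$, where $\mathbb{R}^n_+=\{x: x_1>0\}$. Let $\gamma<\frac{n^2}{4}$, $0\le s\le 2$ and $2^\star(s)=\frac{2(n-s)}{n-2}$. For an open set $D\subset\mathbb{R}^n$ let $D^{1,2}(D)$ be the completion of $C_c^\infty(D)$ for the norm $\left(\int_D|\nabla u|^2\,dx\right)^{1/2}$ (it is also written $H^1_0(D)$ if $D$ is bounded), and put $$\mu_{\gamma,s}(D)=\inf_{u\in D^{1,2}(D)\setminus\{0\}}J^D_{\gamma,s}(u),\qquad J^D_{\gamma,s}(u)=\frac{\int_D|\nabla u|^2dx-\gamma\int_D\frac{u^2}{|x|^2}dx}{\left(\int_D\frac{|u|^{2^\star(s)}}{|x|^s}dx\right)^{2/2^\star(s)}},\qquad \gamma_H(D)=\inf_{u\in D^{1,2}(D)\setminus\{0\}}\frac{\int_D|\nabla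 u|^2dx}{\int_D\frac{u^2}{|x|^2}dx}.$$ 1. If $\mu_{\gamma,s}(\Omega)<\mu_{\gamma,s}(\mathbb{R}^n_+)$, then there are extremals for $\mu_{\gamma,s}(\Omega)$, i.e. there is $u\in H^1_0(\Omega)\setminus\{0\}$ with $J^\Omega_{\gamma,s}(u)=\mu_{\gamma,s}(\Omega)$. In particular, if $\gamma_H(\Omega)<\frac{n^2}{4}$, then the infimum $\gamma_H(\Omega)$ is attained in $H^1_0(\Omega)\setminus\{0\}$. 2. If $\gamma<\gamma_H(\Omega)$, then $\mu_{\gamma,s}(\Omega)>0$; if moreover $\mu_{\gamma,s}(\Omega)<\mu_{\gamma,s}(\mathbb{R}^n_+)$ and $s<2$, then there is a positive weak solution $u\in H^1_0(\Omega)$ of $$-\Delta u-\gamma\frac{u}{|x|^2}=\frac{u^{2^\star(s)-1}}{|x|^s}\ \text{ in }\Omega,\qquad u>0\ \text{ in }\Omega,\qquad u=0\ \text{ on }\partial\Omega.$$ 3. If $\gamma_H(\Omega)<\gamma<\frac{n^2}{4}$, then $\mu_{\gamma,s}(\Omega)<0$; if moreover $s<2$, then there is a positive weak solution $u\in H^1_0(\Omega)$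 of $$-\Delta u-\gamma\frac{u}{|x|^2}=-\frac{u^{2^\star(s)-1}}{|x|^s}\ \text{ in }\Omega,\qquad u>0\ \text{ in }\Omega,\qquad u=0\ \text{ on }\partial\Omega.$$ In 2 and 3, $u$ is a weak solution if the equation holds when tested against every $\varphi\in D^{1,2}(\Omega)$, and the boundary condition means $u\in H^1_0(\Omega)$. -/

import Mathlib

open MeasureTheory Filter Topology
open scoped ContDiff

namespace HardySchrodinger

/-- Euclidean space `ℝⁿ`. -/
abbrev E (n : ℕ) : Type := EuclideanSpace ℝ (Fin n)

/-- The open half-space `ℝⁿ₊ = {x | x₁ > 0}`; the first coordinate is indexed by `0`. -/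
def halfSpace (n : ℕ) [NeZero n] : Set (E n) := {x | 0 < x 0}

/-- The critical Hardy-Sobolev exponent `2⋆(s) = 2 (n - s) / (n - 2)`. -/
noncomputable def critExp (n : ℕ) (s : ℝ) : ℝ := 2 * ((n : ℝ) - s) / ((n : ℝ) - 2)

/-- The boundary of `Ω` is smooth near the point `p`: a `C^∞` diffeomorphism `Φ` from an open
neighbourhood of `p` onto an open subset of `ℝⁿ` flattens `Ω` to the half-space. (As `Φ` is a
homeomorphism, it then also maps `∂Ω` to `{x₁ = 0}`, and points outside the closure of `Ω` to
`{x₁ < 0}`.) -/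
def SmoothBoundaryAt {n : ℕ} [NeZero n] (Ω : Set (E n)) (p : E n) : Prop :=
  ∃ Φ : OpenPartialHomeomorph (E n) (E n),
    p ∈ Φ.source ∧
    ContDiffOn ℝ ∞ Φ Φ.source ∧
    ContDiffOn ℝ ∞ Φ.symm Φ.target ∧
    ∀ x ∈ Φ.source, (x ∈ Ω ↔ Φ x ∈ halfSpace n)

/-- `φ ∈ C_c^∞(Ω)`, as a function on `ℝⁿ` (extended by zero outside `Ω`). -/
structure IsTestFunction {n : ℕ} (Ω : Set (E n)) (φ : E n → ℝ) : Prop where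
  smooth : ContDiff ℝ ∞ φ
  compact : HasCompactSupport φ
  support_subset : tsupport φ ⊆ Ω

/-- `MemD12 Ω u g`: the function `u` belongs to `D^{1,2}(Ω)` and `g` is its (weak) gradient.
`D^{1,2}(Ω)` is the completion of `C_c^∞(Ω)` for the norm `‖∇φ‖_{L²}`. For `n ≥ 3`, by the Sobolev
inequality, a sequence of test functions that is Cauchy for this norm converges in `L^{2⋆(0)}`, so
the completion is the space of limits `u` in `L^{2⋆(0)}` of test functions whose gradients converge
in `L²`; the limit `g` of the gradients is the distributional gradient of `u`. -/
structure MemD12 {n : ℕ} (Ω : Set (E n)) (u : E n → ℝ) (g : E n → E n) : Prop where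
  memLp : MemLp u (ENNReal.ofReal (critExp n 0)) volume
  memLp_grad : MemLp g 2 volume
  approx : ∃ φ : ℕ → E n → ℝ, (∀ k, IsTestFunction Ω (φ k)) ∧
    Tendsto (fun k => eLpNorm (fun x => u x - φ k x) (ENNReal.ofReal (critExp n 0)) volume)
      atTop (𝓝 0) ∧
    Tendsto (fun k => eLpNorm (fun x => g x - gradient (φ k) x) 2 volume) atTop (𝓝 0)

/-- `u` is a nonzero element of `D^{1,2}(Ω)` with gradient `g`. -/
def MemD12NeZero {n : ℕ} (Ω : Set (E n)) (u : E n → ℝ) (g : E n → E n) : Prop :=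
  MemD12 Ω u g ∧ ¬ (u =ᵐ[volume] 0)

/-- The functional `J^Ω_{γ,s}` at `u` with gradient `g`. For `n ≥ 3`, `s ∈ [0, 2]` and nonzero
`u ∈ D^{1,2}(Ω)` all integrals converge (Hardy and Sobolev inequalities on `ℝⁿ`), and the
denominator is positive. -/
noncomputable def J {n : ℕ} (Ω : Set (E n)) (γ s : ℝ) (u : E n → ℝ) (g : E n → E n) : ℝ :=
  ((∫ x in Ω, ‖g x‖ ^ 2) - γ * ∫ x in Ω, (u x) ^ 2 / ‖x‖ ^ 2) /
    (∫ x in Ω, |u x| ^ critExp n s / ‖x‖ ^ s) ^ (2 / critExp n s)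

/-- The best constant `μ_{γ,s}(Ω) = inf {J^Ω_{γ,s}(u) : u ∈ D^{1,2}(Ω) ∖ {0}}`, in `[-∞, ∞]`. -/
noncomputable def bestConst {n : ℕ} (Ω : Set (E n)) (γ s : ℝ) : EReal :=
  sInf {t : EReal | ∃ u g, MemD12NeZero Ω u g ∧ t = (J Ω γ s u g : EReal)}

/-- The Hardy quotient `∫ |∇u|² / ∫ u² / |x|²` over `Ω`. -/
noncomputable def hardyQuotient {n : ℕ} (Ω : Set (E n)) (u : E n → ℝ) (g : E n → E n) : ℝ :=
  (∫ x in Ω, ‖g x‖ ^ 2) / ∫ x in Ω, (u x) ^ 2 / ‖x‖ ^ 2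

/-- The Hardy constant `γ_H(Ω)`, the infimum of the Hardy quotient on `D^{1,2}(Ω) ∖ {0}`. -/
noncomputable def hardyConst {n : ℕ} (Ω : Set (E n)) : EReal :=
  sInf {t : EReal | ∃ u g, MemD12NeZero Ω u g ∧ t = (hardyQuotient Ω u g : EReal)}

/-- `μ_{γ,s}(Ω)` has an extremal. -/
def HasExtremal {n : ℕ} (Ω : Set (E n)) (γ s : ℝ) : Prop :=
  ∃ u g, MemD12NeZero Ω u g ∧ (J Ω γ s u g : EReal) = bestConst Ω γ s

/-- The Hardy constant `γ_H(Ω)` is attained in `D^{1,2}(Ω) ∖ {0}`. -/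
def HardyConstAttained {n : ℕ} (Ω : Set (E n)) : Prop :=
  ∃ u g, MemD12NeZero Ω u g ∧ (hardyQuotient Ω u g : EReal) = hardyConst Ω

/-- `u`, with gradient `g`, is a positive weak solution of
`-Δu - γ u / |x|² = c u^{2⋆(s)-1} / |x|^s` in `Ω`, `u > 0` in `Ω`, `u = 0` on `∂Ω`.
The boundary condition is `u ∈ D^{1,2}(Ω)`, and the equation is tested against all of
`D^{1,2}(Ω)`. -/
def IsPositiveSolution {n : ℕ} (Ω : Set (E n)) (γ s c : ℝ) (u : E n → ℝ) (g : E n → E n) :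
    Prop :=
  MemD12 Ω u g ∧ (∀ x ∈ Ω, 0 < u x) ∧
    ∀ (φ : E n → ℝ) (h : E n → E n), MemD12 Ω φ h →
      (∫ x in Ω, inner ℝ (g x) (h x)) - γ * ∫ x in Ω, u x * φ x / ‖x‖ ^ 2 =
        c * ∫ x in Ω, u x ^ (critExp n s - 1) * φ x / ‖x‖ ^ s

end HardySchrodinger

/-!
Write `p = 2⋆(s)`, `N(u) = ∫ |u|^p / |x|^s` and `Q(u) = ∫ |∇u|² - γ ∫ u² / |x|²`, so that
`J = Q / N^{2/p}`.

**Compactness.** Let `m > 0` satisfy `m N^{2/p} ≤ Q` on `C_c^∞(ℝⁿ₊)`. On `Ω` this inequality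
persists up to lower order terms: for every `ε` there is `C` with `m N^{2/p} ≤ Q + ε ∫ |∇u|² + C ∫ u²`
(`exists_localised_hardySobolev`). Near `0` one transplants to the half-space by a boundary
chart whose derivative at `0` is an isometry (`exists_ball_transplant`). Away from `0` the Hardy
term is of lower order, and so is `N` if `s > 0`; if `s = 0` then `m` is bounded by the Sobolev
constant, as one sees by translating far into the half-space (`exists_hardySobolev_away`). A
partition of unity `sin² θ + cos² θ = 1` glues the two. With `s = 2`, `γ = 0` and `m = n² / 4`,
the Hardy constant of the half-space (`IsTestFunction.hardy_halfSpace`), it gives the coercivity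
of `Q` modulo `∫ u²` for `γ < n² / 4` (`exists_coercive`).

Since `∫ u²` is weakly continuous on bounded sets (Rellich, `tendsto_massMap_of_weakly_null`), the
localised inequality says that a weakly null sequence of mass `N = t` costs at least `m t^{2/p}`.
If `μ_{γ,s}(Ω) < m`, a minimising sequence with `N = 1` splits into its weak limit, of mass `θ`,
and a weakly null part of mass at least `1 - θ` by the Brezis-Lieb lemma; as `t^{2/p}` is concave,
this is too expensive unless `θ = 1`. Hence the weak limit is an extremal (`exists_minimiser`,
`exists_extremal`). The Hardy constant `γ_H(Ω)` is the case `γ = 0`, `s = 2`. If `γ > γ_H(Ω)` then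
`μ_{γ,s}(Ω) < 0`, while a positive `m` exists by the Hardy and Hardy-Sobolev inequalities on the
half-space.

**Positive solutions.** The absolute value of an extremal is an extremal (`MemD12.abs`), so it
satisfies the Euler-Lagrange equation (`MemD12NeZero.euler_lagrange`), and a multiple of it is a
nonnegative weak solution (`exists_nonneg_solution`). It is positive by a strong maximum principle
(`ae_pos_of_solution`): testing with `η² / u`, suitably regularised, shows that `log u` has finite
Dirichlet integral on small balls, so by the Poincaré inequality `u` vanishes almost everywhere or
almost nowhere on each of them, and `Ω` is connected.

The space `D^{1,2}(Ω)` is handled as the Hilbert space `gradSpace` of its gradients in `L²`;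
integral inequalities are proved for test functions and extended by density.
-/

namespace HardySchrodinger

open scoped ENNReal NNReal InnerProductSpace

variable {n : ℕ}

/-! ### The critical exponents -/

lemma critExp_two (hn : 3 ≤ n) : critExp n 2 = 2 := by
  have : (3 : ℝ) ≤ n := by exact_mod_cast hn
  unfold critExp
  field_simp [show (n : ℝ) - 2 ≠ 0 by linarith]

lemma two_le_critExp (hn : 3 ≤ n) {s : ℝ} (hs2 : s ≤ 2) : 2 ≤ critExp n s := by
  have : (3 : ℝ) ≤ n := by exact_mod_cast hn
  unfold critExp
  rw [le_div_iff₀ (by linarith)]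
  linarith

lemma two_lt_critExp (hn : 3 ≤ n) {s : ℝ} (hs2 : s < 2) : 2 < critExp n s := by
  have : (3 : ℝ) ≤ n := by exact_mod_cast hn
  unfold critExp
  rw [lt_div_iff₀ (by linarith)]
  linarith

lemma critExp_pos (hn : 3 ≤ n) {s : ℝ} (hs2 : s ≤ 2) : 0 < critExp n s := by
  linarith [two_le_critExp hn hs2]

/-- The exponent identity behind the Hölder interpolation of the Hardy-Sobolev inequality between
the Hardy and the Sobolev inequalities. -/
lemma critExp_interpolation (hn : 3 ≤ n) (s : ℝ) :
    critExp n s = s + critExp n 0 * (1 - s / 2) := by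
  have : (3 : ℝ) ≤ n := by exact_mod_cast hn
  unfold critExp
  field_simp [show (n : ℝ) - 2 ≠ 0 by linarith]
  ring

lemma one_le_ofReal_critExp (hn : 3 ≤ n) {s : ℝ} (hs2 : s ≤ 2) :
    1 ≤ ENNReal.ofReal (critExp n s) := by
  rw [ENNReal.one_le_ofReal]
  linarith [two_le_critExp hn hs2]

/-! ### Test functions -/

lemma norm_gradient_eq (φ : E n → ℝ) (x : E n) : ‖gradient φ x‖ = ‖fderiv ℝ φ x‖ := by
  simp [gradient]

namespace IsTestFunction

variable {Ω : Set (E n)} {φ ψ : E n → ℝ}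

lemma differentiableAt (h : IsTestFunction Ω φ) (x : E n) : DifferentiableAt ℝ φ x :=
  h.smooth.differentiable (by simp) x

lemma eq_zero (h : IsTestFunction Ω φ) {x : E n} (hx : x ∉ Ω) : φ x = 0 :=
  image_eq_zero_of_notMem_tsupport fun h' => hx (h.support_subset h')

lemma gradient_eq_zero (h : IsTestFunction Ω φ) {x : E n} (hx : x ∉ Ω) : gradient φ x = 0 := by
  have : fderiv ℝ φ x = 0 :=
    image_eq_zero_of_notMem_tsupport fun h' =>
      hx (h.support_subset (tsupport_fderiv_subset ℝ h'))
  simp [gradient, this]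

lemma zero (Ω : Set (E n)) : IsTestFunction Ω (fun _ => 0) :=
  ⟨contDiff_const, HasCompactSupport.zero, by simp [tsupport]⟩

lemma add (h : IsTestFunction Ω φ) (h' : IsTestFunction Ω ψ) :
    IsTestFunction Ω (fun x => φ x + ψ x) :=
  ⟨h.smooth.add h'.smooth, h.compact.add h'.compact,
    (tsupport_add φ ψ).trans (Set.union_subset h.support_subset h'.support_subset)⟩

lemma const_mul (h : IsTestFunction Ω φ) (c : ℝ) : IsTestFunction Ω (fun x => c * φ x) :=
  ⟨contDiff_const.mul h.smooth, h.compact.mul_left,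
    (tsupport_mul_subset_right (f := fun _ => c) (g := φ)).trans h.support_subset⟩

lemma gradient_add (h : IsTestFunction Ω φ) (h' : IsTestFunction Ω ψ) (x : E n) :
    gradient (fun x => φ x + ψ x) x = gradient φ x + gradient ψ x := by
  simp [gradient, fderiv_fun_add (h.differentiableAt x) (h'.differentiableAt x)]

lemma gradient_const_mul (h : IsTestFunction Ω φ) (c : ℝ) (x : E n) :
    gradient (fun x => c * φ x) x = c • gradient φ x := by
  simp [gradient, fderiv_const_mul (h.differentiableAt x)]

lemma continuous_gradient (h : IsTestFunction Ω φ) : Continuous (gradient φ) :=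
  (InnerProductSpace.toDual ℝ (E n)).symm.continuous.comp
    (h.smooth.continuous_fderiv (by simp))

lemma hasCompactSupport_gradient (h : IsTestFunction Ω φ) : HasCompactSupport (gradient φ) := by
  refine HasCompactSupport.comp_left (g := (InnerProductSpace.toDual ℝ (E n)).symm)
    (h.compact.fderiv (𝕜 := ℝ)) (by simp)

lemma memLp (h : IsTestFunction Ω φ) (q : ℝ≥0∞) : MemLp φ q volume :=
  h.smooth.continuous.memLp_of_hasCompactSupport h.compact

lemma memLp_gradient (h : IsTestFunction Ω φ) (q : ℝ≥0∞) : MemLp (gradient φ) q volume :=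
  h.continuous_gradient.memLp_of_hasCompactSupport h.hasCompactSupport_gradient

lemma memD12 (h : IsTestFunction Ω φ) : MemD12 Ω φ (gradient φ) :=
  ⟨h.memLp _, h.memLp_gradient _, fun _ => φ, fun _ => h, by simp, by simp⟩

end IsTestFunction

/-- The Sobolev inequality for test functions. -/
lemma exists_sobolev (hn : 3 ≤ n) : ∃ C : ℝ≥0, ∀ (Ω : Set (E n)) (φ : E n → ℝ),
    IsTestFunction Ω φ →
      eLpNorm φ (ENNReal.ofReal (critExp n 0)) volume ≤ C * eLpNorm (gradient φ) 2 volume := by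
  have h3 : (3 : ℝ) ≤ n := by exact_mod_cast hn
  refine ⟨SNormLESNormFDerivOfEqConst ℝ (volume : Measure (E n)) 2, fun Ω φ h => ?_⟩
  have key := eLpNorm_le_eLpNorm_fderiv_of_eq (volume : Measure (E n))
    (h.smooth.of_le (by simp)) h.compact (p := 2) (p' := (critExp n 0).toNNReal) (by norm_num)
    (by simp; omega) (by
      rw [Real.coe_toNNReal _ (critExp_pos hn (by norm_num)).le]
      simp only [finrank_euclideanSpace, Fintype.card_fin, critExp]
      push_cast
      field_simp [show (n : ℝ) - 2 ≠ 0 by linarith, show (n : ℝ) ≠ 0 by linarith]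
      ring)
  have e : eLpNorm (gradient φ) 2 volume = eLpNorm (fderiv ℝ φ) 2 volume :=
    eLpNorm_congr_norm_ae (ae_of_all _ (norm_gradient_eq φ))
  rw [e]
  exact_mod_cast key

/-! ### Elementary properties of `D^{1,2}(Ω)` -/

/-- Along a subsequence, the approximating test functions converge almost everywhere. -/
lemma MemD12.exists_approx_ae (hn : 3 ≤ n) {Ω : Set (E n)} {u : E n → ℝ} {g : E n → E n}
    (h : MemD12 Ω u g) :
    ∃ φ : ℕ → E n → ℝ, (∀ k, IsTestFunction Ω (φ k)) ∧
    Tendsto (fun k => eLpNorm (fun x => u x - φ k x) (ENNReal.ofReal (critExp n 0)) volume)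
      atTop (𝓝 0) ∧
    Tendsto (fun k => eLpNorm (fun x => g x - gradient (φ k) x) 2 volume) atTop (𝓝 0) ∧
    (∀ᵐ x, Tendsto (fun k => φ k x) atTop (𝓝 (u x))) ∧
    (∀ᵐ x, Tendsto (fun k => gradient (φ k) x) atTop (𝓝 (g x))) := by
  obtain ⟨φ, hφ, h1, h2⟩ := h.approx
  have h1' : TendstoInMeasure volume φ atTop u := by
    refine tendstoInMeasure_of_tendsto_eLpNorm (p := ENNReal.ofReal (critExp n 0)) ?_
      (fun k => ((hφ k).memLp 2).1) h.memLp.1 ?_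
    · exact (lt_of_lt_of_le one_pos (one_le_ofReal_critExp hn (by norm_num))).ne'
    · refine h1.congr fun k => ?_
      rw [← eLpNorm_neg]
      congr 1
      ext x
      simp
  obtain ⟨a, ha, h1a⟩ := h1'.exists_seq_tendsto_ae
  have h2' : TendstoInMeasure volume (fun k => gradient (φ (a k))) atTop g := by
    refine tendstoInMeasure_of_tendsto_eLpNorm (p := 2) (by norm_num)
      (fun k => ((hφ _).memLp_gradient 2).1) h.memLp_grad.1 ?_
    refine (h2.comp ha.tendsto_atTop).congr fun k => ?_
    simp only [Function.comp]
    rw [← eLpNorm_neg]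
    congr 1
    ext x
    simp
  obtain ⟨b, hb, h2b⟩ := h2'.exists_seq_tendsto_ae
  refine ⟨fun k => φ (a (b k)), fun k => hφ _, h1.comp (ha.comp hb).tendsto_atTop,
    h2.comp (ha.comp hb).tendsto_atTop, ?_, h2b⟩
  filter_upwards [h1a] with x hx
  exact hx.comp hb.tendsto_atTop

lemma MemD12.ae_eq_zero (hn : 3 ≤ n) {Ω : Set (E n)} {u : E n → ℝ} {g : E n → E n}
    (h : MemD12 Ω u g) : ∀ᵐ x, x ∉ Ω → u x = 0 ∧ g x = 0 := by
  obtain ⟨φ, hφ, -, -, h1, h2⟩ := h.exists_approx_ae hn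
  filter_upwards [h1, h2] with x hx1 hx2 hxΩ
  refine ⟨tendsto_nhds_unique hx1 ?_, tendsto_nhds_unique hx2 ?_⟩
  · simp [(hφ _).eq_zero hxΩ]
  · simp [(hφ _).gradient_eq_zero hxΩ]

lemma MemD12.congr {Ω : Set (E n)} {u v : E n → ℝ} {g h : E n → E n}
    (hu : MemD12 Ω u g) (huv : u =ᵐ[volume] v) (hgh : g =ᵐ[volume] h) : MemD12 Ω v h := by
  obtain ⟨φ, hφ, h1, h2⟩ := hu.approx
  refine ⟨hu.memLp.ae_eq huv, hu.memLp_grad.ae_eq hgh, φ, hφ, h1.congr fun k => ?_,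
    h2.congr fun k => ?_⟩
  · refine eLpNorm_congr_ae ?_
    filter_upwards [huv] with x hx
    rw [hx]
  · refine eLpNorm_congr_ae ?_
    filter_upwards [hgh] with x hx
    rw [hx]

lemma MemD12.add (hn : 3 ≤ n) {Ω : Set (E n)} {u v : E n → ℝ} {g h : E n → E n}
    (hu : MemD12 Ω u g) (hv : MemD12 Ω v h) :
    MemD12 Ω (fun x => u x + v x) (fun x => g x + h x) := by
  obtain ⟨φ, hφ, h1, h2⟩ := hu.approx
  obtain ⟨ψ, hψ, h3, h4⟩ := hv.approx
  refine ⟨hu.memLp.add hv.memLp, hu.memLp_grad.add hv.memLp_grad, fun k x => φ k x + ψ k x,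
    fun k => (hφ k).add (hψ k), ?_, ?_⟩
  · refine tendsto_of_tendsto_of_tendsto_of_le_of_le tendsto_const_nhds
      (by simpa using h1.add h3) (fun _ => zero_le) fun k => ?_
    refine le_trans (le_of_eq ?_) (eLpNorm_add_le (f := fun x => u x - φ k x)
      (g := fun x => v x - ψ k x) (hu.memLp.1.sub ((hφ k).memLp 2).1)
      (hv.memLp.1.sub ((hψ k).memLp 2).1) (one_le_ofReal_critExp hn (by norm_num)))
    congr 1
    ext x
    simp only [Pi.add_apply]
    ring
  · refine tendsto_of_tendsto_of_tendsto_of_le_of_le tendsto_const_nhds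
      (by simpa using h2.add h4) (fun _ => zero_le) fun k => ?_
    refine le_trans (le_of_eq ?_) (eLpNorm_add_le (f := fun x => g x - gradient (φ k) x)
      (g := fun x => h x - gradient (ψ k) x) (hu.memLp_grad.1.sub ((hφ k).memLp_gradient 2).1)
      (hv.memLp_grad.1.sub ((hψ k).memLp_gradient 2).1) (by norm_num))
    congr 1
    ext1 x
    simp only [Pi.add_apply, (hφ k).gradient_add (hψ k)]
    abel

lemma MemD12.const_mul {Ω : Set (E n)} {u : E n → ℝ} {g : E n → E n}
    (hu : MemD12 Ω u g) (c : ℝ) : MemD12 Ω (fun x => c * u x) (fun x => c • g x) := by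
  obtain ⟨φ, hφ, h1, h2⟩ := hu.approx
  refine ⟨hu.memLp.const_mul c, hu.memLp_grad.const_smul c, fun k x => c * φ k x,
    fun k => (hφ k).const_mul c, ?_, ?_⟩
  · have := ENNReal.Tendsto.const_mul h1 (a := ‖c‖ₑ) (Or.inr (by simp))
    rw [mul_zero] at this
    refine this.congr fun k => ?_
    rw [← eLpNorm_const_smul]
    congr 1
    ext x
    simp [mul_sub]
  · have := ENNReal.Tendsto.const_mul h2 (a := ‖c‖ₑ) (Or.inr (by simp))
    rw [mul_zero] at this
    refine this.congr fun k => ?_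
    rw [← eLpNorm_const_smul]
    congr 1
    ext1 x
    simp [(hφ k).gradient_const_mul, smul_sub]

lemma MemD12.sub (hn : 3 ≤ n) {Ω : Set (E n)} {u v : E n → ℝ} {g h : E n → E n}
    (hu : MemD12 Ω u g) (hv : MemD12 Ω v h) :
    MemD12 Ω (fun x => u x - v x) (fun x => g x - h x) := by
  simpa [sub_eq_add_neg] using hu.add hn (hv.const_mul (-1))

/-- `D^{1,2}(Ω)` is closed. -/
lemma MemD12.of_tendsto (hn : 3 ≤ n) {Ω : Set (E n)} {u : E n → ℝ} {g : E n → E n}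
    {v : ℕ → E n → ℝ} {h : ℕ → E n → E n} (hv : ∀ k, MemD12 Ω (v k) (h k))
    (hu : MemLp u (ENNReal.ofReal (critExp n 0)) volume) (hg : MemLp g 2 volume)
    (h1 : Tendsto (fun k => eLpNorm (fun x => u x - v k x) (ENNReal.ofReal (critExp n 0)) volume)
      atTop (𝓝 0))
    (h2 : Tendsto (fun k => eLpNorm (fun x => g x - h k x) 2 volume) atTop (𝓝 0)) :
    MemD12 Ω u g := by
  have key : ∀ k : ℕ, ∃ φ, IsTestFunction Ω φ ∧
      eLpNorm (fun x => v k x - φ x) (ENNReal.ofReal (critExp n 0)) volume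
        ≤ ENNReal.ofReal (1 / ((k : ℝ) + 1)) ∧
      eLpNorm (fun x => h k x - gradient φ x) 2 volume ≤ ENNReal.ofReal (1 / ((k : ℝ) + 1)) := by
    intro k
    obtain ⟨φ, hφ, h1, h2⟩ := (hv k).approx
    have hpos : (0 : ℝ≥0∞) < ENNReal.ofReal (1 / ((k : ℝ) + 1)) := by
      rw [ENNReal.ofReal_pos]
      positivity
    obtain ⟨j, hj1, hj2⟩ :=
      ((h1.eventually (ge_mem_nhds hpos)).and (h2.eventually (ge_mem_nhds hpos))).exists
    exact ⟨φ j, hφ j, hj1, hj2⟩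
  choose φ hφ hφ1 hφ2 using key
  have hlim : Tendsto (fun k : ℕ => ENNReal.ofReal (1 / ((k : ℝ) + 1))) atTop (𝓝 0) := by
    simpa using ENNReal.tendsto_ofReal tendsto_one_div_add_atTop_nhds_zero_nat
  refine ⟨hu, hg, φ, hφ, ?_, ?_⟩
  · refine tendsto_of_tendsto_of_tendsto_of_le_of_le tendsto_const_nhds
      ((h1.add hlim).trans (by simp)) (fun _ => zero_le) fun k => ?_
    refine le_trans ?_ (add_le_add_right (hφ1 k) _)
    refine le_trans (le_of_eq ?_) (eLpNorm_add_le (f := fun x => u x - v k x)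
      (g := fun x => v k x - φ k x) (hu.1.sub (hv k).memLp.1)
      ((hv k).memLp.1.sub ((hφ k).memLp 2).1) (one_le_ofReal_critExp hn (by norm_num)))
    congr 1
    ext x
    simp
  · refine tendsto_of_tendsto_of_tendsto_of_le_of_le tendsto_const_nhds
      ((h2.add hlim).trans (by simp)) (fun _ => zero_le) fun k => ?_
    refine le_trans ?_ (add_le_add_right (hφ2 k) _)
    refine le_trans (le_of_eq ?_) (eLpNorm_add_le (f := fun x => g x - h k x)
      (g := fun x => h k x - gradient (φ k) x) (hg.1.sub (hv k).memLp_grad.1)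
      ((hv k).memLp_grad.1.sub ((hφ k).memLp_gradient 2).1) (by norm_num))
    congr 1
    ext1 x
    simp

lemma tendsto_eLpNorm_of_tendsto_sub {α F : Type*} [MeasurableSpace α] [NormedAddCommGroup F]
    {μ : Measure α} {q : ℝ≥0∞} (hq : 1 ≤ q) {g : α → F} {f : ℕ → α → F} (hg : MemLp g q μ)
    (hf : ∀ k, AEStronglyMeasurable (f k) μ)
    (h : Tendsto (fun k => eLpNorm (fun x => g x - f k x) q μ) atTop (𝓝 0)) :
    Tendsto (fun k => eLpNorm (f k) q μ) atTop (𝓝 (eLpNorm g q μ)) := by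
  have up : ∀ k, eLpNorm (f k) q μ ≤ eLpNorm g q μ + eLpNorm (fun x => g x - f k x) q μ := by
    intro k
    refine le_trans (le_of_eq ?_) (eLpNorm_sub_le (f := g)
      (g := fun x => g x - f k x) hg.1 (hg.1.sub (hf k)) hq)
    congr 1
    ext1 x
    simp
  have lo : ∀ k, eLpNorm g q μ - eLpNorm (fun x => g x - f k x) q μ ≤ eLpNorm (f k) q μ := by
    intro k
    rw [tsub_le_iff_left]
    refine le_trans (le_of_eq ?_) (eLpNorm_add_le (f := fun x => g x - f k x)
      (g := f k) (hg.1.sub (hf k)) (hf k) hq)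
    congr 1
    ext1 x
    simp
  refine tendsto_of_tendsto_of_tendsto_of_le_of_le ?_ ?_ lo up
  · simpa using ENNReal.Tendsto.sub tendsto_const_nhds h (Or.inl hg.2.ne)
  · simpa using tendsto_const_nhds.add h

/-- A weighted Lebesgue norm controlled by the Dirichlet norm on test functions is controlled by
it on all of `D^{1,2}(Ω)`. -/
lemma MemD12.eLpNorm_weight_le (hn : 3 ≤ n) {Ω : Set (E n)} {w : E n → ℝ}
    (hw : AEStronglyMeasurable w volume) {q : ℝ≥0∞} {C : ℝ≥0}
    (hC : ∀ φ, IsTestFunction Ω φ →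
      eLpNorm (fun x => w x * φ x) q volume ≤ C * eLpNorm (gradient φ) 2 volume)
    {u : E n → ℝ} {g : E n → E n} (h : MemD12 Ω u g) :
    eLpNorm (fun x => w x * u x) q volume ≤ C * eLpNorm g 2 volume := by
  obtain ⟨φ, hφ, -, h2, h3, -⟩ := h.exists_approx_ae hn
  have hlim : Tendsto (fun k => eLpNorm (gradient (φ k)) 2 volume) atTop
      (𝓝 (eLpNorm g 2 volume)) :=
    tendsto_eLpNorm_of_tendsto_sub (by norm_num) h.memLp_grad
      (fun k => ((hφ k).memLp_gradient 2).1) h2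
  refine le_trans (Lp.eLpNorm_lim_le_liminf_eLpNorm (f := fun k x => w x * φ k x)
    (fun k => hw.mul ((hφ k).memLp 2).1) _ ?_) ?_
  · filter_upwards [h3] with x hx
    exact hx.const_mul _
  · refine le_trans (liminf_le_liminf (Eventually.of_forall fun k => hC _ (hφ k))) ?_
    exact (ENNReal.Tendsto.const_mul hlim (Or.inr (by simp))).liminf_eq.le

lemma MemD12.eLpNorm_sobolev_le (hn : 3 ≤ n) {C : ℝ≥0}
    (hC : ∀ (Ω : Set (E n)) (φ : E n → ℝ), IsTestFunction Ω φ →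
      eLpNorm φ (ENNReal.ofReal (critExp n 0)) volume ≤ C * eLpNorm (gradient φ) 2 volume)
    {Ω : Set (E n)} {u : E n → ℝ} {g : E n → E n} (h : MemD12 Ω u g) :
    eLpNorm u (ENNReal.ofReal (critExp n 0)) volume ≤ C * eLpNorm g 2 volume := by
  simpa using h.eLpNorm_weight_le hn (w := fun _ => 1) aestronglyMeasurable_const
    (q := ENNReal.ofReal (critExp n 0)) (C := C) (fun φ hφ => by simpa using hC Ω φ hφ)

/-! ### `D^{1,2}(Ω)` as a Hilbert space -/

/-- Elements of `D^{1,2}(Ω)` with the same gradient agree. -/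
lemma MemD12.ae_eq_of_grad (hn : 3 ≤ n) {Ω : Set (E n)} {u v : E n → ℝ} {g h : E n → E n}
    (hu : MemD12 Ω u g) (hv : MemD12 Ω v h) (hgh : g =ᵐ[volume] h) : u =ᵐ[volume] v := by
  obtain ⟨C, hC⟩ := exists_sobolev hn
  have h0 : eLpNorm (fun x => g x - h x) 2 volume = 0 := by
    refine (eLpNorm_congr_ae (g := fun _ => (0 : E n)) ?_).trans eLpNorm_zero
    filter_upwards [hgh] with x hx
    simp [hx]
  have h1 := (hu.sub hn hv).eLpNorm_sobolev_le hn hC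
  rw [h0, mul_zero, nonpos_iff_eq_zero, eLpNorm_eq_zero_iff (f := fun x => u x - v x)
    (hu.memLp.1.sub hv.memLp.1)
    (lt_of_lt_of_le one_pos (one_le_ofReal_critExp hn (by norm_num))).ne'] at h1
  filter_upwards [h1] with x hx
  exact sub_eq_zero.1 hx

/-- `D^{1,2}(Ω)`, realised as the space of gradients of its elements in `L²(ℝⁿ; ℝⁿ)`. The function
is determined by the gradient, by the Sobolev inequality, and is recovered by `potential`. -/
noncomputable def gradSpace (hn : 3 ≤ n) (Ω : Set (E n)) :
    Submodule ℝ (Lp (E n) 2 (volume : Measure (E n))) where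
  carrier := {G | ∃ u, MemD12 Ω u G}
  zero_mem' := ⟨fun _ => 0, by
    refine (IsTestFunction.zero Ω).memD12.congr EventuallyEq.rfl ?_
    filter_upwards [Lp.coeFn_zero (E n) 2 (volume : Measure (E n))] with x hx
    rw [hx]
    simp [gradient]⟩
  add_mem' := by
    rintro G H ⟨u, hu⟩ ⟨v, hv⟩
    exact ⟨_, (hu.add hn hv).congr EventuallyEq.rfl (Lp.coeFn_add G H).symm⟩
  smul_mem' := by
    rintro c G ⟨u, hu⟩
    exact ⟨_, (hu.const_mul c).congr EventuallyEq.rfl (Lp.coeFn_smul c G).symm⟩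

/-- If gradients converge in `L²`, their potentials converge in `L^{2⋆(0)}` by the Sobolev
inequality. -/
lemma isClosed_gradSpace (hn : 3 ≤ n) (Ω : Set (E n)) :
    IsClosed (gradSpace hn Ω : Set (Lp (E n) 2 (volume : Measure (E n)))) := by
  have : Fact (1 ≤ ENNReal.ofReal (critExp n 0)) := ⟨one_le_ofReal_critExp hn (by norm_num)⟩
  obtain ⟨C, hC⟩ := exists_sobolev hn
  refine IsSeqClosed.isClosed ?_
  intro G H hG hGH
  choose u hu using hG
  have hlip : ∀ j k, dist ((hu j).memLp.toLp (u j)) ((hu k).memLp.toLp (u k))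
      ≤ C * dist (G j) (G k) := by
    intro j k
    have h1 := ((hu j).sub hn (hu k)).eLpNorm_sobolev_le hn hC
    rw [dist_eq_norm, ← MemLp.toLp_sub, Lp.norm_toLp, dist_eq_norm, Lp.norm_def,
      eLpNorm_congr_ae (Lp.coeFn_sub (G j) (G k))]
    have h2 := ENNReal.toReal_mono (by
      exact ENNReal.mul_ne_top (by simp) ((hu j).memLp_grad.sub (hu k).memLp_grad).2.ne) h1
    simpa [Pi.sub_def] using h2
  have hcau : CauchySeq fun j => (hu j).memLp.toLp (u j) := by
    rw [Metric.cauchySeq_iff]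
    intro ε hε
    obtain ⟨N, hN⟩ := Metric.cauchySeq_iff.1 hGH.cauchySeq (ε / (C + 1)) (by positivity)
    refine ⟨N, fun j hj k hk => (hlip j k).trans_lt ?_⟩
    have := hN j hj k hk
    rw [lt_div_iff₀ (by positivity)] at this
    nlinarith [dist_nonneg (x := G j) (y := G k), C.coe_nonneg]
  obtain ⟨U, hU⟩ := cauchySeq_tendsto_of_complete hcau
  refine ⟨U, MemD12.of_tendsto hn hu (Lp.memLp U) (Lp.memLp H) ?_ ?_⟩
  · have := (Lp.tendsto_Lp_iff_tendsto_eLpNorm' _ _).1 hU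
    refine this.congr fun k => ?_
    rw [← eLpNorm_neg]
    refine eLpNorm_congr_ae ?_
    filter_upwards [(hu k).memLp.coeFn_toLp] with x hx
    simp [hx]
  · have := (Lp.tendsto_Lp_iff_tendsto_eLpNorm' _ _).1 hGH
    refine this.congr fun k => ?_
    rw [← eLpNorm_neg]
    refine eLpNorm_congr_ae (ae_of_all _ fun x => ?_)
    simp

instance (hn : 3 ≤ n) (Ω : Set (E n)) : CompleteSpace (gradSpace hn Ω) :=
  (isClosed_gradSpace hn Ω).completeSpace_coe

/-- The element of `D^{1,2}(Ω)` with a given gradient. -/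
noncomputable def potential {hn : 3 ≤ n} {Ω : Set (E n)} (G : gradSpace hn Ω) : E n → ℝ :=
  Classical.choose G.2

lemma memD12_potential {hn : 3 ≤ n} {Ω : Set (E n)} (G : gradSpace hn Ω) :
    MemD12 Ω (potential G) (G : Lp (E n) 2 (volume : Measure (E n))) :=
  Classical.choose_spec G.2

/-- The point of the Hilbert space `gradSpace` given by an element of `D^{1,2}(Ω)`. -/
noncomputable def MemD12.toGrad (hn : 3 ≤ n) {Ω : Set (E n)} {u : E n → ℝ} {g : E n → E n}
    (h : MemD12 Ω u g) : gradSpace hn Ω :=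
  ⟨h.memLp_grad.toLp g, u, h.congr EventuallyEq.rfl h.memLp_grad.coeFn_toLp.symm⟩

lemma MemD12.coeFn_toGrad (hn : 3 ≤ n) {Ω : Set (E n)} {u : E n → ℝ} {g : E n → E n}
    (h : MemD12 Ω u g) :
    ((h.toGrad hn : gradSpace hn Ω) : Lp (E n) 2 (volume : Measure (E n))) =ᵐ[volume] g :=
  h.memLp_grad.coeFn_toLp

lemma MemD12.potential_toGrad (hn : 3 ≤ n) {Ω : Set (E n)} {u : E n → ℝ} {g : E n → E n}
    (h : MemD12 Ω u g) : potential (h.toGrad hn) =ᵐ[volume] u :=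
  (memD12_potential _).ae_eq_of_grad hn h (h.coeFn_toGrad hn)

/-- The set of gradients of test functions is dense in `gradSpace`. -/
lemma dense_testFunctions (hn : 3 ≤ n) (Ω : Set (E n)) {p : gradSpace hn Ω → Prop}
    (hp : IsClosed {G | p G}) (htest : ∀ φ (hφ : IsTestFunction Ω φ), p (hφ.memD12.toGrad hn))
    (G : gradSpace hn Ω) : p G := by
  obtain ⟨φ, hφ, -, h2⟩ := (memD12_potential G).approx
  have hlim : Tendsto (fun k => (hφ k).memD12.toGrad hn) atTop (𝓝 G) := by
    rw [tendsto_subtype_rng, Lp.tendsto_Lp_iff_tendsto_eLpNorm']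
    refine h2.congr fun k => ?_
    rw [← eLpNorm_neg]
    refine eLpNorm_congr_ae ?_
    filter_upwards [(hφ k).memD12.coeFn_toGrad hn] with x hx
    simp [hx]
  exact hp.mem_of_tendsto hlim (Eventually.of_forall fun k => htest _ (hφ k))

/-- The weighted norm `‖w u‖_{L^q}` is controlled by the Dirichlet norm on test functions. -/
structure Controlled (Ω : Set (E n)) (w : E n → ℝ) (q : ℝ≥0∞) : Prop where
  meas : AEStronglyMeasurable w volume
  bound : ∃ C : ℝ≥0, ∀ φ, IsTestFunction Ω φ →
      eLpNorm (fun x => w x * φ x) q volume ≤ C * eLpNorm (gradient φ) 2 volume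

lemma Controlled.memLp (hn : 3 ≤ n) {Ω : Set (E n)} {w : E n → ℝ} {q : ℝ≥0∞}
    (hw : Controlled Ω w q) {u : E n → ℝ} {g : E n → E n} (h : MemD12 Ω u g) :
    MemLp (fun x => w x * u x) q volume := by
  obtain ⟨C, hC⟩ := hw.bound
  exact ⟨hw.meas.mul h.memLp.1, (h.eLpNorm_weight_le hn hw.meas hC).trans_lt
    (ENNReal.mul_lt_top (by simp) h.memLp_grad.2)⟩

/-- The continuous linear map `u ↦ w u` from `D^{1,2}(Ω)` to `L^q`. -/
noncomputable def weightMap {hn : 3 ≤ n} {Ω : Set (E n)} {w : E n → ℝ} {q : ℝ≥0∞} [Fact (1 ≤ q)]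
    (hw : Controlled Ω w q) : gradSpace hn Ω →L[ℝ] Lp ℝ q (volume : Measure (E n)) :=
  LinearMap.mkContinuous
    { toFun := fun G => (hw.memLp hn (memD12_potential G)).toLp _
      map_add' := by
        intro G H
        rw [← MemLp.toLp_add]
        refine MemLp.toLp_congr _ _ ?_
        have := (memD12_potential (G + H)).ae_eq_of_grad hn
          ((memD12_potential G).add hn (memD12_potential H)) (Lp.coeFn_add _ _)
        filter_upwards [this] with x hx
        simp only [hx, Pi.add_apply]
        ring
      map_smul' := by
        intro c G
        rw [RingHom.id_apply, ← MemLp.toLp_const_smul]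
        refine MemLp.toLp_congr _ _ ?_
        have := (memD12_potential (c • G)).ae_eq_of_grad hn
          ((memD12_potential G).const_mul c) (Lp.coeFn_smul _ _)
        filter_upwards [this] with x hx
        simp only [hx, Pi.smul_apply, smul_eq_mul]
        ring }
    (Classical.choose hw.bound : ℝ≥0) (by
      intro G
      have h1 := (memD12_potential G).eLpNorm_weight_le hn hw.meas (Classical.choose_spec hw.bound)
      have h2 := ENNReal.toReal_mono (ENNReal.mul_ne_top (by simp) (Lp.memLp G.1).2.ne) h1
      rw [ENNReal.toReal_mul] at h2
      change ‖(hw.memLp hn (memD12_potential G)).toLp _‖ ≤ _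
      rw [Lp.norm_toLp, Submodule.coe_norm, Lp.norm_def]
      simpa using h2)

lemma coeFn_weightMap {hn : 3 ≤ n} {Ω : Set (E n)} {w : E n → ℝ} {q : ℝ≥0∞} [Fact (1 ≤ q)]
    (hw : Controlled Ω w q) (G : gradSpace hn Ω) :
    weightMap hw G =ᵐ[volume] fun x => w x * potential G x :=
  (hw.memLp hn (memD12_potential G)).coeFn_toLp

lemma MemD12.coeFn_weightMap (hn : 3 ≤ n) {Ω : Set (E n)} {w : E n → ℝ} {q : ℝ≥0∞}
    [Fact (1 ≤ q)] (hw : Controlled Ω w q) {u : E n → ℝ} {g : E n → E n} (h : MemD12 Ω u g) :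
    weightMap hw (h.toGrad hn) =ᵐ[volume] fun x => w x * u x := by
  filter_upwards [HardySchrodinger.coeFn_weightMap hw (h.toGrad hn), h.potential_toGrad hn]
    with x h1 h2
  rw [h1, h2]

/-- Bounded sequences in a separable Hilbert space have weakly convergent subsequences. -/
lemma exists_weakly_convergent_subseq {H : Type*} [NormedAddCommGroup H] [InnerProductSpace ℝ H]
    [CompleteSpace H] [TopologicalSpace.SeparableSpace H] {x : ℕ → H} {R : ℝ}
    (hx : ∀ k, ‖x k‖ ≤ R) :
    ∃ y : H, ∃ a : ℕ → ℕ, StrictMono a ∧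
      ∀ z : H, Tendsto (fun k => ⟪x (a k), z⟫_ℝ) atTop (𝓝 ⟪y, z⟫_ℝ) := by
  have hcomp := WeakDual.isSeqCompact_closedBall (𝕜 := ℝ) (E := H) 0 R
  obtain ⟨ℓ, -, a, ha, hlim⟩ := hcomp (x := fun k =>
    StrongDual.toWeakDual (InnerProductSpace.toDual ℝ H (x k))) (by
      intro k
      simpa using hx k)
  refine ⟨(InnerProductSpace.toDual ℝ H).symm (WeakDual.toStrongDual ℓ), a, ha, fun z => ?_⟩
  have h1 := ((WeakDual.eval_continuous z).tendsto ℓ).comp hlim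
  rw [InnerProductSpace.toDual_symm_apply]
  exact h1

/-! ### Integrals of test functions -/

lemma IsTestFunction.continuous_mul {Ω : Set (E n)} (hΩ : IsOpen Ω) {φ : E n → ℝ}
    (hφ : IsTestFunction Ω φ) {c f : E n → ℝ} (hc : ContinuousOn c Ω) (hf : Continuous f)
    (hf0 : ∀ x, φ x = 0 → f x = 0) : Continuous (fun x => f x * c x) := by
  have hsub : tsupport f ⊆ tsupport φ :=
    closure_mono fun x hx h0 => hx (hf0 x h0)
  refine continuous_of_tsupport fun x hx => ?_
  have hxΩ : x ∈ Ω := hφ.support_subset (hsub (tsupport_mul_subset_left hx))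
  exact hf.continuousAt.mul ((hc x hxΩ).continuousAt (hΩ.mem_nhds hxΩ))

lemma IsTestFunction.integrable_mul {Ω : Set (E n)} (hΩ : IsOpen Ω) {φ : E n → ℝ}
    (hφ : IsTestFunction Ω φ) {c f : E n → ℝ} (hc : ContinuousOn c Ω) (hf : Continuous f)
    (hf0 : ∀ x, φ x = 0 → f x = 0) : Integrable (fun x => f x * c x) := by
  refine (hφ.continuous_mul hΩ hc hf hf0).integrable_of_hasCompactSupport ?_
  refine HasCompactSupport.mul_right ?_
  exact hφ.compact.mono fun x hx h0 => hx (hf0 x h0)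

/-- The Dirichlet energy `∫ |∇φ|²`. -/
noncomputable def dirichletEnergy (φ : E n → ℝ) : ℝ := ∫ x, ‖gradient φ x‖ ^ 2

/-- The Hardy term `∫ φ² / |x|²`. -/
noncomputable def hardyTerm (φ : E n → ℝ) : ℝ := ∫ x, φ x ^ 2 / ‖x‖ ^ 2

/-- The Hardy-Sobolev term `∫ |φ|^{2⋆(s)} / |x|^s`. -/
noncomputable def hsTerm (s : ℝ) (φ : E n → ℝ) : ℝ := ∫ x, |φ x| ^ critExp n s / ‖x‖ ^ s

/-- The mass `∫ φ²`. -/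
noncomputable def massTerm (φ : E n → ℝ) : ℝ := ∫ x, φ x ^ 2

lemma dirichletEnergy_nonneg (φ : E n → ℝ) : 0 ≤ dirichletEnergy φ :=
  integral_nonneg fun _ => by positivity

lemma hardyTerm_nonneg (φ : E n → ℝ) : 0 ≤ hardyTerm φ :=
  integral_nonneg fun _ => by positivity

lemma hsTerm_nonneg (s : ℝ) (φ : E n → ℝ) : 0 ≤ hsTerm s φ :=
  integral_nonneg fun _ => by positivity

lemma massTerm_nonneg (φ : E n → ℝ) : 0 ≤ massTerm φ :=
  integral_nonneg fun _ => by positivity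

namespace IsTestFunction

variable {Ω : Set (E n)} {φ : E n → ℝ}

lemma integrable_dirichlet (h : IsTestFunction Ω φ) :
    Integrable (fun x => ‖gradient φ x‖ ^ 2) := by
  refine (h.continuous_gradient.norm.pow 2).integrable_of_hasCompactSupport ?_
  exact h.hasCompactSupport_gradient.mono fun x hx h0 => hx (by simp [h0])

lemma integrable_mass (h : IsTestFunction Ω φ) : Integrable (fun x => φ x ^ 2) := by
  refine (h.smooth.continuous.pow 2).integrable_of_hasCompactSupport ?_
  exact h.compact.mono fun x hx h0 => hx (by simp [h0])

lemma integrable_hardy (hΩ : IsOpen Ω) (h0 : (0 : E n) ∉ Ω) (h : IsTestFunction Ω φ) :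
    Integrable (fun x => φ x ^ 2 / ‖x‖ ^ 2) := by
  have := h.integrable_mul hΩ (c := fun x => (‖x‖ ^ 2)⁻¹) (f := fun x => φ x ^ 2)
    (ContinuousOn.inv₀ (by fun_prop) fun x hx => by
      have : x ≠ 0 := fun h => h0 (h ▸ hx)
      positivity) (h.smooth.continuous.pow 2) (fun x hx => by simp [hx])
  simpa [div_eq_mul_inv] using this

lemma continuousOn_norm_rpow (h0 : (0 : E n) ∉ Ω) (t : ℝ) :
    ContinuousOn (fun x : E n => ‖x‖ ^ t) Ω := by
  refine ContinuousOn.rpow_const (by fun_prop) fun x hx => Or.inl ?_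
  have : x ≠ 0 := fun h => h0 (h ▸ hx)
  positivity

lemma integrable_hs (hn : 3 ≤ n) {s : ℝ} (hs2 : s ≤ 2) (hΩ : IsOpen Ω) (h0 : (0 : E n) ∉ Ω)
    (h : IsTestFunction Ω φ) : Integrable (fun x => |φ x| ^ critExp n s / ‖x‖ ^ s) := by
  have hp := critExp_pos hn hs2
  have := h.integrable_mul hΩ (c := fun x => ‖x‖ ^ (-s)) (f := fun x => |φ x| ^ critExp n s)
    (continuousOn_norm_rpow h0 (-s))
    (h.smooth.continuous.abs.rpow_const fun x => Or.inr hp.le)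
    (fun x hx => by simp [hx, hp.ne'])
  refine this.congr (ae_of_all _ fun x => ?_)
  simp [div_eq_mul_inv, Real.rpow_neg (norm_nonneg x)]

end IsTestFunction

/-! ### Hardy inequalities -/

lemma integral_fderiv_eq_zero_of_hasCompactSupport {f : E n → ℝ} (hf : ContDiff ℝ 1 f)
    (hc : HasCompactSupport f) (v : E n) : ∫ x, fderiv ℝ f x v = 0 := by
  have hint : Integrable (fun x => fderiv ℝ f x v) := by
    refine Continuous.integrable_of_hasCompactSupport ?_ ?_
    · exact (hf.continuous_fderiv (by simp)).clm_apply continuous_const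
    · exact (hc.fderiv (𝕜 := ℝ)).comp_left (g := fun L : E n →L[ℝ] ℝ => L v) (by simp)
  have := integral_mul_fderiv_eq_neg_fderiv_mul_of_integrable (μ := (volume : Measure (E n)))
    (f := fun _ : E n => (1 : ℝ)) (g := f) (v := v) (by simp) (by simpa using hint)
    (by simpa using hf.continuous.integrable_of_hasCompactSupport hc)
    (fun _ _ => by fun_prop) (fun x _ => hf.differentiable (by simp) x)
  simpa using this

/-- Integrating `|∇φ + φ F|² ≥ 0` by parts: a vector field `F` gives the Hardy-type inequality with
weight `div F - |F|²`. -/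
lemma IsTestFunction.integral_mul_le_of_vectorField {Ω : Set (E n)} (hΩ : IsOpen Ω)
    {φ : E n → ℝ} (hφ : IsTestFunction Ω φ) {F : E n → E n} {F' : E n → E n →L[ℝ] E n}
    (hF : ContDiffOn ℝ 1 F Ω) (hF' : ∀ x ∈ Ω, HasFDerivAt F (F' x) x) {c : E n → ℝ}
    (hc : ContinuousOn c Ω)
    (hcF : ∀ x ∈ Ω, c x = (∑ i, F' x (EuclideanSpace.single i 1) i) - ‖F x‖ ^ 2) :
    ∫ x, φ x ^ 2 * c x ≤ dirichletEnergy φ := by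
  set f : Fin n → E n → ℝ := fun i x => φ x ^ 2 * F x i with hf
  have hsupp : ∀ i, tsupport (f i) ⊆ tsupport φ := fun i =>
    closure_mono fun x hx h0 => hx (by simp only [hf]; rw [h0]; ring)
  have hfc : ∀ i, HasCompactSupport (f i) := fun i =>
    hφ.compact.mono' (subset_closure.trans (hsupp i))
  have hfs : ∀ i, ContDiff ℝ 1 (f i) := by
    intro i
    rw [contDiff_iff_contDiffAt]
    intro x
    by_cases hx : x ∈ tsupport (f i)
    · have hxΩ := hφ.support_subset (hsupp i hx)
      have h1 : ContDiffAt ℝ 1 F x := hF.contDiffAt (hΩ.mem_nhds hxΩ)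
      have h2 : ContDiffAt ℝ 1 (fun x => F x i) x :=
        (contDiffAt_euclidean.1 h1) i
      exact ((hφ.smooth.of_le (by simp)).contDiffAt.pow 2).mul h2
    · exact contDiffAt_const.congr_of_eventuallyEq (notMem_tsupport_iff_eventuallyEq.1 hx)
  have hint : ∀ i, Integrable (fun x => fderiv ℝ (f i) x (EuclideanSpace.single i 1)) := by
    intro i
    refine Continuous.integrable_of_hasCompactSupport ?_ ?_
    · exact ((hfs i).continuous_fderiv (by simp)).clm_apply continuous_const
    · exact ((hfc i).fderiv (𝕜 := ℝ)).comp_left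
        (g := fun L : E n →L[ℝ] ℝ => L (EuclideanSpace.single i 1)) (by simp)
  have hpt : ∀ x, φ x ^ 2 * c x ≤ ‖gradient φ x‖ ^ 2 +
      ∑ i, fderiv ℝ (f i) x (EuclideanSpace.single i 1) := by
    intro x
    by_cases hx : x ∈ tsupport φ
    · have hxΩ := hφ.support_subset hx
      have hd : ∀ i, fderiv ℝ (f i) x (EuclideanSpace.single i 1) =
          2 * φ x * (gradient φ x i * F x i) + φ x ^ 2 * F' x (EuclideanSpace.single i 1) i := by
        intro i
        have h1 : HasFDerivAt (fun x => F x i)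
            ((EuclideanSpace.proj i : E n →L[ℝ] ℝ).comp (F' x)) x :=
          (EuclideanSpace.proj i : E n →L[ℝ] ℝ).hasFDerivAt.comp x (hF' x hxΩ)
        have h2 : HasFDerivAt (f i) _ x := ((hφ.differentiableAt x).hasFDerivAt.pow 2).mul h1
        have h3 : gradient φ x i = fderiv ℝ φ x (EuclideanSpace.single i 1) := by
          rw [← inner_gradient_left, EuclideanSpace.inner_single_right]
          simp
        rw [h2.fderiv, h3]
        simp
        ring
      have hin : ⟪gradient φ x, F x⟫_ℝ = ∑ i, gradient φ x i * F x i := by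
        rw [PiLp.inner_apply]
        exact Finset.sum_congr rfl fun i _ => by simp [mul_comm]
      have hsq := norm_add_sq_real (gradient φ x) (φ x • F x)
      rw [inner_smul_right, norm_smul, mul_pow, Real.norm_eq_abs, sq_abs, hin] at hsq
      rw [hcF x hxΩ, Finset.sum_congr rfl fun i _ => hd i, Finset.sum_add_distrib,
        ← Finset.mul_sum, ← Finset.mul_sum]
      nlinarith [sq_nonneg ‖gradient φ x + φ x • F x‖]
    · have h1 : φ x = 0 := image_eq_zero_of_notMem_tsupport hx
      have h2 : ∀ i, fderiv ℝ (f i) x = 0 := fun i =>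
        image_eq_zero_of_notMem_tsupport fun h' => hx (hsupp i (tsupport_fderiv_subset ℝ h'))
      simp [h1, h2]
  have h1 : ∫ x, (‖gradient φ x‖ ^ 2 + ∑ i, fderiv ℝ (f i) x (EuclideanSpace.single i 1)) =
      dirichletEnergy φ := by
    rw [integral_add hφ.integrable_dirichlet (integrable_finsetSum _ fun i _ => hint i),
      integral_finsetSum _ fun i _ => hint i,
      Finset.sum_eq_zero fun i _ =>
        integral_fderiv_eq_zero_of_hasCompactSupport (hfs i) (hfc i) _]
    simp [dirichletEnergy]
  rw [← h1]
  refine integral_mono ?_ (hφ.integrable_dirichlet.add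
    (integrable_finsetSum _ fun i _ => hint i)) hpt
  exact hφ.integrable_mul hΩ hc (hφ.smooth.continuous.pow 2) (fun x hx => by simp [hx])

/-- The derivative of the radial field `x / |x|²`. -/
noncomputable def radialFieldDeriv (x : E n) : E n →L[ℝ] E n :=
  (‖x‖ ^ 2)⁻¹ • ContinuousLinearMap.id ℝ (E n) +
    (-((‖x‖ ^ 2) ^ 2)⁻¹ • (2 • innerSL ℝ x)).smulRight x

lemma hasFDerivAt_radialField {x : E n} (hx : x ≠ 0) :
    HasFDerivAt (fun x : E n => (‖x‖ ^ 2)⁻¹ • x) (radialFieldDeriv x) x := by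
  have h1 : HasFDerivAt (fun x : E n => ‖x‖ ^ 2) (2 • innerSL ℝ x) x :=
    (hasStrictFDerivAt_norm_sq x).hasFDerivAt
  have hx2 : ‖x‖ ^ 2 ≠ 0 := by positivity
  have h2 := (hasDerivAt_inv hx2).comp_hasFDerivAt x h1
  exact h2.smul (hasFDerivAt_id x)

lemma sum_radialFieldDeriv {x : E n} (hx : x ≠ 0) :
    ∑ i, radialFieldDeriv x (EuclideanSpace.single i 1) i = ((n : ℝ) - 2) / ‖x‖ ^ 2 := by
  have hx2 : ‖x‖ ^ 2 ≠ 0 := by positivity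
  have h1 : ∀ i, radialFieldDeriv x (EuclideanSpace.single i 1) i =
      (‖x‖ ^ 2)⁻¹ - 2 * ((‖x‖ ^ 2) ^ 2)⁻¹ * (x i) ^ 2 := by
    intro i
    simp [radialFieldDeriv, EuclideanSpace.inner_single_right]
    ring
  have h2 : ∑ i, (x i) ^ 2 = ‖x‖ ^ 2 := by
    rw [EuclideanSpace.norm_sq_eq]
    simp
  rw [Finset.sum_congr rfl fun i _ => h1 i, Finset.sum_sub_distrib, ← Finset.mul_sum, h2]
  simp
  field_simp

lemma contDiffOn_radialField {Ω : Set (E n)} (h0 : (0 : E n) ∉ Ω) :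
    ContDiffOn ℝ 1 (fun x : E n => (‖x‖ ^ 2)⁻¹ • x) Ω := by
  refine ContDiffOn.smul (ContDiffOn.inv (contDiff_norm_sq ℝ).contDiffOn fun x hx => ?_)
    contDiffOn_id
  have : x ≠ 0 := fun h => h0 (h ▸ hx)
  positivity

lemma continuousOn_div_norm_sq {Ω : Set (E n)} (h0 : (0 : E n) ∉ Ω) (a : ℝ) :
    ContinuousOn (fun x : E n => a / ‖x‖ ^ 2) Ω := by
  refine ContinuousOn.div continuousOn_const (by fun_prop) fun x hx => ?_
  have : x ≠ 0 := fun h => h0 (h ▸ hx)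
  positivity

/-- The classical Hardy inequality. -/
lemma IsTestFunction.hardy {Ω : Set (E n)} (hΩ : IsOpen Ω) (h0 : (0 : E n) ∉ Ω) {φ : E n → ℝ}
    (hφ : IsTestFunction Ω φ) : ((n : ℝ) - 2) ^ 2 / 4 * hardyTerm φ ≤ dirichletEnergy φ := by
  have key := hφ.integral_mul_le_of_vectorField hΩ
    (F := fun x => (((n : ℝ) - 2) / 2) • ((‖x‖ ^ 2)⁻¹ • x))
    (F' := fun x => (((n : ℝ) - 2) / 2) • radialFieldDeriv x)
    (c := fun x => (((n : ℝ) - 2) ^ 2 / 4) / ‖x‖ ^ 2)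
    ((contDiffOn_radialField h0).const_smul _)
    (fun x hx => (hasFDerivAt_radialField fun h => h0 (h ▸ hx)).fun_const_smul _)
    (continuousOn_div_norm_sq h0 _) (by
      intro x hx
      have hx0 : x ≠ 0 := fun h => h0 (h ▸ hx)
      have hx2 : ‖x‖ ≠ 0 := by positivity
      have h1 : ∑ i, ((((n : ℝ) - 2) / 2) • radialFieldDeriv x) (EuclideanSpace.single i 1) i =
          ((n : ℝ) - 2) / 2 * (((n : ℝ) - 2) / ‖x‖ ^ 2) := by
        rw [← sum_radialFieldDeriv hx0, Finset.mul_sum]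
        exact Finset.sum_congr rfl fun i _ => by simp
      rw [h1, norm_smul, norm_smul, mul_pow, mul_pow]
      simp only [norm_inv, norm_pow, Real.norm_eq_abs, sq_abs]
      field_simp
      ring)
  refine le_trans (le_of_eq ?_) key
  rw [hardyTerm, ← integral_const_mul]
  refine integral_congr_ae (ae_of_all _ fun x => ?_)
  simp only
  ring

lemma isOpen_halfSpace [NeZero n] : IsOpen (halfSpace n) :=
  isOpen_lt continuous_const (by fun_prop)

lemma zero_notMem_halfSpace [NeZero n] : (0 : E n) ∉ halfSpace n := by
  simp [halfSpace]

/-- The derivative of `(n / 2) x / |x|² - e₁ / x₁`. -/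
noncomputable def halfSpaceFieldDeriv [NeZero n] (x : E n) : E n →L[ℝ] E n :=
  ((n : ℝ) / 2) • radialFieldDeriv x -
    (-((x 0) ^ 2)⁻¹ • (EuclideanSpace.proj 0 : E n →L[ℝ] ℝ)).smulRight
      (EuclideanSpace.single 0 1)

lemma hasFDerivAt_halfSpaceField [NeZero n] {x : E n} (hx : x ∈ halfSpace n) :
    HasFDerivAt (fun x : E n =>
      ((n : ℝ) / 2) • ((‖x‖ ^ 2)⁻¹ • x) - (x 0)⁻¹ • EuclideanSpace.single 0 (1 : ℝ))
      (halfSpaceFieldDeriv x) x := by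
  have h1 : HasFDerivAt (fun x : E n => ((n : ℝ) / 2) • ((‖x‖ ^ 2)⁻¹ • x))
      (((n : ℝ) / 2) • radialFieldDeriv x) x :=
    (hasFDerivAt_radialField fun h => zero_notMem_halfSpace (h ▸ hx)).fun_const_smul _
  have h2 : HasFDerivAt (fun x : E n => (x 0)⁻¹)
      (-((x 0) ^ 2)⁻¹ • (EuclideanSpace.proj 0 : E n →L[ℝ] ℝ)) x :=
    (hasDerivAt_inv (ne_of_gt hx)).comp_hasFDerivAt x
      (EuclideanSpace.proj 0 : E n →L[ℝ] ℝ).hasFDerivAt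
  exact h1.fun_sub (h2.smul_const _)

lemma sum_halfSpaceFieldDeriv [NeZero n] {x : E n} (hx : x ∈ halfSpace n) :
    ∑ i, halfSpaceFieldDeriv x (EuclideanSpace.single i 1) i =
      (n : ℝ) / 2 * (((n : ℝ) - 2) / ‖x‖ ^ 2) + ((x 0) ^ 2)⁻¹ := by
  have hx0 : x ≠ 0 := fun h => zero_notMem_halfSpace (h ▸ hx)
  have h1 : ((x 0) ^ 2)⁻¹ = ∑ i : Fin n, if i = 0 then ((x 0) ^ 2)⁻¹ else 0 := by simp
  rw [← sum_radialFieldDeriv hx0, Finset.mul_sum, h1, ← Finset.sum_add_distrib]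
  refine Finset.sum_congr rfl fun i _ => ?_
  by_cases hi : i = 0
  · subst hi
    simp [halfSpaceFieldDeriv]
  · simp [halfSpaceFieldDeriv, hi, Ne.symm hi]

lemma norm_sq_halfSpaceField [NeZero n] {x : E n} (hx : x ∈ halfSpace n) :
    ‖((n : ℝ) / 2) • ((‖x‖ ^ 2)⁻¹ • x) - (x 0)⁻¹ • EuclideanSpace.single 0 (1 : ℝ)‖ ^ 2 =
      ((n : ℝ) ^ 2 / 4 - n) / ‖x‖ ^ 2 + ((x 0) ^ 2)⁻¹ := by
  have hx0 : x ≠ 0 := fun h => zero_notMem_halfSpace (h ▸ hx)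
  have hx2 : ‖x‖ ≠ 0 := by positivity
  have hx1 : x 0 ≠ 0 := ne_of_gt hx
  rw [norm_sub_sq_real, smul_smul, real_inner_smul_left, real_inner_smul_right,
    EuclideanSpace.inner_single_right, norm_smul, norm_smul, mul_pow, mul_pow]
  simp only [Real.norm_eq_abs, sq_abs, PiLp.norm_single, norm_one]
  simp
  field_simp
  ring

/-- The Hardy inequality on the half-space, with constant `n² / 4`: the field is `-∇w / w` for the
positive solution `w = x₁ |x|^{-n/2}` of `-Δw = (n² / 4) w / |x|²`. -/
lemma IsTestFunction.hardy_halfSpace [NeZero n] {φ : E n → ℝ}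
    (hφ : IsTestFunction (halfSpace n) φ) : (n : ℝ) ^ 2 / 4 * hardyTerm φ ≤ dirichletEnergy φ := by
  have h0 := zero_notMem_halfSpace (n := n)
  have hsm : ContDiffOn ℝ 1 (fun x : E n =>
      ((n : ℝ) / 2) • ((‖x‖ ^ 2)⁻¹ • x) - (x 0)⁻¹ • EuclideanSpace.single 0 (1 : ℝ))
      (halfSpace n) := by
    have h1 : ContDiffOn ℝ 1 (fun x : E n => (x 0)⁻¹) (halfSpace n) :=
      ContDiffOn.inv (f := fun x : E n => x 0)
        (EuclideanSpace.proj 0 : E n →L[ℝ] ℝ).contDiff.contDiffOn fun x hx => ne_of_gt hx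
    exact ((contDiffOn_radialField h0).const_smul _).sub (h1.smul contDiffOn_const)
  have key := hφ.integral_mul_le_of_vectorField isOpen_halfSpace hsm
    (fun x hx => hasFDerivAt_halfSpaceField hx)
    (c := fun x => ((n : ℝ) ^ 2 / 4) / ‖x‖ ^ 2) (continuousOn_div_norm_sq h0 _) (by
      intro x hx
      rw [sum_halfSpaceFieldDeriv hx, norm_sq_halfSpaceField hx]
      ring)
  refine le_trans (le_of_eq ?_) key
  rw [hardyTerm, ← integral_const_mul]
  refine integral_congr_ae (ae_of_all _ fun x => ?_)
  simp only
  ring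

/-! ### Hardy-Sobolev inequalities -/

/-- Hölder's inequality with conjugate exponents `1 / θ` and `1 / (1 - θ)`. -/
lemma integral_rpow_mul_rpow_le {α : Type*} [MeasurableSpace α] {μ : Measure α} {f h : α → ℝ}
    (hf : Integrable f μ) (hh : Integrable h μ) (hf0 : ∀ x, 0 ≤ f x) (hh0 : ∀ x, 0 ≤ h x)
    {θ : ℝ} (hθ0 : 0 ≤ θ) (hθ1 : θ ≤ 1) :
    ∫ x, f x ^ θ * h x ^ (1 - θ) ∂μ ≤ (∫ x, f x ∂μ) ^ θ * (∫ x, h x ∂μ) ^ (1 - θ) := by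
  have h1 : AEStronglyMeasurable (fun x => f x ^ θ * h x ^ (1 - θ)) μ :=
    ((hf.1.aemeasurable.pow_const θ).mul (hh.1.aemeasurable.pow_const _)).aestronglyMeasurable
  have key := ENNReal.lintegral_mul_norm_pow_le (μ := μ) (f := fun x => ENNReal.ofReal (f x))
    (g := fun x => ENNReal.ofReal (h x)) hf.1.aemeasurable.ennreal_ofReal
    hh.1.aemeasurable.ennreal_ofReal hθ0 (sub_nonneg.2 hθ1) (by ring)
  rw [← ofReal_integral_eq_lintegral_ofReal hf (ae_of_all _ hf0),
    ← ofReal_integral_eq_lintegral_ofReal hh (ae_of_all _ hh0),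
    ENNReal.ofReal_rpow_of_nonneg (integral_nonneg hf0) hθ0,
    ENNReal.ofReal_rpow_of_nonneg (integral_nonneg hh0) (sub_nonneg.2 hθ1),
    ← ENNReal.ofReal_mul (Real.rpow_nonneg (integral_nonneg hf0) _)] at key
  rw [integral_eq_lintegral_of_nonneg_ae (ae_of_all _ fun x =>
    mul_nonneg (Real.rpow_nonneg (hf0 x) _) (Real.rpow_nonneg (hh0 x) _)) h1]
  refine ENNReal.toReal_le_of_le_ofReal (mul_nonneg (Real.rpow_nonneg (integral_nonneg hf0) _)
    (Real.rpow_nonneg (integral_nonneg hh0) _)) (le_trans (le_of_eq ?_) key)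
  refine lintegral_congr fun x => ?_
  rw [ENNReal.ofReal_rpow_of_nonneg (hf0 x) hθ0,
    ENNReal.ofReal_rpow_of_nonneg (hh0 x) (sub_nonneg.2 hθ1),
    ← ENNReal.ofReal_mul (Real.rpow_nonneg (hf0 x) _)]

lemma toReal_eLpNorm_rpow {α F : Type*} [MeasurableSpace α] [NormedAddCommGroup F]
    {μ : Measure α} {f : α → F} {p : ℝ}
    (hp : 0 < p) (hf : MemLp f (ENNReal.ofReal p) μ) :
    (eLpNorm f (ENNReal.ofReal p) μ).toReal ^ p = ∫ x, ‖f x‖ ^ p ∂μ := by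
  have h0 : 0 ≤ ∫ x, ‖f x‖ ^ p ∂μ := integral_nonneg fun x => by positivity
  rw [hf.eLpNorm_eq_integral_rpow_norm (by simpa using hp) (by simp),
    ENNReal.toReal_ofReal hp.le, ENNReal.toReal_ofReal (Real.rpow_nonneg h0 _),
    ← Real.rpow_mul h0, inv_mul_cancel₀ hp.ne', Real.rpow_one]

lemma toReal_eLpNorm_two_sq {α F : Type*} [MeasurableSpace α] [NormedAddCommGroup F]
    {μ : Measure α} {f : α → F}
    (hf : MemLp f 2 μ) : (eLpNorm f 2 μ).toReal ^ 2 = ∫ x, ‖f x‖ ^ 2 ∂μ := by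
  have := toReal_eLpNorm_rpow (p := 2) (by norm_num) (by simpa using hf)
  simpa using this

lemma hardySobolev_weight_rpow {p : ℝ} (hp : 0 < p) (s t : ℝ) (x : E n) :
    ‖‖x‖ ^ (-s / p) * t‖ ^ p = |t| ^ p / ‖x‖ ^ s := by
  rw [norm_mul, Real.mul_rpow (norm_nonneg _) (norm_nonneg _), Real.norm_eq_abs, Real.norm_eq_abs,
    abs_of_nonneg (by positivity : 0 ≤ ‖x‖ ^ (-s / p)), ← Real.rpow_mul (norm_nonneg x),
    div_mul_cancel₀ _ hp.ne', Real.rpow_neg (norm_nonneg x)]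
  ring

namespace IsTestFunction

variable {Ω : Set (E n)} {φ : E n → ℝ}

lemma dirichletEnergy_eq (h : IsTestFunction Ω φ) :
    dirichletEnergy φ = (eLpNorm (gradient φ) 2 volume).toReal ^ 2 :=
  (toReal_eLpNorm_two_sq (h.memLp_gradient 2)).symm

/-- Hölder interpolation between the Hardy and the Sobolev terms. -/
lemma hsTerm_le (hn : 3 ≤ n) {s : ℝ} (hs0 : 0 ≤ s) (hs2 : s ≤ 2) (hΩ : IsOpen Ω)
    (h0 : (0 : E n) ∉ Ω) (h : IsTestFunction Ω φ) :
    hsTerm s φ ≤ hardyTerm φ ^ (s / 2) * hsTerm 0 φ ^ (1 - s / 2) := by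
  refine le_trans ?_ (integral_rpow_mul_rpow_le (h.integrable_hardy hΩ h0)
    (h.integrable_hs hn (by norm_num) hΩ h0) (fun x => by positivity) (fun x => by positivity)
    (by linarith) (by linarith))
  refine le_of_eq (integral_congr_ae (ae_of_all _ fun x => ?_))
  have hp := critExp_pos hn hs2
  have hq := critExp_pos (n := n) hn (s := 0) (by norm_num)
  simp only
  by_cases hφ : φ x = 0
  · rw [hφ, abs_zero, Real.zero_rpow hp.ne', Real.zero_rpow hq.ne']
    rcases hs0.eq_or_lt with rfl | hs
    · simp
    · simp only [ne_eq, OfNat.ofNat_ne_zero, not_false_eq_true, zero_pow, zero_div,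
        Real.zero_rpow (by positivity : s / 2 ≠ 0), zero_mul]
  · have hx : x ≠ 0 := by
      rintro rfl
      exact hφ (h.eq_zero h0)
    have hx' : 0 < ‖x‖ := by positivity
    have hφ' : 0 < |φ x| := abs_pos.2 hφ
    rw [Real.rpow_zero, div_one, Real.div_rpow (by positivity) (by positivity), ← sq_abs,
      ← Real.rpow_natCast, ← Real.rpow_natCast, ← Real.rpow_mul hφ'.le, ← Real.rpow_mul hx'.le,
      ← Real.rpow_mul hφ'.le, critExp_interpolation hn s, Real.rpow_add hφ']
    have e : ((2 : ℕ) : ℝ) * (s / 2) = s := by push_cast; ring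
    rw [e]
    ring

lemma hsTerm_zero_eq (hn : 3 ≤ n) (h : IsTestFunction Ω φ) :
    hsTerm 0 φ = (eLpNorm φ (ENNReal.ofReal (critExp n 0)) volume).toReal ^ critExp n 0 := by
  rw [toReal_eLpNorm_rpow (critExp_pos hn (by norm_num)) (h.memLp _)]
  simp [hsTerm]

end IsTestFunction

lemma exists_sobolev_real (hn : 3 ≤ n) : ∃ C : ℝ, 0 < C ∧ ∀ (Ω : Set (E n)) (φ : E n → ℝ),
    IsTestFunction Ω φ → hsTerm 0 φ ≤ (C * dirichletEnergy φ) ^ (critExp n 0 / 2) := by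
  obtain ⟨C, hC⟩ := exists_sobolev hn
  have hq := critExp_pos (n := n) hn (s := 0) (by norm_num)
  refine ⟨((C : ℝ) + 1) ^ 2, by positivity, fun Ω φ h => ?_⟩
  have h1 := ENNReal.toReal_mono (ENNReal.mul_ne_top (by simp) (h.memLp_gradient 2).2.ne) (hC Ω φ h)
  rw [ENNReal.toReal_mul, ENNReal.coe_toReal] at h1
  have h2 : (0 : ℝ) ≤ (eLpNorm (gradient φ) 2 volume).toReal := ENNReal.toReal_nonneg
  rw [h.hsTerm_zero_eq hn, h.dirichletEnergy_eq, ← mul_pow, ← Real.rpow_natCast,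
    ← Real.rpow_mul (by positivity)]
  have e : ((2 : ℕ) : ℝ) * (critExp n 0 / 2) = critExp n 0 := by push_cast; ring
  rw [e]
  refine Real.rpow_le_rpow ENNReal.toReal_nonneg ?_ hq.le
  nlinarith

/-- The interpolated Hardy-Sobolev inequality, keeping track of the Hardy term. -/
lemma exists_hardySobolev_interpolated (hn : 3 ≤ n) : ∃ C : ℝ, 0 < C ∧
    ∀ (Ω : Set (E n)) (φ : E n → ℝ) (s : ℝ), IsOpen Ω → (0 : E n) ∉ Ω → 0 ≤ s → s ≤ 2 →
    IsTestFunction Ω φ → hsTerm s φ ^ (2 / critExp n s) ≤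
      hardyTerm φ ^ (s / critExp n s) * (C * dirichletEnergy φ) ^ (1 - s / critExp n s) := by
  obtain ⟨C, hC0, hC⟩ := exists_sobolev_real hn
  refine ⟨C, hC0, fun Ω φ s hΩ h0 hs0 hs2 h => ?_⟩
  have hp := critExp_pos hn hs2
  have hA : 0 ≤ C * dirichletEnergy φ := mul_nonneg hC0.le (dirichletEnergy_nonneg φ)
  have h1 : hsTerm s φ ≤ hardyTerm φ ^ (s / 2) *
      ((C * dirichletEnergy φ) ^ (critExp n 0 / 2)) ^ (1 - s / 2) := by
    refine (h.hsTerm_le hn hs0 hs2 hΩ h0).trans ?_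
    refine mul_le_mul_of_nonneg_left ?_ (Real.rpow_nonneg (hardyTerm_nonneg φ) _)
    exact Real.rpow_le_rpow (hsTerm_nonneg _ _) (hC Ω φ h) (by linarith)
  refine (Real.rpow_le_rpow (hsTerm_nonneg _ _) h1 (by positivity)).trans (le_of_eq ?_)
  rw [Real.mul_rpow (Real.rpow_nonneg (hardyTerm_nonneg φ) _)
    (Real.rpow_nonneg (Real.rpow_nonneg hA _) _), ← Real.rpow_mul (hardyTerm_nonneg φ),
    ← Real.rpow_mul hA, ← Real.rpow_mul hA]
  have e := critExp_interpolation hn s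
  congr 2
  · field_simp
  · have : critExp n 0 / 2 * (1 - s / 2) * (2 / critExp n s) =
        (critExp n 0 * (1 - s / 2)) / critExp n s := by field_simp
    rw [this, show critExp n 0 * (1 - s / 2) = critExp n s - s by linarith, sub_div,
      div_self hp.ne']

/-- The Hardy-Sobolev inequality for test functions. -/
lemma exists_hardySobolev (hn : 3 ≤ n) {s : ℝ} (hs0 : 0 ≤ s) (hs2 : s ≤ 2) : ∃ C : ℝ, 0 < C ∧
    ∀ (Ω : Set (E n)) (φ : E n → ℝ), IsOpen Ω → (0 : E n) ∉ Ω →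
    IsTestFunction Ω φ → hsTerm s φ ^ (2 / critExp n s) ≤ C * dirichletEnergy φ := by
  obtain ⟨C, hC0, hC⟩ := exists_hardySobolev_interpolated hn
  have h3 : (3 : ℝ) ≤ n := by exact_mod_cast hn
  have hp := critExp_pos hn hs2
  set K := ((n : ℝ) - 2) ^ 2 / 4 with hK
  have hK0 : 0 < K := by
    have : (n : ℝ) - 2 ≠ 0 := by linarith
    positivity
  refine ⟨K⁻¹ ^ (s / critExp n s) * C ^ (1 - s / critExp n s), by positivity,
    fun Ω φ hΩ h0 h => ?_⟩
  have hA := dirichletEnergy_nonneg φ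
  have h1 : hardyTerm φ ≤ K⁻¹ * dirichletEnergy φ := by
    rw [le_inv_mul_iff₀ hK0]
    exact h.hardy hΩ h0
  refine (hC Ω φ s hΩ h0 hs0 hs2 h).trans ?_
  refine (mul_le_mul_of_nonneg_right (Real.rpow_le_rpow (hardyTerm_nonneg φ) h1 (by positivity))
    (Real.rpow_nonneg (by positivity) _)).trans (le_of_eq ?_)
  rw [Real.mul_rpow (by positivity) hA, Real.mul_rpow hC0.le hA]
  have : dirichletEnergy φ ^ (s / critExp n s) * dirichletEnergy φ ^ (1 - s / critExp n s) =
      dirichletEnergy φ := by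
    rw [← Real.rpow_add' hA (by norm_num)]
    simp
  calc _ = K⁻¹ ^ (s / critExp n s) * C ^ (1 - s / critExp n s) *
      (dirichletEnergy φ ^ (s / critExp n s) * dirichletEnergy φ ^ (1 - s / critExp n s)) := by
        ring
    _ = _ := by rw [this]

lemma controlled_of_integral_le {Ω : Set (E n)} {w : E n → ℝ} (hw : AEStronglyMeasurable w volume)
    {p : ℝ} (hp : 0 < p) (hmem : ∀ φ, IsTestFunction Ω φ →
      MemLp (fun x => w x * φ x) (ENNReal.ofReal p) volume) {C : ℝ} (hC0 : 0 ≤ C)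
    (hC : ∀ φ, IsTestFunction Ω φ →
      (∫ x, ‖w x * φ x‖ ^ p) ^ (2 / p) ≤ C * dirichletEnergy φ) :
    Controlled Ω w (ENNReal.ofReal p) := by
  refine ⟨hw, (Real.sqrt C).toNNReal, fun φ hφ => ?_⟩
  have h1 := hC φ hφ
  rw [← toReal_eLpNorm_rpow hp (hmem φ hφ), hφ.dirichletEnergy_eq,
    ← Real.rpow_mul ENNReal.toReal_nonneg, mul_div_cancel₀ _ hp.ne', Real.rpow_two] at h1
  have h2 := Real.sqrt_le_sqrt h1
  rw [Real.sqrt_mul hC0, Real.sqrt_sq ENNReal.toReal_nonneg,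
    Real.sqrt_sq ENNReal.toReal_nonneg] at h2
  rw [← ENNReal.toReal_le_toReal (hmem φ hφ).2.ne
    (ENNReal.mul_ne_top (by simp) (hφ.memLp_gradient 2).2.ne), ENNReal.toReal_mul,
    ENNReal.coe_toReal, Real.coe_toNNReal _ (Real.sqrt_nonneg _)]
  exact h2

lemma measurable_norm_rpow (t : ℝ) : Measurable (fun x : E n => ‖x‖ ^ t) :=
  measurable_norm.pow_const t

lemma IsTestFunction.memLp_mul {Ω : Set (E n)} (hΩ : IsOpen Ω) {φ : E n → ℝ}
    (hφ : IsTestFunction Ω φ) {w : E n → ℝ} (hw : ContinuousOn w Ω) (q : ℝ≥0∞) :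
    MemLp (fun x => w x * φ x) q volume := by
  have h1 := hφ.continuous_mul hΩ hw hφ.smooth.continuous (fun _ h => h)
  refine (show Continuous (fun x => w x * φ x) by simpa only [mul_comm] using h1)
    |>.memLp_of_hasCompactSupport ?_
  exact HasCompactSupport.mul_left hφ.compact

lemma controlled_hardySobolev (hn : 3 ≤ n) {Ω : Set (E n)} (hΩ : IsOpen Ω) (h0 : (0 : E n) ∉ Ω)
    {s : ℝ} (hs0 : 0 ≤ s) (hs2 : s ≤ 2) :
    Controlled Ω (fun x => ‖x‖ ^ (-s / critExp n s)) (ENNReal.ofReal (critExp n s)) := by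
  obtain ⟨C, hC0, hC⟩ := exists_hardySobolev hn hs0 hs2
  have hp := critExp_pos hn hs2
  refine controlled_of_integral_le (measurable_norm_rpow _).aestronglyMeasurable hp
    (fun φ hφ => hφ.memLp_mul hΩ (IsTestFunction.continuousOn_norm_rpow h0 _) _) hC0.le
    fun φ hφ => ?_
  refine le_trans (le_of_eq ?_) (hC Ω φ hΩ h0 hφ)
  simp only [hardySobolev_weight_rpow hp, hsTerm]

lemma controlled_hardy (hn : 3 ≤ n) {Ω : Set (E n)} (hΩ : IsOpen Ω) (h0 : (0 : E n) ∉ Ω) :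
    Controlled Ω (fun x => ‖x‖⁻¹) 2 := by
  have := controlled_hardySobolev hn hΩ h0 (s := 2) (by norm_num) le_rfl
  rw [critExp_two hn] at this
  simpa [Real.rpow_neg_one] using this

lemma controlled_one (hn : 3 ≤ n) {Ω : Set (E n)} (hΩ : IsOpen Ω) (h0 : (0 : E n) ∉ Ω)
    (hb : Bornology.IsBounded Ω) : Controlled Ω (fun _ => 1) 2 := by
  obtain ⟨-, C, hC⟩ := controlled_hardy hn hΩ h0
  obtain ⟨R, hR0, hR⟩ := hb.exists_pos_norm_le
  refine ⟨aestronglyMeasurable_const, R.toNNReal * C, fun φ hφ => ?_⟩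
  rw [ENNReal.coe_mul, mul_assoc]
  refine le_trans ?_ (mul_le_mul_right (hC φ hφ) _)
  refine le_trans (eLpNorm_mono (g := fun x => R * (‖x‖⁻¹ * φ x)) fun x => ?_) ?_
  · by_cases hx : x ∈ Ω
    · have hx0 : 0 < ‖x‖ := norm_pos_iff.2 fun h => h0 (h ▸ hx)
      rw [one_mul, ← mul_assoc, norm_mul, norm_mul, norm_inv, norm_norm, Real.norm_of_nonneg hR0.le,
        ← div_eq_mul_inv]
      exact le_mul_of_one_le_left (norm_nonneg _) ((one_le_div hx0).2 (hR x hx))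
    · simp [hφ.eq_zero hx]
  · refine le_of_eq ?_
    have := eLpNorm_const_smul R (fun x => ‖x‖⁻¹ * φ x) 2 (volume : Measure (E n))
    simp only [Pi.smul_def, smul_eq_mul] at this
    rw [this, Real.enorm_of_nonneg hR0.le]
    rfl

/-! ### Flattening the boundary -/

/-- A flattening of `∂Ω` near `0` that fixes `0` and whose derivative at `0` is an isometry. -/
structure IsometricChart [NeZero n] (Ω : Set (E n)) (Ψ : OpenPartialHomeomorph (E n) (E n))
    (R : E n ≃ₗᵢ[ℝ] E n) : Prop where
  mem_source : (0 : E n) ∈ Ψ.source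
  map_zero : Ψ 0 = 0
  contDiffOn : ContDiffOn ℝ ∞ Ψ Ψ.source
  contDiffOn_symm : ContDiffOn ℝ ∞ Ψ.symm Ψ.target
  mem_iff : ∀ x ∈ Ψ.source, (x ∈ Ω ↔ Ψ x ∈ halfSpace n)
  hasFDerivAt_zero : HasFDerivAt Ψ (R : E n →L[ℝ] E n) 0

/-- A rotation taking the half-space `{⟪ν, ·⟫ > 0}` to `{x₁ > 0}`. -/
lemma exists_rotation [NeZero n] {ν : E n} (hν : ν ≠ 0) :
    ∃ R : E n ≃ₗᵢ[ℝ] E n, ∀ y, R y 0 = ‖ν‖⁻¹ * ⟪ν, y⟫_ℝ := by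
  set e : E n := EuclideanSpace.single 0 1 with he
  have h1 : ‖‖ν‖⁻¹ • ν‖ = ‖e‖ := by
    rw [norm_smul, norm_inv, norm_norm, inv_mul_cancel₀ (norm_ne_zero_iff.2 hν)]
    simp [he]
  have h2 := Submodule.reflection_sub h1
  refine ⟨Submodule.reflection (ℝ ∙ (‖ν‖⁻¹ • ν - e))ᗮ, fun y => ?_⟩
  rw [← real_inner_smul_left, ← LinearIsometryEquiv.inner_map_map
    (Submodule.reflection (ℝ ∙ (‖ν‖⁻¹ • ν - e))ᗮ) (‖ν‖⁻¹ • ν) y, h2, he,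
    EuclideanSpace.inner_single_left]
  simp

/-- The flattening `Φ` is composed with the inverse of its derivative at `0`, which turns the
half-space into another half-space, and with a rotation that turns it back. -/
lemma exists_isometricChart [NeZero n] {Ω : Set (E n)} (hΩ : IsOpen Ω)
    (h0 : (0 : E n) ∈ frontier Ω) (hs : SmoothBoundaryAt Ω 0) :
    ∃ Ψ R, IsometricChart Ω Ψ R := by
  obtain ⟨Φ, h0s, hΦ, hΦs, hmem⟩ := hs
  have hat : Φ 0 ∈ Φ.target := Φ.map_source h0s
  have hd : DifferentiableAt ℝ Φ 0 :=
    (hΦ.contDiffAt (Φ.open_source.mem_nhds h0s)).differentiableAt (by simp)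
  have hds : DifferentiableAt ℝ Φ.symm (Φ 0) :=
    (hΦs.contDiffAt (Φ.open_target.mem_nhds hat)).differentiableAt (by simp)
  have hds' : HasFDerivAt Φ.symm (fderiv ℝ Φ.symm (Φ 0)) (Φ 0) := hds.hasFDerivAt
  have hd' : HasFDerivAt Φ (fderiv ℝ Φ 0) (Φ.symm (Φ 0)) := by
    rw [Φ.left_inv h0s]
    exact hd.hasFDerivAt
  have hli : (fderiv ℝ Φ.symm (Φ 0)).comp (fderiv ℝ Φ 0) = ContinuousLinearMap.id ℝ (E n) := by
    have h1 := hds'.comp (0 : E n) hd.hasFDerivAt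
    refine h1.unique ((hasFDerivAt_id (0 : E n)).congr_of_eventuallyEq ?_)
    exact Φ.eventually_left_inverse h0s
  have hri : (fderiv ℝ Φ 0).comp (fderiv ℝ Φ.symm (Φ 0)) = ContinuousLinearMap.id ℝ (E n) := by
    have h1 := hd'.comp (Φ 0) hds'
    refine h1.unique ((hasFDerivAt_id (Φ 0)).congr_of_eventuallyEq ?_)
    exact Φ.eventually_right_inverse hat
  set L : E n ≃L[ℝ] E n := ContinuousLinearEquiv.equivOfInverse (fderiv ℝ Φ 0)
    (fderiv ℝ Φ.symm (Φ 0)) (fun x => DFunLike.congr_fun hli x)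
    (fun x => DFunLike.congr_fun hri x) with hL
  -- The boundary point is mapped to the boundary of the half-space.
  have hΦ0 : Φ 0 0 = 0 := by
    have h1 : ¬ 0 < Φ 0 0 := fun h => by
      have : (0 : E n) ∈ Ω := (hmem 0 h0s).2 h
      rw [hΩ.frontier_eq] at h0
      exact h0.2 this
    refine le_antisymm (not_lt.1 h1) (not_lt.1 fun h2 => ?_)
    have hc : ContinuousAt (fun x => Φ x 0) 0 :=
      (EuclideanSpace.proj 0 : E n →L[ℝ] ℝ).continuous.continuousAt.comp (Φ.continuousAt h0s)
    have hev : ∀ᶠ x in 𝓝 (0 : E n), Φ x 0 < 0 ∧ x ∈ Φ.source :=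
      (hc.eventually (gt_mem_nhds h2)).and (Φ.open_source.mem_nhds h0s)
    obtain ⟨x, ⟨hx1, hx2⟩, hxΩ⟩ := mem_closure_iff_nhds.1 (frontier_subset_closure h0) _ hev
    exact lt_asymm hx1 ((hmem x hx2).1 hxΩ)
  set ν : E n := (InnerProductSpace.toDual ℝ (E n)).symm
    ((EuclideanSpace.proj 0 : E n →L[ℝ] ℝ).comp (L : E n →L[ℝ] E n)) with hνdef
  have hν : ∀ y, ⟪ν, y⟫_ℝ = L y 0 := fun y => by
    rw [hνdef, InnerProductSpace.toDual_symm_apply]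
    rfl
  have hν0 : ν ≠ 0 := by
    intro h
    have h1 := hν (L.symm (EuclideanSpace.single 0 1))
    rw [h, inner_zero_left, L.apply_symm_apply] at h1
    simp at h1
  obtain ⟨R, hR⟩ := exists_rotation hν0
  set e : E n ≃ₜ E n := (Homeomorph.subRight (Φ 0)).trans
    (L.symm.toHomeomorph.trans R.toHomeomorph) with he
  have he1 : ∀ y, e y = R (L.symm (y - Φ 0)) := fun y => rfl
  have he2 : ∀ y, e.symm y = L (R.symm y) + Φ 0 := fun y => rfl
  have hec : ContDiff ℝ ∞ e := by
    have : (e : E n → E n) = fun y => R (L.symm (y - Φ 0)) := funext he1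
    rw [this]
    exact R.contDiff.comp (L.symm.contDiff.comp (contDiff_id.sub contDiff_const))
  have hesc : ContDiff ℝ ∞ e.symm := by
    have : (e.symm : E n → E n) = fun y => L (R.symm y) + Φ 0 := funext he2
    rw [this]
    exact (L.contDiff.comp R.symm.contDiff).add contDiff_const
  refine ⟨Φ.transHomeomorph e, R, h0s, ?_, hec.comp_contDiffOn hΦ, ?_, ?_, ?_⟩
  · change e (Φ 0) = 0
    simp [he1]
  · change ContDiffOn ℝ ∞ (fun y => Φ.symm (e.symm y)) (e.symm ⁻¹' Φ.target)
    exact hΦs.comp hesc.contDiffOn fun x hx => hx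
  · intro x hx
    change _ ↔ e (Φ x) ∈ halfSpace n
    rw [hmem x hx, halfSpace, Set.mem_ofPred_eq, Set.mem_ofPred_eq, he1, hR, hν,
      L.apply_symm_apply, mul_pos_iff_of_pos_left (inv_pos.2 (norm_pos_iff.2 hν0))]
    simp [hΦ0]
  · have h1 : HasFDerivAt e ((R : E n →L[ℝ] E n).comp (L.symm : E n →L[ℝ] E n)) (Φ 0) := by
      have : (e : E n → E n) = fun y => R (L.symm (y - Φ 0)) := funext he1
      rw [this]
      exact (((R : E n →L[ℝ] E n).comp (L.symm : E n →L[ℝ] E n)).hasFDerivAt).comp (Φ 0)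
        ((hasFDerivAt_id (Φ 0)).sub_const (Φ 0))
    have h2 := h1.comp (0 : E n) hd.hasFDerivAt
    refine h2.congr_fderiv ?_
    ext1 x
    change R (L.symm (fderiv ℝ Φ 0 x)) = R x
    congr 1
    exact L.symm_apply_apply x

lemma abs_det_linearIsometryEquiv (R : E n ≃ₗᵢ[ℝ] E n) :
    |((R : E n →L[ℝ] E n)).det| = 1 := by
  have h1 := Measure.addHaar_image_continuousLinearMap (volume : Measure (E n))
    (R : E n →L[ℝ] E n) (Metric.ball 0 1)
  have h2 : (R : E n →L[ℝ] E n) '' Metric.ball 0 1 = Metric.ball 0 1 := by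
    have := R.image_ball 0 1
    rwa [map_zero] at this
  rw [h2] at h1
  have h3 : volume (Metric.ball (0 : E n) 1) ≠ 0 := (Metric.measure_ball_pos _ _ one_pos).ne'
  have h4 : volume (Metric.ball (0 : E n) 1) ≠ ⊤ := measure_ball_lt_top.ne
  have h5 : ENNReal.ofReal |((R : E n →L[ℝ] E n)).det| = 1 := by
    rw [← ENNReal.mul_left_inj h3 h4, one_mul]
    exact h1.symm
  rwa [ENNReal.ofReal_eq_one] at h5

namespace IsometricChart

variable [NeZero n] {Ω : Set (E n)} {Ψ : OpenPartialHomeomorph (E n) (E n)} {R : E n ≃ₗᵢ[ℝ] E n}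

lemma hasFDerivAt (h : IsometricChart Ω Ψ R) {x : E n} (hx : x ∈ Ψ.source) :
    HasFDerivAt Ψ (fderiv ℝ Ψ x) x :=
  ((h.contDiffOn.contDiffAt (Ψ.open_source.mem_nhds hx)).differentiableAt (by simp)).hasFDerivAt

lemma tendsto_det (h : IsometricChart Ω Ψ R) :
    Tendsto (fun x => |(fderiv ℝ Ψ x).det|) (𝓝 0) (𝓝 1) := by
  have h1 : ContinuousAt (fderiv ℝ Ψ) 0 :=
    ((h.contDiffOn.contDiffAt (Ψ.open_source.mem_nhds h.mem_source)).fderiv_right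
      (m := 0) (by simp)).continuousAt
  have h2 : Tendsto (fun x => |(fderiv ℝ Ψ x).det|) (𝓝 0) (𝓝 |(fderiv ℝ Ψ 0).det|) :=
    ((ContinuousLinearMap.continuous_det.continuousAt).comp h1).abs
  rwa [h.hasFDerivAt_zero.fderiv, abs_det_linearIsometryEquiv] at h2

lemma tendsto_norm_fderiv_symm (h : IsometricChart Ω Ψ R) :
    Tendsto (fun x => ‖fderiv ℝ Ψ.symm (Ψ x)‖) (𝓝 0) (𝓝 ‖(R.symm : E n →L[ℝ] E n)‖) := by
  have h0 : Ψ 0 ∈ Ψ.target := Ψ.map_source h.mem_source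
  have h1 : ContinuousAt (fderiv ℝ Ψ.symm) (Ψ 0) :=
    ((h.contDiffOn_symm.contDiffAt (Ψ.open_target.mem_nhds h0)).fderiv_right
      (m := 0) (by simp)).continuousAt
  have h2 : HasFDerivAt Ψ.symm (R.toContinuousLinearEquiv.symm : E n →L[ℝ] E n) (Ψ 0) := by
    refine Ψ.hasFDerivAt_symm h0 ?_
    rw [Ψ.left_inv h.mem_source]
    exact h.hasFDerivAt_zero
  have h3 := (h1.comp (Ψ.continuousAt h.mem_source)).norm
  have e : fderiv ℝ Ψ.symm (Ψ 0) = (R.symm : E n →L[ℝ] E n) := h2.fderiv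
  have h4 : Tendsto (fun x => ‖fderiv ℝ Ψ.symm (Ψ x)‖) (𝓝 0) (𝓝 ‖fderiv ℝ Ψ.symm (Ψ 0)‖) := h3
  rwa [e] at h4

lemma tendsto_norm_div (h : IsometricChart Ω Ψ R) :
    Tendsto (fun x => ‖x‖ / ‖Ψ x‖) (𝓝[≠] 0) (𝓝 1) := by
  have h1 := h.hasFDerivAt_zero.isLittleO
  simp only [h.map_zero, sub_zero] at h1
  have h2 : Tendsto (fun x => ‖Ψ x - R x‖ / ‖x‖) (𝓝 0) (𝓝 0) :=
    (Asymptotics.isLittleO_norm_norm.2 h1).tendsto_div_nhds_zero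
  have h3 : Tendsto (fun x => ‖Ψ x‖ / ‖x‖) (𝓝[≠] 0) (𝓝 1) := by
    have h4 : Tendsto (fun x => ‖Ψ x‖ / ‖x‖ - 1) (𝓝[≠] 0) (𝓝 0) := by
      refine squeeze_zero_norm' ?_ (h2.mono_left nhdsWithin_le_nhds)
      filter_upwards [self_mem_nhdsWithin] with x hx
      have hx' : 0 < ‖x‖ := norm_pos_iff.2 hx
      rw [Real.norm_eq_abs, div_sub_one hx'.ne', abs_div, abs_norm]
      gcongr
      have := abs_norm_sub_norm_le (Ψ x) (R x)
      rwa [R.norm_map] at this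
    simpa using h4.add_const 1
  simpa using h3.inv₀ one_ne_zero

end IsometricChart

/-- The function `φ ∘ Ψ⁻¹`, extended by zero. -/
noncomputable def transplant (Ψ : OpenPartialHomeomorph (E n) (E n)) (φ : E n → ℝ) : E n → ℝ :=
  Ψ.target.indicator fun y => φ (Ψ.symm y)

lemma transplant_apply {Ψ : OpenPartialHomeomorph (E n) (E n)} {φ : E n → ℝ} {x : E n}
 (hx : x ∈ Ψ.source) : transplant Ψ φ (Ψ x) = φ x := by
  rw [transplant, Set.indicator_of_mem (Ψ.map_source hx), Ψ.left_inv hx]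

namespace IsometricChart

variable [NeZero n] {Ω : Set (E n)} {Ψ : OpenPartialHomeomorph (E n) (E n)} {R : E n ≃ₗᵢ[ℝ] E n}
  {φ : E n → ℝ}

lemma isTestFunction_transplant (h : IsometricChart Ω Ψ R) (hφ : IsTestFunction Ω φ)
    (hsrc : tsupport φ ⊆ Ψ.source) : IsTestFunction (halfSpace n) (transplant Ψ φ) := by
  have hK : IsCompact (Ψ '' tsupport φ) := hφ.compact.isCompact.image_of_continuousOn
    (Ψ.continuousOn.mono hsrc)
  have hzero : ∀ y ∉ Ψ '' tsupport φ, transplant Ψ φ y = 0 := by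
    intro y hy
    by_cases hyt : y ∈ Ψ.target
    · rw [transplant, Set.indicator_of_mem hyt]
      refine image_eq_zero_of_notMem_tsupport fun h' => hy ⟨_, h', Ψ.right_inv hyt⟩
    · exact Set.indicator_of_notMem hyt _
  have hsupp : tsupport (transplant Ψ φ) ⊆ Ψ '' tsupport φ :=
    closure_minimal (fun y hy => by_contra fun h' => hy (hzero y h')) hK.isClosed
  refine ⟨?_, hK.of_isClosed_subset (isClosed_tsupport _) hsupp, ?_⟩
  · rw [contDiff_iff_contDiffAt]
    intro y
    by_cases hy : y ∈ Ψ '' tsupport φ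
    · have hyt : y ∈ Ψ.target := by
        obtain ⟨x, hx, rfl⟩ := hy
        exact Ψ.map_source (hsrc hx)
      have h1 : ContDiffAt ℝ ∞ (fun y => φ (Ψ.symm y)) y :=
        hφ.smooth.contDiffAt.comp y (h.contDiffOn_symm.contDiffAt (Ψ.open_target.mem_nhds hyt))
      refine h1.congr_of_eventuallyEq ?_
      filter_upwards [Ψ.open_target.mem_nhds hyt] with z hz
      exact Set.indicator_of_mem hz _
    · refine contDiffAt_const (c := (0 : ℝ)) |>.congr_of_eventuallyEq ?_
      filter_upwards [hK.isClosed.isOpen_compl.mem_nhds hy] with z hz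
      exact hzero z hz
  · intro y hy
    obtain ⟨x, hx, rfl⟩ := hsupp hy
    exact (h.mem_iff x (hsrc hx)).1 (hφ.support_subset hx)

lemma norm_gradient_transplant_le (h : IsometricChart Ω Ψ R) (hφ : IsTestFunction Ω φ) {x : E n}
    (hx : x ∈ Ψ.source) : ‖gradient (transplant Ψ φ) (Ψ x)‖ ≤
      ‖gradient φ x‖ * ‖fderiv ℝ Ψ.symm (Ψ x)‖ := by
  have hxt := Ψ.map_source hx
  have h1 : transplant Ψ φ =ᶠ[𝓝 (Ψ x)] fun y => φ (Ψ.symm y) := by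
    filter_upwards [Ψ.open_target.mem_nhds hxt] with z hz
    exact Set.indicator_of_mem hz _
  have h2 : HasFDerivAt Ψ.symm (fderiv ℝ Ψ.symm (Ψ x)) (Ψ x) :=
    ((h.contDiffOn_symm.contDiffAt (Ψ.open_target.mem_nhds hxt)).differentiableAt
      (by simp)).hasFDerivAt
  have h3 : HasFDerivAt φ (fderiv ℝ φ x) (Ψ.symm (Ψ x)) := by
    rw [Ψ.left_inv hx]
    exact (hφ.differentiableAt x).hasFDerivAt
  have h4 : fderiv ℝ (transplant Ψ φ) (Ψ x) =
      (fderiv ℝ φ x).comp (fderiv ℝ Ψ.symm (Ψ x)) := by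
    rw [h1.fderiv_eq]
    exact (h3.comp (Ψ x) h2).fderiv
  rw [norm_gradient_eq, norm_gradient_eq, h4]
  exact ContinuousLinearMap.opNorm_comp_le _ _

lemma integral_eq (h : IsometricChart Ω Ψ R) {f : E n → ℝ} (hf0 : ∀ y ∉ Ψ.target, f y = 0) :
    ∫ y, f y = ∫ x in Ψ.source, |(fderiv ℝ Ψ x).det| * f (Ψ x) := by
  rw [← setIntegral_eq_integral_of_forall_compl_eq_zero hf0, ← Ψ.image_source_eq_target]
  exact integral_image_eq_integral_abs_det_fderiv_smul volume Ψ.open_source.measurableSet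
    (fun x hx => (h.hasFDerivAt hx).hasFDerivWithinAt) Ψ.injOn f

lemma integrableOn (h : IsometricChart Ω Ψ R) {f : E n → ℝ} (hf : Integrable f) :
    IntegrableOn (fun x => |(fderiv ℝ Ψ x).det| * f (Ψ x)) Ψ.source := by
  have := (integrableOn_image_iff_integrableOn_abs_det_fderiv_smul volume
    Ψ.open_source.measurableSet (fun x hx => (h.hasFDerivAt hx).hasFDerivWithinAt) Ψ.injOn f).1
    hf.integrableOn
  exact this

lemma integral_le (h : IsometricChart Ω Ψ R) {f k : E n → ℝ} (hf : Integrable f)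
    (hf0 : ∀ y ∉ Ψ.target, f y = 0) (hk : Integrable k) (hk0 : ∀ x ∉ Ψ.source, k x = 0)
    (hfk : ∀ x ∈ Ψ.source, |(fderiv ℝ Ψ x).det| * f (Ψ x) ≤ k x) : ∫ y, f y ≤ ∫ x, k x := by
  rw [h.integral_eq hf0, ← setIntegral_eq_integral_of_forall_compl_eq_zero hk0]
  exact setIntegral_mono_on (h.integrableOn hf) hk.integrableOn Ψ.open_source.measurableSet hfk

lemma le_integral (h : IsometricChart Ω Ψ R) {f k : E n → ℝ} (hf : Integrable f)
    (hf0 : ∀ y ∉ Ψ.target, f y = 0) (hk : Integrable k) (hk0 : ∀ x ∉ Ψ.source, k x = 0)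
    (hfk : ∀ x ∈ Ψ.source, k x ≤ |(fderiv ℝ Ψ x).det| * f (Ψ x)) : ∫ x, k x ≤ ∫ y, f y := by
  rw [h.integral_eq hf0, ← setIntegral_eq_integral_of_forall_compl_eq_zero hk0]
  exact setIntegral_mono_on hk.integrableOn (h.integrableOn hf) Ψ.open_source.measurableSet hfk

/-- Near `0` the chart is almost an isometry: the ratios that govern the change of variables in
the three integrals of the functional are close to `1`. -/
lemma exists_ball_ratio (h : IsometricChart Ω Ψ R) (s : ℝ) {ε : ℝ} (hε : 0 < ε) :
    ∃ δ > 0, Metric.ball 0 δ ⊆ Ψ.source ∧ ∀ x ∈ Metric.ball (0 : E n) δ, x ≠ 0 →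
      |(fderiv ℝ Ψ x).det| * ‖fderiv ℝ Ψ.symm (Ψ x)‖ ^ 2 ≤ 1 + ε ∧
      |(fderiv ℝ Ψ x).det| * (‖x‖ / ‖Ψ x‖) ^ 2 ≤ 1 + ε ∧
      1 - ε ≤ |(fderiv ℝ Ψ x).det| * (‖x‖ / ‖Ψ x‖) ^ 2 ∧
      1 ≤ (1 + ε) * (|(fderiv ℝ Ψ x).det| * (‖x‖ / ‖Ψ x‖) ^ s) := by
  have t1 := h.tendsto_det
  have t1' : Tendsto (fun x => |(fderiv ℝ Ψ x).det|) (𝓝[≠] 0) (𝓝 1) :=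
    t1.mono_left nhdsWithin_le_nhds
  have t2 := h.tendsto_norm_div
  have hR : ‖(R.symm : E n →L[ℝ] E n)‖ ≤ 1 := 
    ContinuousLinearMap.opNorm_le_bound _ zero_le_one fun x => by simp
  have e1 : ∀ᶠ x in 𝓝[≠] (0 : E n),
      |(fderiv ℝ Ψ x).det| * ‖fderiv ℝ Ψ.symm (Ψ x)‖ ^ 2 ≤ 1 + ε := by
    have t3 := (t1.mul (h.tendsto_norm_fderiv_symm.pow 2)).mono_left
      (nhdsWithin_le_nhds (s := {0}ᶜ))
    refine t3.eventually (ge_mem_nhds ?_)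
    have : ‖(R.symm : E n →L[ℝ] E n)‖ ^ 2 ≤ 1 := pow_le_one₀ (norm_nonneg _) hR
    linarith
  have t4 : Tendsto (fun x => |(fderiv ℝ Ψ x).det| * (‖x‖ / ‖Ψ x‖) ^ 2) (𝓝[≠] 0) (𝓝 1) := by
    simpa using t1'.mul (t2.pow 2)
  have e2 := t4.eventually (ge_mem_nhds (by linarith : 1 < 1 + ε))
  have e3 := t4.eventually (le_mem_nhds (by linarith : 1 - ε < 1))
  have t5 : Tendsto (fun x => (1 + ε) * (|(fderiv ℝ Ψ x).det| * (‖x‖ / ‖Ψ x‖) ^ s)) (𝓝[≠] 0)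
      (𝓝 (1 + ε)) := by
    have := (t1'.mul (t2.rpow_const (p := s) (Or.inl one_ne_zero))).const_mul (1 + ε)
    simpa using this
  have e4 := t5.eventually (le_mem_nhds (by linarith : 1 < 1 + ε))
  have e5 := eventually_nhdsWithin_iff.1 (e1.and (e2.and (e3.and e4)))
  obtain ⟨δ, hδ, hball⟩ := Metric.eventually_nhds_iff_ball.1
    (e5.and (Ψ.open_source.mem_nhds h.mem_source))
  exact ⟨δ, hδ, fun x hx => (hball x hx).2, fun x hx hx0 => (hball x hx).1 hx0⟩

/-- Transplanting to the half-space almost preserves all the terms of the functional, for test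
functions concentrated near `0`. -/
lemma exists_ball_transplant (hn : 3 ≤ n) (h : IsometricChart Ω Ψ R) (hΩ : IsOpen Ω)
    (h0 : (0 : E n) ∉ Ω) {s : ℝ} (hs2 : s ≤ 2) {ε : ℝ} (hε : 0 < ε) :
    ∃ δ > 0, ∀ φ, IsTestFunction Ω φ → tsupport φ ⊆ Metric.ball 0 δ →
      IsTestFunction (halfSpace n) (transplant Ψ φ) ∧
      dirichletEnergy (transplant Ψ φ) ≤ (1 + ε) * dirichletEnergy φ ∧
      hardyTerm (transplant Ψ φ) ≤ (1 + ε) * hardyTerm φ ∧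
      (1 - ε) * hardyTerm φ ≤ hardyTerm (transplant Ψ φ) ∧
      hsTerm s φ ≤ (1 + ε) * hsTerm s (transplant Ψ φ) := by
  obtain ⟨δ, hδ, hsub, hball⟩ := h.exists_ball_ratio s hε
  refine ⟨δ, hδ, fun φ hφ hsupp => ?_⟩
  have hp := critExp_pos hn hs2
  have hsrc := hsupp.trans hsub
  have hT := h.isTestFunction_transplant hφ hsrc
  have hT0 : ∀ y ∉ Ψ.target, transplant Ψ φ y = 0 := fun y hy => Set.indicator_of_notMem hy _
  have hTg0 : ∀ y ∉ Ψ.target, gradient (transplant Ψ φ) y = 0 := by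
    intro y hy
    have hK : IsCompact (Ψ '' tsupport φ) := hφ.compact.isCompact.image_of_continuousOn
      (Ψ.continuousOn.mono hsrc)
    have h1 : y ∉ Ψ '' tsupport φ := by
      rintro ⟨x, hx, rfl⟩
      exact hy (Ψ.map_source (hsrc hx))
    have h2 : transplant Ψ φ =ᶠ[𝓝 y] fun _ => 0 := by
      filter_upwards [hK.isClosed.isOpen_compl.mem_nhds h1] with z hz
      by_cases hzt : z ∈ Ψ.target
      · rw [transplant, Set.indicator_of_mem hzt]
        exact image_eq_zero_of_notMem_tsupport fun h' => hz ⟨_, h', Ψ.right_inv hzt⟩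
      · exact Set.indicator_of_notMem hzt _
    simp [gradient, h2.fderiv_eq]
  have hφ0 : ∀ x ∉ Ψ.source, φ x = 0 := fun x hx =>
    image_eq_zero_of_notMem_tsupport fun h' => hx (hsrc h')
  have hφg0 : ∀ x ∉ tsupport φ, gradient φ x = 0 := fun x hx => by
    have : fderiv ℝ φ x = 0 :=
      image_eq_zero_of_notMem_tsupport fun h' => hx (tsupport_fderiv_subset ℝ h')
    simp [gradient, this]
  -- Off the support everything vanishes, and on it the ratio bounds apply.
  have hcase : ∀ x, x ∈ tsupport φ → x ∈ Metric.ball 0 δ ∧ x ≠ 0 := fun x hx =>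
    ⟨hsupp hx, fun h' => h0 (h' ▸ hφ.support_subset hx)⟩
  have hquot : ∀ x, x ∈ Ψ.source → x ≠ 0 → 0 < ‖Ψ x‖ := by
    intro x hx hx0
    refine norm_pos_iff.2 fun h' => hx0 ?_
    rw [← Ψ.left_inv hx, ← Ψ.left_inv h.mem_source, h', h.map_zero]
  have hΨ2 : ∀ x ∈ tsupport φ, |(fderiv ℝ Ψ x).det| * (φ x ^ 2 / ‖Ψ x‖ ^ 2) =
      |(fderiv ℝ Ψ x).det| * (‖x‖ / ‖Ψ x‖) ^ 2 * (φ x ^ 2 / ‖x‖ ^ 2) := by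
    intro x hx
    have h1 := hquot x (hsrc hx) (hcase x hx).2
    have h2 : 0 < ‖x‖ := norm_pos_iff.2 (hcase x hx).2
    field_simp
  refine ⟨hT, ?_, ?_, ?_, ?_⟩
  · rw [dirichletEnergy, dirichletEnergy, ← integral_const_mul]
    refine h.integral_le hT.integrable_dirichlet (fun y hy => by simp [hTg0 y hy])
      (hφ.integrable_dirichlet.const_mul _)
      (fun x hx => by simp [hφg0 x fun h' => hx (hsrc h')]) fun x hx => ?_
    by_cases hxs : x ∈ tsupport φ
    · obtain ⟨b1, -⟩ := hball x (hcase x hxs).1 (hcase x hxs).2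
      have h1 := pow_le_pow_left₀ (norm_nonneg _) (h.norm_gradient_transplant_le hφ hx) 2
      calc _ ≤ |(fderiv ℝ Ψ x).det| * (‖gradient φ x‖ * ‖fderiv ℝ Ψ.symm (Ψ x)‖) ^ 2 := by
            gcongr
        _ = |(fderiv ℝ Ψ x).det| * ‖fderiv ℝ Ψ.symm (Ψ x)‖ ^ 2 * ‖gradient φ x‖ ^ 2 := by ring
        _ ≤ _ := by gcongr
    · have h1 := h.norm_gradient_transplant_le hφ hx
      rw [hφg0 x hxs, norm_zero, zero_mul] at h1
      rw [hφg0 x hxs, le_antisymm h1 (norm_nonneg _)]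
      simp
  · rw [hardyTerm, hardyTerm, ← integral_const_mul]
    refine h.integral_le (hT.integrable_hardy isOpen_halfSpace zero_notMem_halfSpace)
      (fun y hy => by simp [hT0 y hy]) ((hφ.integrable_hardy hΩ h0).const_mul _)
      (fun x hx => by simp [hφ0 x hx]) fun x hx => ?_
    rw [transplant_apply hx]
    by_cases hxs : x ∈ tsupport φ
    · obtain ⟨-, b2, -⟩ := hball x (hcase x hxs).1 (hcase x hxs).2
      rw [hΨ2 x hxs]
      gcongr
    · simp [image_eq_zero_of_notMem_tsupport hxs]
  · rw [hardyTerm, hardyTerm, ← integral_const_mul]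
    refine h.le_integral (hT.integrable_hardy isOpen_halfSpace zero_notMem_halfSpace)
      (fun y hy => by simp [hT0 y hy]) ((hφ.integrable_hardy hΩ h0).const_mul _)
      (fun x hx => by simp [hφ0 x hx]) fun x hx => ?_
    rw [transplant_apply hx]
    by_cases hxs : x ∈ tsupport φ
    · obtain ⟨-, -, b3, -⟩ := hball x (hcase x hxs).1 (hcase x hxs).2
      rw [hΨ2 x hxs]
      gcongr
    · simp [image_eq_zero_of_notMem_tsupport hxs]
  · rw [hsTerm, hsTerm, ← integral_const_mul]
    refine h.le_integral (f := fun y => (1 + ε) * (|transplant Ψ φ y| ^ critExp n s / ‖y‖ ^ s))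
      ((hT.integrable_hs hn hs2 isOpen_halfSpace zero_notMem_halfSpace).const_mul _)
      (fun y hy => by simp [hT0 y hy, hp.ne']) (hφ.integrable_hs hn hs2 hΩ h0)
      (fun x hx => by simp [hφ0 x hx, hp.ne']) fun x hx => ?_
    rw [transplant_apply hx]
    by_cases hxs : x ∈ tsupport φ
    · obtain ⟨-, -, -, b4⟩ := hball x (hcase x hxs).1 (hcase x hxs).2
      have h1 := hquot x hx (hcase x hxs).2
      have h2 : 0 < ‖x‖ := norm_pos_iff.2 (hcase x hxs).2
      have h3 : 0 < ‖x‖ ^ s := by positivity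
      have h4 : 0 < ‖Ψ x‖ ^ s := by positivity
      rw [Real.div_rpow h2.le h1.le] at b4
      calc |φ x| ^ critExp n s / ‖x‖ ^ s = 1 * (|φ x| ^ critExp n s / ‖x‖ ^ s) := by ring
        _ ≤ (1 + ε) * (|(fderiv ℝ Ψ x).det| * (‖x‖ ^ s / ‖Ψ x‖ ^ s)) *
            (|φ x| ^ critExp n s / ‖x‖ ^ s) := by gcongr
        _ = _ := by field_simp
    · simp [image_eq_zero_of_notMem_tsupport hxs, hp.ne']

end IsometricChart

/-! ### The localised sharp inequality -/

lemma IsTestFunction.hardyTerm_le (hn : 3 ≤ n) {Ω : Set (E n)} (hΩ : IsOpen Ω)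
    (h0 : (0 : E n) ∉ Ω) {φ : E n → ℝ} (hφ : IsTestFunction Ω φ) :
    hardyTerm φ ≤ 4 * dirichletEnergy φ := by
  have h1 := hφ.hardy hΩ h0
  have h3 : (3 : ℝ) ≤ n := by exact_mod_cast hn
  nlinarith [hardyTerm_nonneg φ, mul_nonneg (hardyTerm_nonneg φ)
    (by nlinarith : 0 ≤ ((n : ℝ) - 2) ^ 2 - 1)]

lemma neg_mul_le_abs_mul {γ a b : ℝ} (hab : |a| ≤ b) : -γ * a ≤ |γ| * b := by
  calc -γ * a ≤ |-γ * a| := le_abs_self _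
    _ = |γ| * |a| := by rw [abs_mul, abs_neg]
    _ ≤ |γ| * b := by gcongr

/-- The inequality of the half-space holds, up to `ε`, for test functions concentrated near `0`. -/
lemma exists_ball_hardySobolev [NeZero n] (hn : 3 ≤ n) {Ω : Set (E n)} (hΩ : IsOpen Ω)
    (h0 : (0 : E n) ∈ frontier Ω) (hsm : SmoothBoundaryAt Ω 0) {γ s m : ℝ}
    (hs2 : s ≤ 2) (hm0 : 0 < m)
    (hm : ∀ φ, IsTestFunction (halfSpace n) φ →
      m * hsTerm s φ ^ (2 / critExp n s) ≤ dirichletEnergy φ - γ * hardyTerm φ)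
    {ε : ℝ} (hε : 0 < ε) :
    ∃ δ > 0, ∀ φ, IsTestFunction Ω φ → tsupport φ ⊆ Metric.ball 0 δ →
      m * hsTerm s φ ^ (2 / critExp n s) ≤
        dirichletEnergy φ - γ * hardyTerm φ + ε * dirichletEnergy φ := by
  obtain ⟨Ψ, R, hΨ⟩ := exists_isometricChart hΩ h0 hsm
  have h0' : (0 : E n) ∉ Ω := by
    rw [hΩ.frontier_eq] at h0
    exact h0.2
  have hp := two_le_critExp hn hs2
  set η := min 1 (ε / (3 + 12 * |γ|)) with hη
  have hη0 : 0 < η := by positivity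
  have hη1 : η ≤ 1 := min_le_left _ _
  have hηε : η * (3 + 12 * |γ|) ≤ ε := by
    rw [← le_div_iff₀ (by positivity)]
    exact min_le_right _ _
  obtain ⟨δ, hδ, hball⟩ := hΨ.exists_ball_transplant hn hΩ h0' hs2 hη0
  refine ⟨δ, hδ, fun φ hφ hsupp => ?_⟩
  obtain ⟨hT, hA, hH1, hH2, hN⟩ := hball φ hφ hsupp
  have hm' := hm _ hT
  have hH4 := hφ.hardyTerm_le hn hΩ h0'
  have hA0 := dirichletEnergy_nonneg φ
  have hH0 := hardyTerm_nonneg φ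
  set A := dirichletEnergy φ
  set H := hardyTerm φ
  set A' := dirichletEnergy (transplant Ψ φ)
  set H' := hardyTerm (transplant Ψ φ)
  have hpow : hsTerm s φ ^ (2 / critExp n s) ≤
      (1 + η) * hsTerm s (transplant Ψ φ) ^ (2 / critExp n s) := by
    refine (Real.rpow_le_rpow (hsTerm_nonneg _ _) hN (by positivity)).trans ?_
    rw [Real.mul_rpow (by positivity) (hsTerm_nonneg _ _)]
    refine mul_le_mul_of_nonneg_right ?_ (Real.rpow_nonneg (hsTerm_nonneg _ _) _)
    refine Real.rpow_le_self_of_one_le (by linarith) ?_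
    rw [div_le_one (by linarith)]
    exact hp
  have hdiff : -γ * (H' - H) ≤ |γ| * (η * H) :=
    neg_mul_le_abs_mul (abs_le.2 ⟨by linarith, by linarith⟩)
  have hγH : -γ * (η * H) ≤ |γ| * (η * H) :=
    neg_mul_le_abs_mul (abs_of_nonneg (by positivity)).le
  have hfin : (1 + η) * (A' - γ * H') ≤ A - γ * H + ε * A := by
    have h1 : A' - γ * H' ≤ (1 + η) * A - γ * H + |γ| * (η * H) := by nlinarith
    have h2 : (1 + η) * (A' - γ * H') ≤ (1 + η) * ((1 + η) * A - γ * H + |γ| * (η * H)) :=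
      mul_le_mul_of_nonneg_left h1 (by positivity)
    have h3 : |γ| * (η * H) ≤ |γ| * (η * (4 * A)) := by gcongr
    have h4 : η * (|γ| * (η * H)) ≤ |γ| * (η * (4 * A)) :=
      (mul_le_of_le_one_left (by positivity) hη1).trans h3
    have h5 : η * (η * A) ≤ η * A := mul_le_of_le_one_left (by positivity) hη1
    have h6 : η * (3 + 12 * |γ|) * A ≤ ε * A := mul_le_mul_of_nonneg_right hηε hA0
    nlinarith
  calc m * hsTerm s φ ^ (2 / critExp n s)
      ≤ m * ((1 + η) * hsTerm s (transplant Ψ φ) ^ (2 / critExp n s)) := by gcongr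
    _ = (1 + η) * (m * hsTerm s (transplant Ψ φ) ^ (2 / critExp n s)) := by ring
    _ ≤ (1 + η) * (A' - γ * H') := by gcongr
    _ ≤ _ := hfin

/-- Young's inequality with a small parameter. -/
lemma exists_rpow_mul_rpow_le {θ τ : ℝ} (hθ0 : 0 < θ) (hθ1 : θ ≤ 1) (hτ : 0 < τ) :
    ∃ K : ℝ, 0 ≤ K ∧ ∀ X Y : ℝ, 0 ≤ X → 0 ≤ Y → X ^ θ * Y ^ (1 - θ) ≤ K * X + τ * Y := by
  set κ := τ ^ (-((1 - θ) / θ)) with hκ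
  have hκ0 : 0 < κ := by positivity
  refine ⟨κ, hκ0.le, fun X Y hX hY => ?_⟩
  have h1 := Real.geom_mean_le_arith_mean2_weighted hθ0.le (sub_nonneg.2 hθ1)
    (mul_nonneg hκ0.le hX) (mul_nonneg hτ.le hY) (by ring)
  have h2 : (κ * X) ^ θ * (τ * Y) ^ (1 - θ) = X ^ θ * Y ^ (1 - θ) := by
    rw [Real.mul_rpow hκ0.le hX, Real.mul_rpow hτ.le hY, hκ, ← Real.rpow_mul hτ.le]
    have : -((1 - θ) / θ) * θ = -(1 - θ) := by field_simp
    rw [this, Real.rpow_neg hτ.le]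
    have h3 : τ ^ (1 - θ) ≠ 0 := by positivity
    field_simp
  rw [h2] at h1
  have h3 : θ * (κ * X) ≤ κ * X := mul_le_of_le_one_left (by positivity) hθ1
  have h4 : (1 - θ) * (τ * Y) ≤ τ * Y := mul_le_of_le_one_left (by positivity) (by linarith)
  linarith

lemma IsTestFunction.hardyTerm_le_massTerm {Ω : Set (E n)} {φ : E n → ℝ}
    (hφ : IsTestFunction Ω φ) {r : ℝ} (hr : 0 < r) (hsupp : ∀ x, φ x ≠ 0 → r ≤ ‖x‖) :
    hardyTerm φ ≤ (r ^ 2)⁻¹ * massTerm φ := by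
  rw [hardyTerm, massTerm, ← integral_const_mul]
  refine integral_mono_of_nonneg (ae_of_all _ fun x => by positivity)
    (hφ.integrable_mass.const_mul _) (ae_of_all _ fun x => ?_)
  by_cases hx : φ x = 0
  · simp [hx]
  · have h1 := hsupp x hx
    simp only
    rw [div_eq_inv_mul]
    gcongr

lemma IsTestFunction.translate {Ω Ω' : Set (E n)} {φ : E n → ℝ} (hφ : IsTestFunction Ω φ)
    (a : E n) (hΩ : ∀ x ∈ Ω, x - a ∈ Ω') : IsTestFunction Ω' (fun y => φ (y + a)) := by
  refine ⟨hφ.smooth.comp (contDiff_id.add contDiff_const),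
    hφ.compact.comp_homeomorph (Homeomorph.addRight a), ?_⟩
  have h1 : tsupport (fun y => φ (y + a)) = (Homeomorph.addRight a) ⁻¹' tsupport φ :=
    tsupport_comp_eq_preimage φ (Homeomorph.addRight a)
  rw [h1]
  intro y hy
  have := hΩ _ (hφ.support_subset hy)
  simpa using this

lemma dirichletEnergy_translate (φ : E n → ℝ) (a : E n) :
    dirichletEnergy (fun y => φ (y + a)) = dirichletEnergy φ := by
  rw [dirichletEnergy, dirichletEnergy,
    ← integral_add_right_eq_self (fun x => ‖gradient φ x‖ ^ 2) a]
  refine integral_congr_ae (ae_of_all _ fun x => ?_)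
  simp only [norm_gradient_eq, fderiv_comp_add_right]

/-- Away from `0` the inequality holds with an error controlled by the mass. For `s = 0`, where the
problem is critical at every point, this follows by translating far into the half-space. -/
lemma exists_hardySobolev_away [NeZero n] (hn : 3 ≤ n) {Ω : Set (E n)} (hΩ : IsOpen Ω)
    (h0 : (0 : E n) ∉ Ω) (hb : Bornology.IsBounded Ω) {γ s m : ℝ} (hs0 : 0 ≤ s)
    (hs2 : s ≤ 2) (hm0 : 0 < m)
    (hm : ∀ φ, IsTestFunction (halfSpace n) φ →
      m * hsTerm s φ ^ (2 / critExp n s) ≤ dirichletEnergy φ - γ * hardyTerm φ)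
    {r : ℝ} (hr : 0 < r) :
    ∃ C, 0 ≤ C ∧ ∀ φ, IsTestFunction Ω φ → (∀ x, φ x ≠ 0 → r ≤ ‖x‖) →
      m * hsTerm s φ ^ (2 / critExp n s) ≤
        dirichletEnergy φ - γ * hardyTerm φ + C * massTerm φ := by
  have hp := critExp_pos hn hs2
  have key : ∃ C, 0 ≤ C ∧ ∀ φ, IsTestFunction Ω φ → (∀ x, φ x ≠ 0 → r ≤ ‖x‖) →
      m * hsTerm s φ ^ (2 / critExp n s) ≤ dirichletEnergy φ + C * massTerm φ := by
    rcases hs0.eq_or_lt with rfl | hs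
    · obtain ⟨R, hR0, hR⟩ := hb.exists_pos_norm_le
      refine ⟨|γ|, abs_nonneg γ, fun φ hφ _ => ?_⟩
      set a : E n := -(EuclideanSpace.single 0 (R + 1)) with ha
      have hfar : ∀ x ∈ Ω, 1 ≤ (x - a) 0 := by
        intro x hx
        have h1 : |x 0| ≤ ‖x‖ := PiLp.norm_apply_le x 0
        have h2 := (abs_le.1 (h1.trans (hR x hx))).1
        simp [ha]
        linarith
      have hT : IsTestFunction (halfSpace n) (fun y => φ (y + a)) :=
        hφ.translate a fun x hx => lt_of_lt_of_le one_pos (hfar x hx)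
      have h1 := hm _ hT
      have hN : hsTerm 0 (fun y => φ (y + a)) = hsTerm 0 φ := by
        simp only [hsTerm, Real.rpow_zero, div_one]
        exact integral_add_right_eq_self (fun x => |φ x| ^ critExp n 0) a
      have hM : massTerm (fun y => φ (y + a)) = massTerm φ :=
        integral_add_right_eq_self (fun x => φ x ^ 2) a
      have hH : hardyTerm (fun y => φ (y + a)) ≤ massTerm φ := by
        have := hT.hardyTerm_le_massTerm one_pos fun y hy => by
          have hy' : y + a ∈ Ω := by_contra fun h => hy (hφ.eq_zero h)
          have h3 := hfar _ hy'
          rw [add_sub_cancel_right] at h3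
          exact h3.trans ((le_abs_self _).trans (PiLp.norm_apply_le y 0))
        rw [hM] at this
        simpa using this
      have h2 : -γ * hardyTerm (fun y => φ (y + a)) ≤ |γ| * massTerm φ :=
        neg_mul_le_abs_mul (by rwa [abs_of_nonneg (hardyTerm_nonneg _)])
      rw [hN, dirichletEnergy_translate] at h1
      linarith
    · obtain ⟨C, hC0, hC⟩ := exists_hardySobolev_interpolated hn
      have hsp : s / critExp n s ≤ 1 := by
        rw [div_le_one hp]
        exact hs2.trans (two_le_critExp hn hs2)
      obtain ⟨K, hK0, hK⟩ := exists_rpow_mul_rpow_le (θ := s / critExp n s) (τ := (m * C)⁻¹)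
        (by positivity) hsp (by positivity)
      refine ⟨m * (K * (r ^ 2)⁻¹), by positivity, fun φ hφ hsupp => ?_⟩
      have hA := dirichletEnergy_nonneg φ
      have h1 := (hC Ω φ s hΩ h0 hs0 hs2 hφ).trans
        (hK _ _ (hardyTerm_nonneg φ) (mul_nonneg hC0.le hA))
      have h2 := hφ.hardyTerm_le_massTerm hr hsupp
      calc m * hsTerm s φ ^ (2 / critExp n s)
          ≤ m * (K * ((r ^ 2)⁻¹ * massTerm φ) + (m * C)⁻¹ * (C * dirichletEnergy φ)) := by
            refine mul_le_mul_of_nonneg_left (h1.trans ?_) hm0.le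
            gcongr
        _ = _ := by
            field_simp
            ring
  obtain ⟨C, hC0, hC⟩ := key
  refine ⟨C + |γ| * (r ^ 2)⁻¹, by positivity, fun φ hφ hsupp => ?_⟩
  have h1 := hC φ hφ hsupp
  have h2 := hφ.hardyTerm_le_massTerm hr hsupp
  have h3 : γ * hardyTerm φ ≤ |γ| * ((r ^ 2)⁻¹ * massTerm φ) := by
    have := neg_mul_le_abs_mul (γ := -γ) (a := hardyTerm φ)
      (b := (r ^ 2)⁻¹ * massTerm φ) (by rwa [abs_of_nonneg (hardyTerm_nonneg φ)])
    simpa using this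
  nlinarith

lemma IsTestFunction.smooth_mul {Ω : Set (E n)} {η φ : E n → ℝ} (hη : ContDiff ℝ ∞ η)
    (hφ : IsTestFunction Ω φ) : IsTestFunction Ω (fun x => η x * φ x) :=
  ⟨hη.mul hφ.smooth, hφ.compact.mul_left,
    (tsupport_mul_subset_right (f := η) (g := φ)).trans hφ.support_subset⟩

lemma gradient_mul {η φ : E n → ℝ} {x : E n} (hη : DifferentiableAt ℝ η x)
    (hφ : DifferentiableAt ℝ φ x) :
    gradient (fun x => η x * φ x) x = η x • gradient φ x + φ x • gradient η x := by
  have : fderiv ℝ (fun x => η x * φ x) x = η x • fderiv ℝ φ x + φ x • fderiv ℝ η x :=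
    fderiv_mul hη hφ
  simp [gradient, this]

/-- Subadditivity of `N^{2/p}` with respect to a quadratic partition of unity. -/
lemma hsTerm_rpow_le_add (hn : 3 ≤ n) {Ω : Set (E n)} (hΩ : IsOpen Ω) (h0 : (0 : E n) ∉ Ω)
    {s : ℝ} (hs2 : s ≤ 2) {φ φ₁ φ₂ : E n → ℝ} (h1 : IsTestFunction Ω φ₁)
    (h2 : IsTestFunction Ω φ₂) (hφ : ∀ x, φ x ^ 2 = φ₁ x ^ 2 + φ₂ x ^ 2) :
    hsTerm s φ ^ (2 / critExp n s) ≤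
      hsTerm s φ₁ ^ (2 / critExp n s) + hsTerm s φ₂ ^ (2 / critExp n s) := by
  have hp := two_le_critExp hn hs2
  have hp0 := critExp_pos hn hs2
  set p := critExp n s
  set q := p / 2 with hq
  have hq0 : 0 < q := by positivity
  have hq1 : 1 ≤ q := by
    rw [hq, le_div_iff₀ two_pos]
    linarith
  set W : E n → ℝ := fun x => ‖x‖ ^ (-s / q) with hW
  have hWc : ContinuousOn W Ω := IsTestFunction.continuousOn_norm_rpow h0 _
  have hm : ∀ ψ, IsTestFunction Ω ψ →
      MemLp (fun x => W x * (ψ x * ψ x)) (ENNReal.ofReal q) volume := fun ψ hψ =>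
    (hψ.smooth_mul hψ.smooth).memLp_mul hΩ hWc _
  have hT : ∀ ψ : E n → ℝ, MemLp (fun x => W x * (ψ x * ψ x)) (ENNReal.ofReal q) volume →
      hsTerm s ψ ^ (2 / p) =
        (eLpNorm (fun x => W x * (ψ x * ψ x)) (ENNReal.ofReal q) volume).toReal := by
    intro ψ hψ
    have e1 : hsTerm s ψ =
        (eLpNorm (fun x => W x * (ψ x * ψ x)) (ENNReal.ofReal q) volume).toReal ^ q := by
      rw [toReal_eLpNorm_rpow hq0 hψ, hsTerm]
      refine integral_congr_ae (ae_of_all _ fun x => ?_)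
      simp only [hW]
      rw [hardySobolev_weight_rpow hq0, ← sq, abs_pow, ← Real.rpow_natCast,
        ← Real.rpow_mul (abs_nonneg _)]
      congr 2
      rw [hq]
      push_cast
      ring
    rw [e1, ← Real.rpow_mul ENNReal.toReal_nonneg]
    have : q * (2 / p) = 1 := by
      rw [hq]
      field_simp
    rw [this, Real.rpow_one]
  have hsum : (fun x => W x * (φ x * φ x)) =
      fun x => W x * (φ₁ x * φ₁ x) + W x * (φ₂ x * φ₂ x) := by
    ext x
    rw [← sq, hφ x]
    ring
  have hmφ : MemLp (fun x => W x * (φ x * φ x)) (ENNReal.ofReal q) volume := by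
    rw [hsum]
    exact (hm _ h1).add (hm _ h2)
  rw [hT φ hmφ, hT φ₁ (hm _ h1), hT φ₂ (hm _ h2), hsum,
    ← ENNReal.toReal_add (hm _ h1).2.ne (hm _ h2).2.ne]
  exact ENNReal.toReal_mono (ENNReal.add_ne_top.2 ⟨(hm _ h1).2.ne, (hm _ h2).2.ne⟩)
    (eLpNorm_add_le (hm _ h1).1 (hm _ h2).1 (by simpa using hq1))

/-- A quadratic partition of unity `sin² θ + cos² θ = 1` separating `0` from the exterior of a
ball. -/
lemma exists_angle {δ : ℝ} (hδ : 0 < δ) : ∃ (θ : E n → ℝ) (B : ℝ), ContDiff ℝ ∞ θ ∧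
    (∀ x, ‖gradient θ x‖ ^ 2 ≤ B) ∧ 0 ≤ B ∧
    tsupport (fun x => Real.sin (θ x)) ⊆ Metric.ball 0 δ ∧
    ∀ x, Real.cos (θ x) ≠ 0 → δ / 3 ≤ ‖x‖ := by
  set f : ContDiffBump (0 : E n) := ⟨δ / 3, δ / 2, by positivity, by linarith⟩ with hf
  have hsm : ContDiff ℝ ∞ (fun x => Real.pi / 2 * f x) := contDiff_const.mul f.contDiff
  have hgc : Continuous (gradient fun x => Real.pi / 2 * f x) :=
    (InnerProductSpace.toDual ℝ (E n)).symm.continuous.comp (hsm.continuous_fderiv (by simp))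
  have hcs : HasCompactSupport (gradient fun x => Real.pi / 2 * f x) := by
    refine HasCompactSupport.comp_left (g := (InnerProductSpace.toDual ℝ (E n)).symm) ?_ (by simp)
    exact HasCompactSupport.fderiv (𝕜 := ℝ) f.hasCompactSupport.mul_left
  obtain ⟨B, hB⟩ := hgc.bounded_above_of_compact_support hcs
  refine ⟨fun x => Real.pi / 2 * f x, B ^ 2, hsm,
    fun x => pow_le_pow_left₀ (norm_nonneg _) (hB x) 2, sq_nonneg B, ?_, ?_⟩
  · have h1 : tsupport (fun x => Real.sin (Real.pi / 2 * f x)) ⊆ tsupport f :=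
      closure_mono fun x hx h0 => hx (by simp [h0])
    refine h1.trans ?_
    rw [f.tsupport_eq]
    exact Metric.closedBall_subset_ball (by simp only [hf]; linarith)
  · intro x hx
    by_contra! h
    refine hx ?_
    have h1 : f x = 1 := f.one_of_mem_closedBall (by
      simp only [hf, mem_closedBall_zero_iff]
      exact h.le)
    simp [h1]

/-- The inequality of the half-space holds on `Ω` up to a small multiple of the Dirichlet energy and
a large multiple of the mass: the latter is a lower order term, and this is all the compactness
that the minimisation problem needs. -/
lemma exists_localised_hardySobolev [NeZero n] (hn : 3 ≤ n) {Ω : Set (E n)} (hΩ : IsOpen Ω)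
    (hb : Bornology.IsBounded Ω)
    (h0 : (0 : E n) ∈ frontier Ω) (hsm : SmoothBoundaryAt Ω 0) {γ s m : ℝ}
    (hs0 : 0 ≤ s) (hs2 : s ≤ 2) (hm0 : 0 < m)
    (hm : ∀ φ, IsTestFunction (halfSpace n) φ →
      m * hsTerm s φ ^ (2 / critExp n s) ≤ dirichletEnergy φ - γ * hardyTerm φ)
    {ε : ℝ} (hε : 0 < ε) :
    ∃ C, 0 ≤ C ∧ ∀ φ, IsTestFunction Ω φ →
      m * hsTerm s φ ^ (2 / critExp n s) ≤
        dirichletEnergy φ - γ * hardyTerm φ + ε * dirichletEnergy φ + C * massTerm φ := by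
  have h0' : (0 : E n) ∉ Ω := by
    rw [hΩ.frontier_eq] at h0
    exact h0.2
  obtain ⟨δ, hδ, hnear⟩ := exists_ball_hardySobolev hn hΩ h0 hsm hs2 hm0 hm hε
  obtain ⟨C, hC0, haway⟩ := exists_hardySobolev_away hn hΩ h0' hb hs0 hs2 hm0 hm
    (r := δ / 3) (by positivity)
  obtain ⟨θ, B, hθ, hθB, hB0, hsin, hcos⟩ := exists_angle (n := n) hδ
  refine ⟨C + (1 + ε) * B, by positivity, fun φ hφ => ?_⟩
  have hsθ : ContDiff ℝ ∞ fun x => Real.sin (θ x) := Real.contDiff_sin.comp hθ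
  have hcθ : ContDiff ℝ ∞ fun x => Real.cos (θ x) := Real.contDiff_cos.comp hθ
  have h1 := hφ.smooth_mul hsθ
  have h2 := hφ.smooth_mul hcθ
  have n1 := hnear _ h1 ((tsupport_mul_subset_left (f := fun x => Real.sin (θ x))
    (g := φ)).trans hsin)
  have n2 := haway _ h2 fun x hx => hcos x (left_ne_zero_of_mul hx)
  have hsq : ∀ x, φ x ^ 2 = (Real.sin (θ x) * φ x) ^ 2 + (Real.cos (θ x) * φ x) ^ 2 := by
    intro x
    have := Real.sin_sq_add_cos_sq (θ x)
    linear_combination -(φ x ^ 2) * this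
  have n3 := hsTerm_rpow_le_add hn hΩ h0' hs2 h1 h2 hsq
  have hH : hardyTerm φ = hardyTerm (fun x => Real.sin (θ x) * φ x) +
      hardyTerm (fun x => Real.cos (θ x) * φ x) := by
    rw [hardyTerm, hardyTerm, hardyTerm, ← integral_add (h1.integrable_hardy hΩ h0')
      (h2.integrable_hardy hΩ h0')]
    refine integral_congr_ae (ae_of_all _ fun x => ?_)
    simp only
    rw [hsq x, add_div]
  have hM : massTerm φ = massTerm (fun x => Real.sin (θ x) * φ x) +
      massTerm (fun x => Real.cos (θ x) * φ x) := by
    rw [massTerm, massTerm, massTerm, ← integral_add h1.integrable_mass h2.integrable_mass]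
    exact integral_congr_ae (ae_of_all _ hsq)
  have hA : dirichletEnergy (fun x => Real.sin (θ x) * φ x) +
      dirichletEnergy (fun x => Real.cos (θ x) * φ x) ≤ dirichletEnergy φ + B * massTerm φ := by
    rw [dirichletEnergy, dirichletEnergy, dirichletEnergy, massTerm, ← integral_const_mul,
      ← integral_add h1.integrable_dirichlet h2.integrable_dirichlet,
      ← integral_add hφ.integrable_dirichlet (hφ.integrable_mass.const_mul _)]
    refine integral_mono (h1.integrable_dirichlet.add h2.integrable_dirichlet)
      (hφ.integrable_dirichlet.add (hφ.integrable_mass.const_mul _)) fun x => ?_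
    have hθd : DifferentiableAt ℝ θ x := hθ.differentiable (by simp) x
    have g1 : gradient (fun x => Real.sin (θ x)) x = Real.cos (θ x) • gradient θ x := by
      simp [gradient, fderiv_sin hθd]
    have g2 : gradient (fun x => Real.cos (θ x)) x = (-Real.sin (θ x)) • gradient θ x := by
      simp [gradient, fderiv_cos hθd]
    simp only
    rw [gradient_mul (hsθ.differentiable (by simp) x) (hφ.differentiableAt x),
      gradient_mul (hcθ.differentiable (by simp) x) (hφ.differentiableAt x), g1, g2,
      norm_add_sq_real, norm_add_sq_real]
    simp only [smul_smul, norm_smul, real_inner_smul_left, real_inner_smul_right, mul_pow,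
      Real.norm_eq_abs, sq_abs]
    have hsc := Real.sin_sq_add_cos_sq (θ x)
    have hg := hθB x
    have e : Real.sin (θ x) ^ 2 * ‖gradient φ x‖ ^ 2 +
        2 * (Real.sin (θ x) * (φ x * Real.cos (θ x) * inner ℝ (gradient φ x) (gradient θ x))) +
        (φ x * Real.cos (θ x)) ^ 2 * ‖gradient θ x‖ ^ 2 +
        (Real.cos (θ x) ^ 2 * ‖gradient φ x‖ ^ 2 +
        2 * (Real.cos (θ x) * (φ x * -Real.sin (θ x) * inner ℝ (gradient φ x) (gradient θ x))) +
        (φ x * -Real.sin (θ x)) ^ 2 * ‖gradient θ x‖ ^ 2) =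
        ‖gradient φ x‖ ^ 2 + ‖gradient θ x‖ ^ 2 * φ x ^ 2 := by
      linear_combination (‖gradient φ x‖ ^ 2 + ‖gradient θ x‖ ^ 2 * φ x ^ 2) * hsc
    have hle : ‖gradient θ x‖ ^ 2 * φ x ^ 2 ≤ B * φ x ^ 2 := by gcongr
    nlinarith [e, hle]
  have hM2 : C * massTerm (fun x => Real.cos (θ x) * φ x) ≤ C * massTerm φ := by
    rw [hM]
    have := massTerm_nonneg (fun x => Real.sin (θ x) * φ x)
    gcongr
    linarith
  have hA2 := dirichletEnergy_nonneg (fun x => Real.cos (θ x) * φ x)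
  have hεA := mul_le_mul_of_nonneg_left hA (by positivity : 0 ≤ 1 + ε)
  have hm3 := mul_le_mul_of_nonneg_left n3 hm0.le
  have hεA2 := mul_nonneg hε.le hA2
  rw [hH]
  linarith

/-- Gårding's inequality: below the Hardy constant `n² / 4` of the half-space the quadratic form is
coercive up to the mass. -/
lemma exists_coercive [NeZero n] (hn : 3 ≤ n) {Ω : Set (E n)} (hΩ : IsOpen Ω)
    (hb : Bornology.IsBounded Ω) (h0 : (0 : E n) ∈ frontier Ω) (hsm : SmoothBoundaryAt Ω 0)
    {γ : ℝ} (hγ : γ < (n : ℝ) ^ 2 / 4) :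
    ∃ c C, 0 < c ∧ 0 ≤ C ∧ ∀ φ, IsTestFunction Ω φ →
      c * dirichletEnergy φ ≤ dirichletEnergy φ - γ * hardyTerm φ + C * massTerm φ := by
  rcases le_or_gt γ 0 with hγ0 | hγ0
  · refine ⟨1, 0, one_pos, le_rfl, fun φ _ => ?_⟩
    nlinarith [mul_nonneg (neg_nonneg.2 hγ0) (hardyTerm_nonneg φ)]
  · set m : ℝ := (n : ℝ) ^ 2 / 4 with hm
    have hm0 : 0 < m := hγ0.trans hγ
    obtain ⟨C, hC0, hC⟩ := exists_localised_hardySobolev hn hΩ hb h0 hsm (γ := 0) (s := 2) (m := m)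
      (by norm_num) le_rfl hm0 (fun φ hφ => by
        rw [critExp_two hn, div_self two_ne_zero, Real.rpow_one]
        simpa [hsTerm, critExp_two hn, hardyTerm] using hφ.hardy_halfSpace)
      (ε := (m - γ) / (2 * γ)) (div_pos (by linarith) (by positivity))
    refine ⟨(m - γ) / (2 * m), γ / m * C, div_pos (by linarith) (by positivity), by positivity,
      fun φ hφ => ?_⟩
    have h1 := hC φ hφ
    have h2 : hsTerm 2 φ = hardyTerm φ := by simp [hsTerm, critExp_two hn, hardyTerm]
    rw [critExp_two hn, div_self two_ne_zero, Real.rpow_one, h2] at h1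
    have h3 := mul_le_mul_of_nonneg_left h1 (by positivity : 0 ≤ γ / m)
    have e1 : γ / m * (m * hardyTerm φ) = γ * hardyTerm φ := by field_simp
    have e2 : γ / m * (dirichletEnergy φ - 0 * hardyTerm φ +
        (m - γ) / (2 * γ) * dirichletEnergy φ + C * massTerm φ) =
        dirichletEnergy φ - (m - γ) / (2 * m) * dirichletEnergy φ + γ / m * C * massTerm φ := by
      field_simp
      ring
    rw [e1, e2] at h3
    linarith

/-! ### The Poincaré inequality on convex sets -/

lemma lintegral_comp_add_smul (f : E n → ℝ≥0∞) (c : E n) {t : ℝ} (ht : t ≠ 0)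
    (hf : Measurable f) :
    ∫⁻ x, f (c + t • x) = ENNReal.ofReal (|(t ^ n)⁻¹|) * ∫⁻ x, f x := by
  have h1 : ∫⁻ x, f (c + t • x) = ∫⁻ y, f (c + y) ∂(Measure.map (t • ·) volume) := by
    exact (lintegral_map (f := fun y => f (c + y)) (hf.comp (measurable_const_add c))
      (measurable_const_smul t)).symm
  rw [h1, Measure.map_addHaar_smul _ ht, lintegral_smul_measure, lintegral_add_left_eq_self f c]
  simp

/-- Integrating along segments, and using that one of the two end points of a segment is at
parameter distance at least `1 / 2`. -/
lemma lintegral_segment_le {B : Set (E n)} (hBm : MeasurableSet B) {G : E n → ℝ≥0∞}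
    (hG : Measurable G) (hGB : ∀ x ∉ B, G x = 0) (t : ℝ) :
    ∫⁻ x in B, ∫⁻ y in B, G (y + t • (x - y)) ≤ 2 ^ n * volume B * ∫⁻ x in B, G x := by
  have hI : ∫⁻ x in B, G x = ∫⁻ x, G x := by
    rw [← lintegral_indicator hBm]
    refine lintegral_congr fun x => ?_
    by_cases hx : x ∈ B
    · simp [hx]
    · simp [hx, hGB x hx]
  have hscale : ∀ {r : ℝ}, 1 / 2 ≤ r → ENNReal.ofReal |(r ^ n)⁻¹| ≤ 2 ^ n := by
    intro r hr
    have hr0 : 0 < r := by linarith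
    rw [abs_of_pos (by positivity), ← inv_pow,
      show (2 : ℝ≥0∞) ^ n = ENNReal.ofReal (2 ^ n) by
        rw [ENNReal.ofReal_pow (by norm_num)]; simp]
    refine ENNReal.ofReal_le_ofReal (pow_le_pow_left₀ (by positivity) ?_ n)
    rw [inv_le_comm₀ hr0 two_pos]
    linarith
  rw [hI]
  rcases le_total (1 / 2) t with h | h
  · have hmeas : Measurable fun z : E n × E n => G (z.2 + t • (z.1 - z.2)) := by
      refine hG.comp ?_
      fun_prop
    rw [lintegral_lintegral_swap hmeas.aemeasurable]
    calc ∫⁻ y in B, ∫⁻ x in B, G (y + t • (x - y)) ≤ ∫⁻ y in B, 2 ^ n * ∫⁻ x, G x := by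
          refine lintegral_mono fun y => ?_
          calc ∫⁻ x in B, G (y + t • (x - y)) ≤ ∫⁻ x, G (y + t • (x - y)) :=
                setLIntegral_le_lintegral _ _
            _ = ∫⁻ x, G ((1 - t) • y + t • x) := by
                refine lintegral_congr fun x => ?_
                congr 1
                module
            _ ≤ _ := by
                rw [lintegral_comp_add_smul G _ (by linarith) hG]
                gcongr
                exact hscale h
      _ = _ := by
        rw [setLIntegral_const]
        ring
  · calc ∫⁻ x in B, ∫⁻ y in B, G (y + t • (x - y)) ≤ ∫⁻ x in B, 2 ^ n * ∫⁻ x, G x := by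
          refine lintegral_mono fun x => ?_
          calc ∫⁻ y in B, G (y + t • (x - y)) ≤ ∫⁻ y, G (y + t • (x - y)) :=
                setLIntegral_le_lintegral _ _
            _ = ∫⁻ y, G (t • x + (1 - t) • y) := by
                refine lintegral_congr fun x => ?_
                congr 1
                module
            _ ≤ _ := by
                rw [lintegral_comp_add_smul G _ (by linarith) hG]
                gcongr
                exact hscale (by linarith)
      _ = _ := by
        rw [setLIntegral_const]
        ring

/-- The increment of a `C¹` function along a segment. -/
lemma enorm_sub_sq_le {φ : E n → ℝ} (hφ : ContDiff ℝ 1 φ) (x y : E n) :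
    ‖φ x - φ y‖ₑ ^ 2 ≤ ‖x - y‖ₑ ^ 2 *
      ∫⁻ t in Set.Icc (0 : ℝ) 1, ‖gradient φ (y + t • (x - y))‖ₑ ^ 2 := by
  set ψ : ℝ → ℝ := fun t => fderiv ℝ φ (y + t • (x - y)) (x - y) with hψ
  have hline : Continuous fun t : ℝ => y + t • (x - y) := by fun_prop
  have hψc : Continuous ψ :=
    ((hφ.continuous_fderiv (by simp)).comp hline).clm_apply continuous_const
  have hder : ∀ t : ℝ, HasDerivAt (fun t => φ (y + t • (x - y))) (ψ t) t := by
    intro t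
    have h1 : HasDerivAt (fun t : ℝ => y + t • (x - y)) (x - y) t := by
      simpa using ((hasDerivAt_id t).smul_const (x - y)).const_add y
    exact (hφ.differentiable (by simp) _).hasFDerivAt.comp_hasDerivAt t h1
  have hftc : ∫ t in (0 : ℝ)..1, ψ t = φ x - φ y := by
    rw [intervalIntegral.integral_eq_sub_of_hasDerivAt (fun t _ => hder t)
      (hψc.intervalIntegrable _ _)]
    simp
  rw [intervalIntegral.integral_of_le zero_le_one, ← integral_Icc_eq_integral_Ioc] at hftc
  have hprob : volume (Set.Icc (0 : ℝ) 1) = 1 := by simp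
  -- Jensen's inequality for the square.
  have hjensen : ‖φ x - φ y‖ₑ ^ 2 ≤ ∫⁻ t in Set.Icc (0 : ℝ) 1, ‖ψ t‖ₑ ^ 2 := by
    have : IsProbabilityMeasure (volume.restrict (Set.Icc (0 : ℝ) 1)) := ⟨by simp⟩
    have h1 : ‖φ x - φ y‖ₑ ≤ eLpNorm ψ 1 (volume.restrict (Set.Icc (0 : ℝ) 1)) := by
      rw [← hftc, eLpNorm_one_eq_lintegral_enorm]
      exact enorm_integral_le_lintegral_enorm _
    have h2 := h1.trans (eLpNorm_le_eLpNorm_of_exponent_le (p := 1) (q := 2) (by norm_num)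
      hψc.aestronglyMeasurable)
    have h3 := pow_le_pow_left₀ zero_le h2 2
    refine h3.trans (le_of_eq ?_)
    rw [eLpNorm_eq_lintegral_rpow_enorm_toReal (by norm_num) (by norm_num), ← ENNReal.rpow_natCast,
      ← ENNReal.rpow_mul]
    simp
  refine hjensen.trans ?_
  rw [← lintegral_const_mul' _ _ (by simp)]
  refine lintegral_mono fun t => ?_
  rw [← mul_pow, mul_comm]
  gcongr
  have h4 : ‖ψ t‖ ≤ ‖gradient φ (y + t • (x - y))‖ * ‖x - y‖ := by
    rw [norm_gradient_eq]
    exact ContinuousLinearMap.le_opNorm _ _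
  rw [← ofReal_norm, ← ofReal_norm, ← ofReal_norm, ← ENNReal.ofReal_mul (norm_nonneg _)]
  exact ENNReal.ofReal_le_ofReal h4

/-- The Poincaré inequality on a convex set, in the form of a double integral. -/
lemma IsTestFunction.lintegral_sub_sq_le {Ω : Set (E n)} {φ : E n → ℝ} (hφ : IsTestFunction Ω φ)
    {B : Set (E n)} (hBm : MeasurableSet B) (hBc : Convex ℝ B) {D : ℝ≥0∞} (hD : D ≠ ⊤)
    (hBD : ∀ x ∈ B, ∀ y ∈ B, ‖x - y‖ₑ ^ 2 ≤ D) :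
    ∫⁻ x in B, ∫⁻ y in B, ‖φ x - φ y‖ₑ ^ 2 ≤
      D * (2 ^ n * volume B) * ∫⁻ x in B, ‖gradient φ x‖ₑ ^ 2 := by
  set G : E n → ℝ≥0∞ := B.indicator fun x => ‖gradient φ x‖ₑ ^ 2 with hGdef
  have hG : Measurable G :=
    (hφ.continuous_gradient.measurable.enorm.pow_const 2).indicator hBm
  have hG0 : ∀ x ∉ B, G x = 0 := fun x hx => Set.indicator_of_notMem hx _
  have hGB : ∫⁻ x in B, G x = ∫⁻ x in B, ‖gradient φ x‖ₑ ^ 2 :=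
    setLIntegral_congr_fun hBm fun x hx => Set.indicator_of_mem hx _
  have hpt : ∀ x ∈ B, ∀ y ∈ B, ‖φ x - φ y‖ₑ ^ 2 ≤
      D * ∫⁻ t in Set.Icc (0 : ℝ) 1, G (y + t • (x - y)) := by
    intro x hx y hy
    refine (enorm_sub_sq_le (hφ.smooth.of_le (by simp)) x y).trans ?_
    refine mul_le_mul' (hBD x hx y hy) (le_of_eq ?_)
    refine setLIntegral_congr_fun measurableSet_Icc fun t ht => ?_
    rw [hGdef, Set.indicator_of_mem (hBc.add_smul_sub_mem hy hx ht)]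
  have hm3 : Measurable fun z : (E n × ℝ) × E n => G (z.2 + z.1.2 • (z.1.1 - z.2)) := by
    refine hG.comp ?_
    fun_prop
  have hm2 : Measurable fun z : E n × ℝ => ∫⁻ y in B, G (y + z.2 • (z.1 - y)) :=
    hm3.lintegral_prod_right'
  calc ∫⁻ x in B, ∫⁻ y in B, ‖φ x - φ y‖ₑ ^ 2
      ≤ ∫⁻ x in B, ∫⁻ y in B, D * ∫⁻ t in Set.Icc (0 : ℝ) 1, G (y + t • (x - y)) := by
        refine setLIntegral_mono' hBm fun x hx => ?_
        exact setLIntegral_mono' hBm fun y hy => hpt x hx y hy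
    _ = D * ∫⁻ x in B, ∫⁻ t in Set.Icc (0 : ℝ) 1, ∫⁻ y in B, G (y + t • (x - y)) := by
        rw [← lintegral_const_mul' _ _ hD]
        refine lintegral_congr fun x => ?_
        rw [lintegral_const_mul' _ _ hD, lintegral_lintegral_swap]
        have hm1 : Measurable fun z : E n × ℝ => G (z.1 + z.2 • (x - z.1)) := by
          refine hG.comp ?_
          fun_prop
        exact hm1.aemeasurable
    _ = D * ∫⁻ t in Set.Icc (0 : ℝ) 1, ∫⁻ x in B, ∫⁻ y in B, G (y + t • (x - y)) := by
        rw [lintegral_lintegral_swap hm2.aemeasurable]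
    _ ≤ D * ∫⁻ _ in Set.Icc (0 : ℝ) 1, 2 ^ n * volume B * ∫⁻ x in B, G x := by
        gcongr 1
        exact setLIntegral_mono' measurableSet_Icc fun t _ =>
          lintegral_segment_le hBm hG hG0 t
    _ = _ := by
        rw [setLIntegral_const, hGB]
        simp
        ring

/-- The Poincaré inequality on convex sets for elements of `D^{1,2}(Ω)`. -/
lemma MemD12.lintegral_sub_sq_le (hn : 3 ≤ n) {Ω : Set (E n)} {u : E n → ℝ} {g : E n → E n}
    (hu : MemD12 Ω u g) {B : Set (E n)} (hBm : MeasurableSet B) (hBc : Convex ℝ B)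
    (hBf : volume B ≠ ⊤) {D : ℝ≥0∞} (hD : D ≠ ⊤)
    (hBD : ∀ x ∈ B, ∀ y ∈ B, ‖x - y‖ₑ ^ 2 ≤ D) :
    ∫⁻ x in B, ∫⁻ y in B, ‖u x - u y‖ₑ ^ 2 ≤
      D * (2 ^ n * volume B) * ∫⁻ x in B, ‖g x‖ₑ ^ 2 := by
  obtain ⟨φ, hφ, -, h2, h3, -⟩ := hu.exists_approx_ae hn
  have hsq : ∀ f : E n → E n, ∫⁻ x in B, ‖f x‖ₑ ^ 2 = eLpNorm f 2 (volume.restrict B) ^ 2 := by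
    intro f
    rw [eLpNorm_eq_lintegral_rpow_enorm_toReal (by norm_num) (by norm_num),
      ← ENNReal.rpow_natCast, ← ENNReal.rpow_mul]
    simp
  have hlim : Tendsto (fun k => ∫⁻ x in B, ‖gradient (φ k) x‖ₑ ^ 2) atTop
      (𝓝 (∫⁻ x in B, ‖g x‖ₑ ^ 2)) := by
    simp only [hsq]
    refine ENNReal.Tendsto.pow ?_
    refine tendsto_eLpNorm_of_tendsto_sub (by norm_num) (hu.memLp_grad.restrict B)
      (fun k => ((hφ k).memLp_gradient 2).1.restrict) ?_
    exact tendsto_of_tendsto_of_tendsto_of_le_of_le tendsto_const_nhds h2 (fun _ => zero_le)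
      fun k => eLpNorm_mono_measure _ Measure.restrict_le_self
  have hmeas : ∀ k, Measurable fun z : E n × E n => ‖φ k z.1 - φ k z.2‖ₑ ^ 2 := by
    intro k
    have := (hφ k).smooth.continuous.measurable
    fun_prop
  have hae := ae_restrict_of_ae (s := B) h3
  calc ∫⁻ x in B, ∫⁻ y in B, ‖u x - u y‖ₑ ^ 2
      ≤ ∫⁻ x in B, ∫⁻ y in B, liminf (fun k => ‖φ k x - φ k y‖ₑ ^ 2) atTop := by
        refine lintegral_mono_ae ?_
        filter_upwards [hae] with x hx
        refine lintegral_mono_ae ?_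
        filter_upwards [hae] with y hy
        refine le_of_eq (Tendsto.liminf_eq ?_).symm
        exact ENNReal.Tendsto.pow (hx.sub hy).enorm
    _ ≤ ∫⁻ x in B, liminf (fun k => ∫⁻ y in B, ‖φ k x - φ k y‖ₑ ^ 2) atTop := by
        refine lintegral_mono fun x => lintegral_liminf_le fun k => ?_
        exact (hmeas k).comp measurable_prodMk_left
    _ ≤ liminf (fun k => ∫⁻ x in B, ∫⁻ y in B, ‖φ k x - φ k y‖ₑ ^ 2) atTop :=
        lintegral_liminf_le fun k => (hmeas k).lintegral_prod_right'
    _ ≤ liminf (fun k => D * (2 ^ n * volume B) * ∫⁻ x in B, ‖gradient (φ k) x‖ₑ ^ 2) atTop :=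
        liminf_le_liminf (Eventually.of_forall fun k =>
          (hφ k).lintegral_sub_sq_le hBm hBc hD hBD)
    _ = _ := by
        refine (ENNReal.Tendsto.const_mul hlim (Or.inr ?_)).liminf_eq
        exact ENNReal.mul_ne_top hD (ENNReal.mul_ne_top (by simp) hBf)

/-! ### Rellich's theorem -/

lemma integrable_norm_sq {α F : Type*} [MeasurableSpace α] [NormedAddCommGroup F]
    {μ : Measure α} {f : α → F} (hf : MemLp f 2 μ) : Integrable (fun x => ‖f x‖ ^ 2) μ :=
  MemLp.integrable_norm_pow (p := 2) (by simpa using hf) two_ne_zero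

lemma lintegral_lintegral_sub_sq {μ : Measure (E n)} [IsFiniteMeasure μ] {u : E n → ℝ}
    (hu : MemLp u 2 μ) :
    (∫⁻ x, ∫⁻ y, ‖u x - u y‖ₑ ^ 2 ∂μ ∂μ).toReal =
      2 * (μ.real Set.univ * ∫ x, u x ^ 2 ∂μ) - 2 * (∫ x, u x ∂μ) ^ 2 := by
  have h1 : Integrable u μ := hu.integrable (by norm_num)
  have h2 : Integrable (fun x => u x ^ 2) μ := hu.integrable_sq
  have i1 : Integrable (fun z : E n × E n => u z.1 ^ 2 * (1 : ℝ)) (μ.prod μ) :=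
    h2.mul_prod (integrable_const (1 : ℝ))
  have i2 : Integrable (fun z : E n × E n => (1 : ℝ) * u z.2 ^ 2) (μ.prod μ) :=
    (integrable_const (1 : ℝ)).mul_prod h2
  have i3 : Integrable (fun z : E n × E n => u z.1 * u z.2) (μ.prod μ) := h1.mul_prod h1
  have hmeas : AEStronglyMeasurable (fun z : E n × E n => u z.1 - u z.2) (μ.prod μ) :=
    hu.1.comp_fst.sub hu.1.comp_snd
  have e1 : ∫⁻ x, ∫⁻ y, ‖u x - u y‖ₑ ^ 2 ∂μ ∂μ =
      ∫⁻ z, ‖u z.1 - u z.2‖ₑ ^ 2 ∂(μ.prod μ) :=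
    (lintegral_prod _ (hmeas.enorm.pow_const 2)).symm
  have e2 : ∫⁻ z, ‖u z.1 - u z.2‖ₑ ^ 2 ∂(μ.prod μ) =
      ∫⁻ z, ENNReal.ofReal ((u z.1 - u z.2) ^ 2) ∂(μ.prod μ) := by
    refine lintegral_congr fun z => ?_
    rw [← ofReal_norm, ← ENNReal.ofReal_pow (norm_nonneg _), Real.norm_eq_abs, sq_abs]
  rw [e1, e2, ← integral_eq_lintegral_of_nonneg_ae (ae_of_all _ fun z => sq_nonneg _)
    (hmeas.pow 2)]
  have e3 : ∀ z : E n × E n, (u z.1 - u z.2) ^ 2 =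
      u z.1 ^ 2 * 1 + 1 * u z.2 ^ 2 - 2 * (u z.1 * u z.2) := fun z => by ring
  simp only [e3]
  have i12 : Integrable (fun z : E n × E n => u z.1 ^ 2 * (1 : ℝ) + (1 : ℝ) * u z.2 ^ 2)
      (μ.prod μ) := i1.add i2
  rw [integral_sub i12 (i3.const_mul 2), integral_add i1 i2,
    integral_prod_mul (fun x => u x ^ 2) (fun _ => (1 : ℝ)),
    integral_prod_mul (fun _ => (1 : ℝ)) (fun x => u x ^ 2), integral_const_mul,
    integral_prod_mul]
  simp
  ring

/-- The Poincaré inequality on a convex set, with the mean value on the right-hand side. -/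
lemma MemD12.setIntegral_sq_le (hn : 3 ≤ n) {Ω : Set (E n)} {u : E n → ℝ} {g : E n → E n}
    (hu : MemD12 Ω u g) (hu2 : MemLp u 2 volume) {B : Set (E n)} (hBm : MeasurableSet B)
    (hBc : Convex ℝ B) (hBf : volume B ≠ ⊤) {D : ℝ} (hD : 0 ≤ D)
    (hBD : ∀ x ∈ B, ∀ y ∈ B, ‖x - y‖ ^ 2 ≤ D) :
    ∫ x in B, u x ^ 2 ≤ D * 2 ^ n * (∫ x in B, ‖g x‖ ^ 2) +
      (volume.real B)⁻¹ * (∫ x in B, u x) ^ 2 := by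
  have hg2 : ∫⁻ x in B, ‖g x‖ₑ ^ 2 = ENNReal.ofReal (∫ x in B, ‖g x‖ ^ 2) := by
    rw [ofReal_integral_eq_lintegral_ofReal (integrable_norm_sq (hu.memLp_grad.restrict B))
      (ae_of_all _ fun x => by positivity)]
    refine lintegral_congr fun x => ?_
    rw [← ofReal_norm, ← ENNReal.ofReal_pow (norm_nonneg _)]
  rcases eq_or_ne (volume B) 0 with h0 | h0
  · rw [Measure.restrict_eq_zero.2 h0]
    simp
  have hB0 : 0 < volume.real B := ENNReal.toReal_pos h0 hBf
  have : IsFiniteMeasure (volume.restrict B) := ⟨by simpa using hBf.lt_top⟩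
  have h1 := hu.lintegral_sub_sq_le hn hBm hBc hBf (D := ENNReal.ofReal D) (by simp) (by
    intro x hx y hy
    rw [← ofReal_norm, ← ENNReal.ofReal_pow (norm_nonneg _)]
    exact ENNReal.ofReal_le_ofReal (hBD x hx y hy))
  have h2 := ENNReal.toReal_mono (by
    rw [hg2]
    exact ENNReal.mul_ne_top (ENNReal.mul_ne_top (by simp) (ENNReal.mul_ne_top (by simp) hBf))
      (by simp)) h1
  have hG0 : 0 ≤ ∫ x in B, ‖g x‖ ^ 2 := integral_nonneg fun x => by positivity
  rw [lintegral_lintegral_sub_sq (hu2.restrict B), hg2, ENNReal.toReal_mul, ENNReal.toReal_mul,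
    ENNReal.toReal_mul, ENNReal.toReal_ofReal hD, ENNReal.toReal_ofReal hG0] at h2
  simp only [ENNReal.toReal_pow, ENNReal.toReal_ofNat, measureReal_restrict_apply_univ] at h2
  change _ ≤ D * (2 ^ n * volume.real B) * _ at h2
  have h3 : volume.real B * ∫ x in B, u x ^ 2 ≤
      volume.real B * (D * 2 ^ n * ∫ x in B, ‖g x‖ ^ 2) + (∫ x in B, u x) ^ 2 := by
    have : 0 ≤ volume.real B * (D * 2 ^ n * ∫ x in B, ‖g x‖ ^ 2) := by positivity
    nlinarith
  rw [← mul_le_mul_iff_right₀ hB0]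
  refine h3.trans (le_of_eq ?_)
  field_simp

/-- The cell of the grid of mesh `h` with index `j`. -/
def gridCell (h : ℝ) (j : Fin n → ℤ) : Set (E n) := {x | ∀ i, ⌊x i / h⌋ = j i}

lemma mem_gridCell {h : ℝ} (hh : 0 < h) {j : Fin n → ℤ} {x : E n} :
    x ∈ gridCell h j ↔ ∀ i, j i * h ≤ x i ∧ x i < (j i + 1) * h := by
  simp only [gridCell, Set.mem_ofPred_eq, Int.floor_eq_iff]
  refine forall_congr' fun i => ?_
  rw [le_div_iff₀ hh, div_lt_iff₀ hh]

lemma gridCell_eq_iInter {h : ℝ} (hh : 0 < h) (j : Fin n → ℤ) :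
    gridCell h j = ⋂ i, {x : E n | j i * h ≤ x i} ∩ {x : E n | x i < (j i + 1) * h} := by
  ext x
  simp [mem_gridCell hh]

lemma measurableSet_gridCell {h : ℝ} (hh : 0 < h) (j : Fin n → ℤ) :
    MeasurableSet (gridCell h j) := by
  rw [gridCell_eq_iInter hh]
  refine MeasurableSet.iInter fun i => ?_
  exact (measurableSet_le measurable_const (by fun_prop)).inter
    (measurableSet_lt (by fun_prop) measurable_const)

lemma convex_gridCell {h : ℝ} (hh : 0 < h) (j : Fin n → ℤ) : Convex ℝ (gridCell h j) := by
  rw [gridCell_eq_iInter hh]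
  refine convex_iInter fun i => ?_
  have hlin : IsLinearMap ℝ fun x : E n => x i := ⟨fun _ _ => rfl, fun _ _ => rfl⟩
  exact (convex_halfSpace_ge hlin _).inter (convex_halfSpace_lt hlin _)

lemma norm_sub_sq_le_of_mem_gridCell {h : ℝ} (hh : 0 < h) {j : Fin n → ℤ} {x y : E n}
    (hx : x ∈ gridCell h j) (hy : y ∈ gridCell h j) : ‖x - y‖ ^ 2 ≤ n * h ^ 2 := by
  rw [EuclideanSpace.norm_sq_eq]
  have h1 : ∀ i ∈ Finset.univ, ‖(x - y) i‖ ^ 2 ≤ h ^ 2 := by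
    intro i _
    rw [Real.norm_eq_abs]
    refine pow_le_pow_left₀ (abs_nonneg _) ?_ 2
    obtain ⟨a, b⟩ := (mem_gridCell hh).1 hx i
    obtain ⟨c, d⟩ := (mem_gridCell hh).1 hy i
    rw [PiLp.sub_apply, abs_le]
    constructor <;> linarith
  exact (Finset.sum_le_sum h1).trans (by simp)

lemma isBounded_gridCell {h : ℝ} (hh : 0 < h) (j : Fin n → ℤ) :
    Bornology.IsBounded (gridCell h j) := by
  rw [Metric.isBounded_iff]
  refine ⟨Real.sqrt (n * h ^ 2), fun x hx y hy => ?_⟩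
  rw [dist_eq_norm]
  exact Real.le_sqrt_of_sq_le (norm_sub_sq_le_of_mem_gridCell hh hx hy)

lemma pairwise_disjoint_gridCell (h : ℝ) :
    Pairwise (Function.onFun Disjoint (gridCell (n := n) h)) := by
  intro j k hjk
  refine Set.disjoint_left.2 fun x hj hk => hjk ?_
  ext i
  exact (hj i).symm.trans (hk i)

lemma exists_finset_gridCell {Ω : Set (E n)} (hb : Bornology.IsBounded Ω) {h : ℝ} (hh : 0 < h) :
    ∃ J : Finset (Fin n → ℤ), Ω ⊆ ⋃ j ∈ J, gridCell h j := by
  obtain ⟨R, -, hR⟩ := hb.exists_pos_norm_le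
  refine ⟨Fintype.piFinset fun _ => Finset.Icc ⌊-R / h⌋ ⌊R / h⌋, fun x hx => ?_⟩
  rw [Set.mem_iUnion₂]
  refine ⟨fun i => ⌊x i / h⌋, ?_, fun i => rfl⟩
  rw [Fintype.mem_piFinset]
  intro i
  have h1 := abs_le.1 ((PiLp.norm_apply_le x i).trans (hR x hx))
  rw [Finset.mem_Icc]
  exact ⟨Int.floor_le_floor (by gcongr; exact h1.1), Int.floor_le_floor (by gcongr; exact h1.2)⟩

lemma tendsto_clm_of_weakly_null {H : Type*} [NormedAddCommGroup H] [InnerProductSpace ℝ H]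
    [CompleteSpace H] {x : ℕ → H} (hx : ∀ z, Tendsto (fun k => ⟪x k, z⟫_ℝ) atTop (𝓝 0))
    (ℓ : H →L[ℝ] ℝ) : Tendsto (fun k => ℓ (x k)) atTop (𝓝 0) := by
  have h1 := hx ((InnerProductSpace.toDual ℝ H).symm ℓ)
  refine h1.congr fun k => ?_
  rw [real_inner_comm, InnerProductSpace.toDual_symm_apply]

/-- Rellich's theorem: on a bounded set, weakly null bounded sequences of `D^{1,2}` converge to zero
in `L²`. On each cell of a fine grid the Poincaré inequality reduces this to the mean values, which
are weakly continuous. -/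
lemma tendsto_massMap_of_weakly_null (hn : 3 ≤ n) {Ω : Set (E n)}
    (hb : Bornology.IsBounded Ω) (hK : Controlled Ω (fun _ => 1) 2)
    {x : ℕ → gradSpace hn Ω} {R : ℝ} (hR : ∀ k, ‖x k‖ ≤ R)
    (hx : ∀ z, Tendsto (fun k => ⟪x k, z⟫_ℝ) atTop (𝓝 0)) :
    Tendsto (fun k => ‖weightMap hK (x k)‖) atTop (𝓝 0) := by
  have hmem : ∀ k, MemLp (potential (x k)) 2 volume := fun k => by
    simpa using hK.memLp hn (memD12_potential (x k))
  have hnorm : ∀ k, ‖weightMap hK (x k)‖ ^ 2 = ∫ y, potential (x k) y ^ 2 := by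
    intro k
    rw [Lp.norm_def, eLpNorm_congr_ae (coeFn_weightMap hK (x k)), toReal_eLpNorm_two_sq
      (by simpa using hmem k)]
    simp
  have hgrad : ∀ k, ∫ y, ‖(x k).1 y‖ ^ 2 ≤ R ^ 2 := by
    intro k
    rw [← toReal_eLpNorm_two_sq (Lp.memLp _), ← Lp.norm_def]
    exact pow_le_pow_left₀ (norm_nonneg _) (hR k) 2
  have hsq : Tendsto (fun k => ‖weightMap hK (x k)‖ ^ 2) atTop (𝓝 0) := by
    rw [Metric.tendsto_atTop]
    intro ε hε
    obtain ⟨h, hh0, hh⟩ : ∃ h : ℝ, 0 < h ∧ n * h ^ 2 * 2 ^ n * R ^ 2 < ε / 2 := by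
      have : Tendsto (fun h : ℝ => n * h ^ 2 * 2 ^ n * R ^ 2) (𝓝[>] 0) (𝓝 0) := by
        have hc : Continuous fun h : ℝ => n * h ^ 2 * 2 ^ n * R ^ 2 := by fun_prop
        simpa using (hc.tendsto 0).mono_left nhdsWithin_le_nhds
      obtain ⟨h, h1, h2⟩ := ((this.eventually (gt_mem_nhds (half_pos hε))).and
        self_mem_nhdsWithin).exists
      exact ⟨h, h2, h1⟩
    obtain ⟨J, hJ⟩ := exists_finset_gridCell hb hh0
    have hfin : ∀ j, volume (gridCell (n := n) h j) ≠ ⊤ := fun j =>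
      (isBounded_gridCell hh0 j).measure_lt_top.ne
    have hmean : Tendsto (fun k => ∑ j ∈ J, (volume.real (gridCell (n := n) h j))⁻¹ *
        (∫ y in gridCell h j, potential (x k) y) ^ 2) atTop (𝓝 0) := by
      have : ∀ j ∈ J, Tendsto (fun k => (volume.real (gridCell (n := n) h j))⁻¹ *
          (∫ y in gridCell h j, potential (x k) y) ^ 2) atTop (𝓝 0) := by
        intro j _
        have h1 := tendsto_clm_of_weakly_null hx ((innerSL ℝ (indicatorConstLp 2
          (measurableSet_gridCell hh0 j) (hfin j) (1 : ℝ))).comp (weightMap hK))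
        have h2 : Tendsto (fun k => ∫ y in gridCell h j, potential (x k) y) atTop (𝓝 0) := by
          refine h1.congr fun k => ?_
          rw [ContinuousLinearMap.comp_apply, innerSL_apply_apply, L2.inner_indicatorConstLp_one]
          refine integral_congr_ae (ae_restrict_of_ae ?_)
          filter_upwards [coeFn_weightMap hK (x k)] with y hy
          rw [hy, one_mul]
        simpa using (h2.pow 2).const_mul (volume.real (gridCell (n := n) h j))⁻¹
      simpa using tendsto_finsetSum J this
    obtain ⟨N, hN⟩ := Metric.tendsto_atTop.1 hmean (ε / 2) (half_pos hε)
    refine ⟨N, fun k hk => ?_⟩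
    have h1 := hN k hk
    rw [Real.dist_eq, sub_zero] at h1 ⊢
    have h2 := (abs_lt.1 h1).2
    rw [abs_of_nonneg (sq_nonneg _), hnorm]
    set B : Set (E n) := ⋃ j ∈ J, gridCell h j with hB
    have e1 : ∫ y, potential (x k) y ^ 2 = ∫ y in B, potential (x k) y ^ 2 := by
      refine (setIntegral_eq_integral_of_ae_compl_eq_zero ?_).symm
      filter_upwards [(memD12_potential (x k)).ae_eq_zero hn] with y hy hyB
      rw [(hy fun h' => hyB (hJ h')).1]
      simp
    have hmeasB := fun j (_ : j ∈ J) => measurableSet_gridCell (n := n) hh0 j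
    have hdisj : (J : Set (Fin n → ℤ)).Pairwise (Function.onFun Disjoint (gridCell (n := n) h)) :=
      (pairwise_disjoint_gridCell h).set_pairwise _
    have e2 : ∫ y in B, potential (x k) y ^ 2 =
        ∑ j ∈ J, ∫ y in gridCell h j, potential (x k) y ^ 2 :=
      integral_biUnion_finset J hmeasB hdisj fun j _ => (hmem k).integrable_sq.integrableOn
    have hgi : Integrable fun y => ‖(x k).1 y‖ ^ 2 := integrable_norm_sq (Lp.memLp (x k).1)
    have e3 : ∫ y in B, ‖(x k).1 y‖ ^ 2 = ∑ j ∈ J, ∫ y in gridCell h j, ‖(x k).1 y‖ ^ 2 :=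
      integral_biUnion_finset J hmeasB hdisj fun j _ => hgi.integrableOn
    have e4 : ∫ y in B, ‖(x k).1 y‖ ^ 2 ≤ R ^ 2 :=
      (setIntegral_le_integral hgi (ae_of_all _ fun y => by positivity)).trans (hgrad k)
    have e5 : ∑ j ∈ J, ∫ y in gridCell h j, potential (x k) y ^ 2 ≤
        ∑ j ∈ J, (n * h ^ 2 * 2 ^ n * (∫ y in gridCell h j, ‖(x k).1 y‖ ^ 2) +
          (volume.real (gridCell (n := n) h j))⁻¹ *
            (∫ y in gridCell h j, potential (x k) y) ^ 2) := by
      refine Finset.sum_le_sum fun j _ => ?_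
      exact (memD12_potential (x k)).setIntegral_sq_le hn (hmem k) (measurableSet_gridCell hh0 j)
        (convex_gridCell hh0 j) (hfin j) (by positivity)
        fun y hy z hz => norm_sub_sq_le_of_mem_gridCell hh0 hy hz
    rw [Finset.sum_add_distrib, ← Finset.mul_sum, ← e3] at e5
    rw [e1, e2]
    have e6 : n * h ^ 2 * 2 ^ n * ∫ y in B, ‖(x k).1 y‖ ^ 2 ≤ n * h ^ 2 * 2 ^ n * R ^ 2 := by
      gcongr
    linarith
  have := hsq.sqrt
  simpa using this

/-! ### Existence of minimisers in a Hilbert space -/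

/-- A consequence of the convexity of `t ↦ t ^ p`. -/
lemma exists_abs_add_rpow_le {p η : ℝ} (hp : 1 ≤ p) (hη : 0 < η) :
    ∃ C : ℝ, ∀ a b : ℝ, |a + b| ^ p ≤ (1 + η) * |b| ^ p + C * |a| ^ p := by
  obtain ⟨l, ⟨hl0, hl1⟩, hl⟩ : ∃ l : ℝ, (0 < l ∧ l < 1) ∧ (1 - l) ^ (1 - p) < 1 + η := by
    have h1 : Tendsto (fun l : ℝ => (1 - l) ^ (1 - p)) (𝓝[>] 0) (𝓝 1) := by
      have : ContinuousAt (fun l : ℝ => (1 - l) ^ (1 - p)) 0 :=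
        ContinuousAt.rpow_const (by fun_prop) (Or.inl (by norm_num))
      simpa using this.tendsto.mono_left nhdsWithin_le_nhds
    have h2 : ∀ᶠ l : ℝ in 𝓝[>] 0, 0 < l ∧ l < 1 := by
      filter_upwards [Ioo_mem_nhdsGT (zero_lt_one (α := ℝ))] with l hl
      exact hl
    exact (h2.and (h1.eventually (gt_mem_nhds (by linarith)))).exists
  refine ⟨l ^ (1 - p), fun a b => ?_⟩
  have hp0 : 0 ≤ p := by linarith
  have hl1' : 0 < 1 - l := by linarith
  have h1 := (convexOn_rpow hp).2 (x := |b| / (1 - l)) (y := |a| / l)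
    (by simp only [Set.mem_Ici]; positivity) (by simp only [Set.mem_Ici]; positivity)
    hl1'.le hl0.le (by ring)
  simp only [smul_eq_mul] at h1
  rw [mul_div_cancel₀ _ hl1'.ne', mul_div_cancel₀ _ hl0.ne',
    Real.div_rpow (abs_nonneg _) hl1'.le, Real.div_rpow (abs_nonneg _) hl0.le] at h1
  have e : ∀ t : ℝ, 0 < t → ∀ c : ℝ, t * (c / t ^ p) = t ^ (1 - p) * c := by
    intro t ht c
    rw [Real.rpow_sub ht, Real.rpow_one]
    ring
  rw [e _ hl1', e _ hl0] at h1
  calc |a + b| ^ p ≤ (|b| + |a|) ^ p := by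
        refine Real.rpow_le_rpow (abs_nonneg _) ?_ hp0
        rw [add_comm a b]
        exact abs_add_le b a
    _ ≤ (1 - l) ^ (1 - p) * |b| ^ p + l ^ (1 - p) * |a| ^ p := h1
    _ ≤ _ := by gcongr

/-- One half of the Brezis-Lieb lemma: along an almost everywhere convergent sequence, no more mass
can be found than that of the limit and that of the remainder. -/
lemma eventually_integral_abs_rpow_le {α : Type*} [MeasurableSpace α] {μ : Measure α} {p : ℝ}
    (hp : 1 ≤ p) {f : α → ℝ} {g : ℕ → α → ℝ} (hf : MemLp f (ENNReal.ofReal p) μ)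
    (hg : ∀ k, MemLp (g k) (ENNReal.ofReal p) μ)
    (hlim : ∀ᵐ x ∂μ, Tendsto (fun k => g k x) atTop (𝓝 (f x)))
    {R : ℝ} (hR : ∀ k, ∫ x, |g k x - f x| ^ p ∂μ ≤ R) {ε : ℝ} (hε : 0 < ε) :
    ∀ᶠ k in atTop, ∫ x, |g k x| ^ p ∂μ ≤
      ∫ x, |f x| ^ p ∂μ + ∫ x, |g k x - f x| ^ p ∂μ + ε := by
  have hp0 : 0 < p := by linarith
  have hint : ∀ {h : α → ℝ}, MemLp h (ENNReal.ofReal p) μ → Integrable (fun x => |h x| ^ p) μ := by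
    intro h hh
    have := hh.integrable_norm_rpow (by simpa using hp0) (by simp)
    simpa [ENNReal.toReal_ofReal hp0.le] using this
  have hR0 : 0 ≤ R := (integral_nonneg fun x => by positivity).trans (hR 0)
  set η := ε / (2 * (R + 1)) with hη
  have hη0 : 0 < η := by positivity
  have hηR : η * R ≤ ε / 2 := by
    rw [hη, div_mul_eq_mul_div, div_le_div_iff₀ (by positivity) two_pos]
    nlinarith
  obtain ⟨C, hC⟩ := exists_abs_add_rpow_le hp hη0
  have hd : ∀ k, MemLp (fun x => g k x - f x) (ENNReal.ofReal p) μ := fun k => (hg k).sub hf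
  set r : ℕ → α → ℝ := fun k x =>
    max (|g k x| ^ p - |g k x - f x| ^ p - |f x| ^ p - η * |g k x - f x| ^ p) 0 with hr
  have hi : ∀ k, Integrable (fun x =>
      |g k x| ^ p - |g k x - f x| ^ p - |f x| ^ p - η * |g k x - f x| ^ p) μ := fun k =>
    (((hint (hg k)).sub (hint (hd k))).sub (hint hf)).sub ((hint (hd k)).const_mul η)
  have hlimr : Tendsto (fun k => ∫ x, r k x ∂μ) atTop (𝓝 (∫ _, (0 : ℝ) ∂μ)) := by
    refine tendsto_integral_of_dominated_convergence (fun x => |C| * |f x| ^ p)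
      (fun k => ((hi k).1.sup aestronglyMeasurable_const))
      ((hint hf).const_mul _) (fun k => ae_of_all _ fun x => ?_) ?_
    · rw [Real.norm_of_nonneg (le_max_right _ _)]
      refine max_le ?_ (by positivity)
      have h1 := hC (f x) (g k x - f x)
      rw [add_sub_cancel] at h1
      have h2 : C * |f x| ^ p ≤ |C| * |f x| ^ p := by
        gcongr
        exact le_abs_self C
      have h3 : 0 ≤ |f x| ^ p := by positivity
      linarith
    · filter_upwards [hlim] with x hx
      have hx0 : Tendsto (fun k => |g k x - f x| ^ p) atTop (𝓝 0) := by
        have := ((hx.sub_const (f x)).abs).rpow_const (p := p) (Or.inr hp0.le)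
        simpa [Real.zero_rpow hp0.ne'] using this
      have h1 := ((((hx.abs).rpow_const (p := p) (Or.inr hp0.le)).sub hx0).sub_const
        (|f x| ^ p)).sub (hx0.const_mul η)
      have h2 := h1.max (tendsto_const_nhds (x := (0 : ℝ)))
      simpa using h2
  rw [integral_zero] at hlimr
  filter_upwards [hlimr.eventually (gt_mem_nhds (half_pos hε))] with k hk
  have h1 : ∫ x, (|g k x| ^ p - |g k x - f x| ^ p - |f x| ^ p - η * |g k x - f x| ^ p) ∂μ ≤
      ∫ x, r k x ∂μ :=
    integral_mono (hi k) (hi k).pos_part fun x => le_max_left _ _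
  have j1 : Integrable (fun x => |g k x| ^ p - |g k x - f x| ^ p) μ :=
    (hint (hg k)).sub (hint (hd k))
  have j2 : Integrable (fun x => |g k x| ^ p - |g k x - f x| ^ p - |f x| ^ p) μ :=
    j1.sub (hint hf)
  rw [integral_sub j2 ((hint (hd k)).const_mul η), integral_sub j1 (hint hf),
    integral_sub (hint (hg k)) (hint (hd k)), integral_const_mul] at h1
  have h2 := mul_le_mul_of_nonneg_left (hR k) hη0.le
  linarith

/-- Minimisation of `Q(x) = ‖x‖² - γ ‖S x‖²` on the sphere `‖T x‖_{L^p} = 1`. The localised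
inequality with constant `m` says that a weakly null sequence of unit `L^p` mass costs at least `m`;
as the infimum `μ` is less than `m`, no mass can be lost in the weak limit of a minimising
sequence. -/
lemma exists_minimiser {H F F' α : Type*} [NormedAddCommGroup H] [InnerProductSpace ℝ H]
    [CompleteSpace H] [TopologicalSpace.SeparableSpace H] [NormedAddCommGroup F]
    [InnerProductSpace ℝ F] [NormedAddCommGroup F'] [InnerProductSpace ℝ F']
    [MeasurableSpace α] {ν : Measure α} {p : ℝ} [Fact (1 ≤ ENNReal.ofReal p)] (hp : 2 ≤ p)
    (T : H →L[ℝ] Lp ℝ (ENNReal.ofReal p) ν) (S : H →L[ℝ] F) (K : H →L[ℝ] F') {γ m μ : ℝ}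
    (hae : ∀ (x : ℕ → H) (y : H) (R : ℝ), (∀ k, ‖x k‖ ≤ R) →
      (∀ z, Tendsto (fun k => ⟪x k, z⟫_ℝ) atTop (𝓝 ⟪y, z⟫_ℝ)) →
      ∃ a : ℕ → ℕ, StrictMono a ∧ ∀ᵐ t ∂ν, Tendsto (fun k => T (x (a k)) t) atTop (𝓝 (T y t)))
    (hcomp : ∀ (x : ℕ → H) (R : ℝ), (∀ k, ‖x k‖ ≤ R) →
      (∀ z, Tendsto (fun k => ⟪x k, z⟫_ℝ) atTop (𝓝 0)) →
      Tendsto (fun k => ‖K (x k)‖) atTop (𝓝 0))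
    (hloc : ∀ ε > 0, ∃ C, 0 ≤ C ∧ ∀ x, m * ‖T x‖ ^ 2 ≤
      ‖x‖ ^ 2 - γ * ‖S x‖ ^ 2 + ε * ‖x‖ ^ 2 + C * ‖K x‖ ^ 2)
    (hcoer : ∃ c C, 0 < c ∧ 0 ≤ C ∧ ∀ x, c * ‖x‖ ^ 2 ≤
      ‖x‖ ^ 2 - γ * ‖S x‖ ^ 2 + C * ‖K x‖ ^ 2)
    (hKT : ∃ C, ∀ x, ‖K x‖ ≤ C * ‖T x‖) (hm0 : 0 < m) (hμm : μ < m)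
    (hlow : ∀ x, μ * ‖T x‖ ^ 2 ≤ ‖x‖ ^ 2 - γ * ‖S x‖ ^ 2)
    (hmin : ∀ ε > 0, ∃ x, ‖T x‖ = 1 ∧ ‖x‖ ^ 2 - γ * ‖S x‖ ^ 2 < μ + ε) :
    ∃ x, T x ≠ 0 ∧ ‖x‖ ^ 2 - γ * ‖S x‖ ^ 2 ≤ μ * ‖T x‖ ^ 2 := by
  have hp0 : 0 < p := by linarith
  set Q : H → ℝ := fun x => ‖x‖ ^ 2 - γ * ‖S x‖ ^ 2 with hQ
  have hTp : ∀ x, ‖T x‖ ^ p = ∫ t, |T x t| ^ p ∂ν := fun x => by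
    rw [Lp.norm_def, toReal_eLpNorm_rpow hp0 (Lp.memLp _)]
    simp
  obtain ⟨c, C₁, hc0, hC₁, hcoer⟩ := hcoer
  obtain ⟨C₂, hKT⟩ := hKT
  -- A minimising sequence, bounded by coercivity.
  have hseq : ∀ k : ℕ, ∃ x, ‖T x‖ = 1 ∧ Q x < μ + 1 / ((k : ℝ) + 1) := fun k =>
    hmin _ (by positivity)
  choose x₀ hx₀T hx₀Q using hseq
  obtain ⟨R, hR⟩ : ∃ R, ∀ k, ‖x₀ k‖ ≤ R := by
    refine ⟨Real.sqrt ((μ + 1 + C₁ * C₂ ^ 2) / c), fun k => Real.le_sqrt_of_sq_le ?_⟩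
    rw [le_div_iff₀ hc0]
    have h1 := hcoer (x₀ k)
    have h2 := hx₀Q k
    have h3 : (1 : ℝ) / ((k : ℝ) + 1) ≤ 1 := by
      rw [div_le_one (by positivity)]
      linarith [(Nat.cast_nonneg k : (0 : ℝ) ≤ k)]
    have h4 : ‖K (x₀ k)‖ ^ 2 ≤ C₂ ^ 2 := by
      have := hKT (x₀ k)
      rw [hx₀T, mul_one] at this
      exact pow_le_pow_left₀ (norm_nonneg _) this 2
    have h5 := mul_le_mul_of_nonneg_left h4 hC₁
    simp only [hQ] at h2
    linarith
  obtain ⟨y, a, ha, hweak⟩ := exists_weakly_convergent_subseq hR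
  obtain ⟨b, hb, hTae⟩ := hae (fun k => x₀ (a k)) y R (fun k => hR _) hweak
  set x : ℕ → H := fun k => x₀ (a (b k)) with hx
  have hxw : ∀ z, Tendsto (fun k => ⟪x k, z⟫_ℝ) atTop (𝓝 ⟪y, z⟫_ℝ) := fun z =>
    (hweak z).comp hb.tendsto_atTop
  have hxT : ∀ k, ‖T (x k)‖ = 1 := fun k => hx₀T _
  have hxQ : ∀ ε > 0, ∀ᶠ k in atTop, Q (x k) < μ + ε := by
    intro ε hε
    have h1 : Tendsto (fun k => 1 / (((a (b k) : ℕ) : ℝ) + 1)) atTop (𝓝 0) :=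
      tendsto_one_div_add_atTop_nhds_zero_nat.comp (ha.comp hb).tendsto_atTop
    filter_upwards [h1.eventually (gt_mem_nhds hε)] with k hk
    exact (hx₀Q _).trans (by linarith)
  set w : ℕ → H := fun k => x k - y with hw
  have hww : ∀ z, Tendsto (fun k => ⟪w k, z⟫_ℝ) atTop (𝓝 0) := by
    intro z
    have := (hxw z).sub_const ⟪y, z⟫_ℝ
    simpa [hw, inner_sub_left] using this
  have hwR : ∀ k, ‖w k‖ ≤ R + ‖y‖ := fun k =>
    (norm_sub_le _ _).trans (by gcongr; exact hR _)
  have hKw := hcomp w _ hwR hww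
  have hKw2 : Tendsto (fun k => ‖K (w k)‖ ^ 2) atTop (𝓝 0) := by simpa using hKw.pow 2
  -- The quadratic form splits along the weak limit.
  have hcross : Tendsto (fun k => 2 * (⟪w k, y⟫_ℝ - γ * ⟪S y, S (w k)⟫_ℝ)) atTop (𝓝 0) := by
    have h1 := tendsto_clm_of_weakly_null hww ((innerSL ℝ (S y)).comp S)
    have h2 := ((hww y).sub (h1.const_mul γ)).const_mul 2
    simpa using h2
  have hsplit : ∀ k, Q (x k) = Q y + Q (w k) + 2 * (⟪w k, y⟫_ℝ - γ * ⟪S y, S (w k)⟫_ℝ) := by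
    intro k
    have e1 : x k = y + w k := by simp [hw]
    simp only [hQ]
    rw [e1, map_add, norm_add_sq_real, norm_add_sq_real, real_inner_comm y (w k)]
    ring
  set θ := ‖T y‖ ^ p with hθ
  have hθ0 : 0 ≤ θ := by positivity
  have hθ1 : θ ≤ 1 := by
    have h1 : eLpNorm (T y) (ENNReal.ofReal p) ν ≤ 1 := by
      refine (Lp.eLpNorm_lim_le_liminf_eLpNorm (fun k => (Lp.memLp (T (x k))).1) _ hTae).trans ?_
      have : ∀ k, eLpNorm (T (x k)) (ENNReal.ofReal p) ν = 1 := by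
        intro k
        have := hxT k
        rw [Lp.norm_def] at this
        exact (ENNReal.toReal_eq_one_iff _).1 this
      simp [this]
    have h2 : ‖T y‖ ≤ 1 := by
      rw [Lp.norm_def]
      exact ENNReal.toReal_le_of_le_ofReal zero_le_one (by simpa using h1)
    exact Real.rpow_le_one (norm_nonneg _) h2 hp0.le
  have hTw : ∀ k, ∫ t, |T (x k) t - T y t| ^ p ∂ν = ‖T (w k)‖ ^ p := by
    intro k
    rw [hTp]
    refine integral_congr_ae ?_
    have e : T (w k) = T (x k) - T y := by simp [hw]
    rw [e]
    filter_upwards [Lp.coeFn_sub (T (x k)) (T y)] with t ht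
    rw [ht, Pi.sub_apply]
  have hTwR : ∀ k, ‖T (w k)‖ ^ p ≤ (‖T‖ * (R + ‖y‖)) ^ p := fun k =>
    Real.rpow_le_rpow (norm_nonneg _) ((T.le_opNorm _).trans (by gcongr; exact hwR k)) hp0.le
  have hsq : ∀ z, ‖T z‖ ^ 2 = (‖T z‖ ^ p) ^ (2 / p) := fun z => by
    rw [← Real.rpow_mul (norm_nonneg _), mul_div_cancel₀ _ hp0.ne', Real.rpow_two]
  have hmass : ∀ ε > 0, ∀ᶠ k in atTop, 1 - θ - ε ≤ ‖T (w k)‖ ^ p := by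
    intro ε hε
    filter_upwards [eventually_integral_abs_rpow_le (by linarith) (Lp.memLp (T y))
      (fun k => Lp.memLp (T (x k))) hTae
      (fun k => (hTw k).le.trans (hTwR k)) hε] with k hk
    rw [← hTp, ← hTp, hTw, hxT, Real.one_rpow] at hk
    linarith
  -- The remainder is weakly null, so its mass `1 - θ` costs at least `m (1 - θ)^{2/p}`.
  have hineq : ∀ ε > 0, Q y + m * (max (1 - θ - ε) 0) ^ (2 / p) ≤
      μ + ε * (3 + (R + ‖y‖) ^ 2) := by
    intro ε hε
    obtain ⟨C, hC0, hC⟩ := hloc ε hε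
    have hCK : Tendsto (fun k => C * ‖K (w k)‖ ^ 2) atTop (𝓝 0) := by
      simpa using hKw2.const_mul C
    obtain ⟨k, h1, h2, h3, h4⟩ := ((hmass ε hε).and ((hxQ ε hε).and
      ((hCK.eventually (gt_mem_nhds hε)).and
        (hcross.eventually (lt_mem_nhds (neg_lt_zero.2 hε)))))).exists
    have h5 := hC (w k)
    have h6 : m * (max (1 - θ - ε) 0) ^ (2 / p) ≤ m * ‖T (w k)‖ ^ 2 := by
      rw [hsq]
      gcongr
      exact max_le h1 (by positivity)
    have h7 : ε * ‖w k‖ ^ 2 ≤ ε * (R + ‖y‖) ^ 2 := by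
      gcongr
      exact hwR k
    have h8 := hsplit k
    simp only [hQ] at h2 h8 ⊢
    linarith
  have hlimit : Q y + m * (1 - θ) ^ (2 / p) ≤ μ := by
    have hc1 : Continuous fun ε : ℝ => Q y + m * (max (1 - θ - ε) 0) ^ (2 / p) := by
      refine continuous_const.add (continuous_const.mul (Continuous.rpow_const (by fun_prop)
        fun _ => Or.inr (by positivity)))
    have hc2 : Continuous fun ε : ℝ => μ + ε * (3 + (R + ‖y‖) ^ 2) := by fun_prop
    have h1 := (hc1.tendsto 0).mono_left (nhdsWithin_le_nhds (s := Set.Ioi 0))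
    have h2 := (hc2.tendsto 0).mono_left (nhdsWithin_le_nhds (s := Set.Ioi 0))
    have h3 := le_of_tendsto_of_tendsto h1 h2 (by
      filter_upwards [self_mem_nhdsWithin] with ε hε
      exact hineq ε hε)
    rw [sub_zero, max_eq_left (by linarith)] at h3
    simpa using h3
  have h2p : 2 / p ≤ 1 := by
    rw [div_le_one hp0]
    exact hp
  have ha1 : θ ≤ ‖T y‖ ^ 2 := by
    rw [hsq]
    exact Real.self_le_rpow_of_le_one hθ0 hθ1 h2p
  have ha2 : 1 - θ ≤ (1 - θ) ^ (2 / p) :=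
    Real.self_le_rpow_of_le_one (by linarith) (by linarith) h2p
  have ha3 : ‖T y‖ ^ 2 ≤ 1 := by
    rw [hsq]
    exact Real.rpow_le_one hθ0 hθ1 (by positivity)
  have hlowy := hlow y
  -- The limit costs at least `μ θ^{2/p}`, and `t^{2/p} ≥ t` on `[0, 1]`: if `θ < 1`, the total cost
  -- exceeds `μ`.
  have hθeq : θ = 1 := by
    by_contra hne
    have hlt : θ < 1 := lt_of_le_of_ne hθ1 hne
    have h1 : m * (1 - θ) ≤ μ * (1 - ‖T y‖ ^ 2) := by
      have := mul_le_mul_of_nonneg_left ha2 hm0.le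
      simp only [hQ] at hlimit
      linarith
    rcases le_or_gt μ 0 with hμ | hμ
    · nlinarith [mul_pos hm0 (sub_pos.2 hlt)]
    · have h2 : μ * (1 - ‖T y‖ ^ 2) ≤ μ * (1 - θ) := by gcongr
      nlinarith [mul_lt_mul_of_pos_right hμm (sub_pos.2 hlt)]
  have hTy : ‖T y‖ ^ 2 = 1 := le_antisymm ha3 (hθeq ▸ ha1)
  refine ⟨y, fun h => ?_, ?_⟩
  · rw [h, norm_zero] at hTy
    norm_num at hTy
  · rw [hTy, mul_one]
    rw [hθeq, sub_self, Real.zero_rpow (by positivity)] at hlimit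
    rw [mul_zero, add_zero] at hlimit
    exact hlimit

/-! ### Extremals below the half-space threshold -/

lemma MemD12.setIntegral_eq (hn : 3 ≤ n) {Ω : Set (E n)} {u : E n → ℝ} {g : E n → E n}
    (h : MemD12 Ω u g) {f : E n → ℝ} (hf : ∀ x, u x = 0 → g x = 0 → f x = 0) :
    ∫ x in Ω, f x = ∫ x, f x := by
  refine setIntegral_eq_integral_of_ae_compl_eq_zero ?_
  filter_upwards [h.ae_eq_zero hn] with x hx hxΩ
  exact hf x (hx hxΩ).1 (hx hxΩ).2

lemma MemD12.norm_toGrad_sq (hn : 3 ≤ n) {Ω : Set (E n)} {u : E n → ℝ} {g : E n → E n}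
    (h : MemD12 Ω u g) : ‖h.toGrad hn‖ ^ 2 = ∫ x, ‖g x‖ ^ 2 := by
  rw [Submodule.coe_norm, Lp.norm_def, eLpNorm_congr_ae (h.coeFn_toGrad hn),
    toReal_eLpNorm_two_sq h.memLp_grad]

lemma MemD12.norm_weightMap_rpow (hn : 3 ≤ n) {Ω : Set (E n)} {w : E n → ℝ} {p : ℝ} (hp : 0 < p)
    [Fact (1 ≤ ENNReal.ofReal p)] (hw : Controlled Ω w (ENNReal.ofReal p)) {u : E n → ℝ}
    {g : E n → E n} (h : MemD12 Ω u g) :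
    ‖weightMap hw (h.toGrad hn)‖ ^ p = ∫ x, ‖w x * u x‖ ^ p := by
  rw [Lp.norm_def, eLpNorm_congr_ae (h.coeFn_weightMap hn hw),
    toReal_eLpNorm_rpow hp (hw.memLp hn h)]

lemma MemD12.norm_weightMap_sq (hn : 3 ≤ n) {Ω : Set (E n)} {w : E n → ℝ}
    (hw : Controlled Ω w 2) {u : E n → ℝ} {g : E n → E n} (h : MemD12 Ω u g) :
    ‖weightMap hw (h.toGrad hn)‖ ^ 2 = ∫ x, ‖w x * u x‖ ^ 2 := by
  rw [Lp.norm_def, eLpNorm_congr_ae (h.coeFn_weightMap hn hw),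
    toReal_eLpNorm_two_sq (hw.memLp hn h)]

lemma MemD12.norm_hardyMap_sq (hn : 3 ≤ n) {Ω : Set (E n)} (hw : Controlled Ω (fun x => ‖x‖⁻¹) 2)
    {u : E n → ℝ} {g : E n → E n} (h : MemD12 Ω u g) :
    ‖weightMap hw (h.toGrad hn)‖ ^ 2 = hardyTerm u := by
  rw [h.norm_weightMap_sq hn hw, hardyTerm]
  congr with x
  rw [norm_mul, mul_pow, norm_inv, norm_norm, Real.norm_eq_abs, sq_abs]
  ring

lemma MemD12.norm_massMap_sq (hn : 3 ≤ n) {Ω : Set (E n)} (hw : Controlled Ω (fun _ => 1) 2)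
    {u : E n → ℝ} {g : E n → E n} (h : MemD12 Ω u g) :
    ‖weightMap hw (h.toGrad hn)‖ ^ 2 = massTerm u := by
  rw [h.norm_weightMap_sq hn hw, massTerm]
  simp

lemma MemD12.norm_hsMap_sq (hn : 3 ≤ n) {Ω : Set (E n)} {s : ℝ} (hs2 : s ≤ 2)
    [Fact (1 ≤ ENNReal.ofReal (critExp n s))]
    (hw : Controlled Ω (fun x => ‖x‖ ^ (-s / critExp n s)) (ENNReal.ofReal (critExp n s)))
    {u : E n → ℝ} {g : E n → E n} (h : MemD12 Ω u g) :
    ‖weightMap hw (h.toGrad hn)‖ ^ 2 = hsTerm s u ^ (2 / critExp n s) := by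
  have hp := critExp_pos hn hs2
  have h1 := h.norm_weightMap_rpow hn hp hw
  simp only [hardySobolev_weight_rpow hp] at h1
  rw [hsTerm, ← h1, ← Real.rpow_mul (norm_nonneg _), mul_div_cancel₀ _ hp.ne', Real.rpow_two]

lemma J_eq (hn : 3 ≤ n) {Ω : Set (E n)} {γ s : ℝ} (hs2 : s ≤ 2) {u : E n → ℝ} {g : E n → E n}
    (h : MemD12 Ω u g) :
    J Ω γ s u g = ((∫ x, ‖g x‖ ^ 2) - γ * hardyTerm u) / hsTerm s u ^ (2 / critExp n s) := by
  have hp := critExp_pos hn hs2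
  rw [J, h.setIntegral_eq hn (by intro x _ h; simp [h]),
    h.setIntegral_eq hn (by intro x h _; simp [h]),
    h.setIntegral_eq hn (by intro x h _; simp [h, hp.ne'])]
  rfl

lemma ae_norm_pos (hn : 3 ≤ n) : ∀ᵐ x : E n, 0 < ‖x‖ := by
  have : Nonempty (Fin n) := ⟨⟨0, by omega⟩⟩
  have : Nontrivial (E n) := by
    unfold E
    infer_instance
  filter_upwards [compl_mem_ae_iff.2 (measure_singleton (μ := (volume : Measure (E n))) 0)]
    with x hx
  exact norm_pos_iff.2 hx

lemma ae_weight_ne_zero (hn : 3 ≤ n) (t : ℝ) : ∀ᵐ x : E n, ‖x‖ ^ t ≠ 0 := by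
  filter_upwards [ae_norm_pos hn] with x hx
  exact (Real.rpow_pos_of_pos hx _).ne'

lemma MemD12.weightMap_eq_zero_iff (hn : 3 ≤ n) {Ω : Set (E n)} {w : E n → ℝ} {q : ℝ≥0∞}
    [Fact (1 ≤ q)] (hw : Controlled Ω w q) (hw0 : ∀ᵐ x, w x ≠ 0)
    {u : E n → ℝ} {g : E n → E n} (h : MemD12 Ω u g) :
    weightMap hw (h.toGrad hn) = 0 ↔ u =ᵐ[volume] 0 := by
  rw [Lp.eq_zero_iff_ae_eq_zero]
  constructor
  · intro h1
    filter_upwards [h1, h.coeFn_weightMap hn hw, hw0] with x h1 h2 h3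
    rw [h1] at h2
    simpa [h3] using h2.symm
  · intro h1
    filter_upwards [h1, h.coeFn_weightMap hn hw] with x h1 h2
    rw [h2, h1]
    simp

lemma hsTerm_pos (hn : 3 ≤ n) {Ω : Set (E n)} (hΩ : IsOpen Ω) (h0 : (0 : E n) ∉ Ω) {s : ℝ}
    (hs0 : 0 ≤ s) (hs2 : s ≤ 2) {u : E n → ℝ} {g : E n → E n} (h : MemD12NeZero Ω u g) :
    0 < hsTerm s u := by
  have : Fact (1 ≤ ENNReal.ofReal (critExp n s)) := ⟨one_le_ofReal_critExp hn hs2⟩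
  have hp := critExp_pos hn hs2
  have h1 := h.1.norm_weightMap_rpow hn hp (controlled_hardySobolev hn hΩ h0 hs0 hs2)
  simp only [hardySobolev_weight_rpow hp] at h1
  rw [hsTerm, ← h1]
  refine Real.rpow_pos_of_pos (norm_pos_iff.2 fun h2 => h.2 ?_) _
  exact (h.1.weightMap_eq_zero_iff hn _ (ae_weight_ne_zero hn _)).1 h2

/-- An inequality between the quadratic terms passes from test functions to `D^{1,2}`. -/
lemma le_of_forall_test (hn : 3 ≤ n) {Ω : Set (E n)} {s : ℝ} (hs2 : s ≤ 2)
    [Fact (1 ≤ ENNReal.ofReal (critExp n s))]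
    (hT : Controlled Ω (fun x => ‖x‖ ^ (-s / critExp n s)) (ENNReal.ofReal (critExp n s)))
    (hS : Controlled Ω (fun x => ‖x‖⁻¹) 2) (hK : Controlled Ω (fun _ => 1) 2) {a b c d : ℝ}
    (h : ∀ φ, IsTestFunction Ω φ → d * hsTerm s φ ^ (2 / critExp n s) ≤
      a * dirichletEnergy φ + b * hardyTerm φ + c * massTerm φ) (x : gradSpace hn Ω) :
    d * ‖weightMap hT x‖ ^ 2 ≤
      a * ‖x‖ ^ 2 + b * ‖weightMap hS x‖ ^ 2 + c * ‖weightMap hK x‖ ^ 2 := by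
  refine dense_testFunctions hn Ω (p := fun x => d * ‖weightMap hT x‖ ^ 2 ≤
      a * ‖x‖ ^ 2 + b * ‖weightMap hS x‖ ^ 2 + c * ‖weightMap hK x‖ ^ 2)
      (isClosed_le (by fun_prop) (by fun_prop)) (fun φ hφ => ?_) x
  rw [hφ.memD12.norm_hsMap_sq hn hs2 hT, hφ.memD12.norm_hardyMap_sq hn hS,
    hφ.memD12.norm_massMap_sq hn hK, hφ.memD12.norm_toGrad_sq hn]
  exact h φ hφ

/-- On a bounded set the `L²` norm is controlled by the Hardy-Sobolev norm. -/
lemma exists_norm_massMap_le (hn : 3 ≤ n) {Ω : Set (E n)} (hΩ : IsOpen Ω)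
    (hb : Bornology.IsBounded Ω) {s : ℝ} (hs0 : 0 ≤ s) (hs2 : s ≤ 2)
    [Fact (1 ≤ ENNReal.ofReal (critExp n s))]
    (hT : Controlled Ω (fun x => ‖x‖ ^ (-s / critExp n s)) (ENNReal.ofReal (critExp n s)))
    (hK : Controlled Ω (fun _ => 1) 2) :
    ∃ C, ∀ x : gradSpace hn Ω, ‖weightMap hK x‖ ≤ C * ‖weightMap hT x‖ := by
  obtain ⟨R, hR0, hR⟩ := hb.exists_pos_norm_le
  have hp := critExp_pos hn hs2
  set p := critExp n s with hp_def
  have hμ : (volume.restrict Ω) Set.univ ≠ ⊤ := by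
    rw [Measure.restrict_apply_univ]
    exact hb.measure_lt_top.ne
  set A := (volume.restrict Ω) Set.univ ^ (1 / (2 : ℝ≥0∞).toReal - 1 / (ENNReal.ofReal p).toReal)
    with hA
  have h2p : (2 : ℝ≥0∞) ≤ ENNReal.ofReal p := by
    rw [← ENNReal.ofReal_ofNat]
    exact ENNReal.ofReal_le_ofReal (two_le_critExp hn hs2)
  have hAtop : A ≠ ⊤ := by
    refine ENNReal.rpow_ne_top_of_nonneg ?_ hμ
    rw [ENNReal.toReal_ofReal hp.le, sub_nonneg]
    exact one_div_le_one_div_of_le (by norm_num) (by simpa using two_le_critExp hn hs2)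
  refine ⟨R ^ (s / p) * A.toReal, fun x => ?_⟩
  have hx := memD12_potential x
  have key : eLpNorm (weightMap hK x) 2 volume ≤
      ENNReal.ofReal (R ^ (s / p)) * A * eLpNorm (weightMap hT x) (ENNReal.ofReal p) volume := by
    calc eLpNorm (weightMap hK x) 2 volume
        ≤ eLpNorm (fun y => R ^ (s / p) * weightMap hT x y) 2 (volume.restrict Ω) := by
          rw [← eLpNorm_indicator_eq_eLpNorm_restrict hΩ.measurableSet]
          refine eLpNorm_mono_ae ?_
          filter_upwards [coeFn_weightMap hK x, coeFn_weightMap hT x, hx.ae_eq_zero hn,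
            ae_norm_pos hn] with y h1 h2 h3 h4
          rw [h1]
          by_cases hy : y ∈ Ω
          · rw [Set.indicator_of_mem hy, h2, one_mul, ← mul_assoc, norm_mul]
            refine le_mul_of_one_le_left (norm_nonneg _) ?_
            rw [norm_mul, Real.norm_of_nonneg (by positivity), Real.norm_of_nonneg (by positivity),
              neg_div, Real.rpow_neg h4.le, ← div_eq_mul_inv, one_le_div (by positivity)]
            exact Real.rpow_le_rpow h4.le (hR y hy) (by positivity)
          · rw [(h3 hy).1]
            simp
      _ = ENNReal.ofReal (R ^ (s / p)) * eLpNorm (weightMap hT x) 2 (volume.restrict Ω) := by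
          have := eLpNorm_const_smul (R ^ (s / p)) (weightMap hT x) 2 (volume.restrict Ω)
          simp only [Pi.smul_def, smul_eq_mul] at this
          rw [this, Real.enorm_of_nonneg (by positivity)]
      _ ≤ ENNReal.ofReal (R ^ (s / p)) *
          (eLpNorm (weightMap hT x) (ENNReal.ofReal p) (volume.restrict Ω) * A) := by
          gcongr
          exact eLpNorm_le_eLpNorm_mul_rpow_measure_univ h2p (Lp.memLp _).1.restrict
      _ ≤ _ := by
          rw [mul_comm _ A, ← mul_assoc]
          gcongr
          exact Measure.restrict_le_self
  have := ENNReal.toReal_mono (ENNReal.mul_ne_top (ENNReal.mul_ne_top (by simp) hAtop)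
    (Lp.memLp (weightMap hT x)).2.ne) key
  rw [ENNReal.toReal_mul, ENNReal.toReal_mul, ENNReal.toReal_ofReal (by positivity)] at this
  simpa [Lp.norm_def] using this

/-- By Rellich's theorem a weakly convergent sequence converges in `L²`, hence almost everywhere
along a subsequence. -/
lemma exists_subseq_ae_of_weakly_convergent (hn : 3 ≤ n) {Ω : Set (E n)}
    (hb : Bornology.IsBounded Ω) (hK : Controlled Ω (fun _ => 1) 2) {w : E n → ℝ} {q : ℝ≥0∞}
    [Fact (1 ≤ q)] (hT : Controlled Ω w q) {x : ℕ → gradSpace hn Ω} {y : gradSpace hn Ω} {R : ℝ}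
    (hR : ∀ k, ‖x k‖ ≤ R) (hx : ∀ z, Tendsto (fun k => ⟪x k, z⟫_ℝ) atTop (𝓝 ⟪y, z⟫_ℝ)) :
    ∃ a : ℕ → ℕ, StrictMono a ∧
      ∀ᵐ t, Tendsto (fun k => weightMap hT (x (a k)) t) atTop (𝓝 (weightMap hT y t)) := by
  have h1 := tendsto_massMap_of_weakly_null hn hb hK (x := fun k => x k - y) (R := R + ‖y‖)
    (fun k => (norm_sub_le _ _).trans (by gcongr; exact hR k))
    (fun z => by simpa [inner_sub_left] using (hx z).sub_const ⟪y, z⟫_ℝ)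
  have h2 : Tendsto (fun k => weightMap hK (x k)) atTop (𝓝 (weightMap hK y)) := by
    rw [tendsto_iff_norm_sub_tendsto_zero]
    simpa using h1
  obtain ⟨a, ha, h3⟩ := (tendstoInMeasure_of_tendsto_Lp h2).exists_seq_tendsto_ae
  refine ⟨a, ha, ?_⟩
  have h4 : ∀ᵐ t, ∀ k, weightMap hT (x (a k)) t = w t * weightMap hK (x (a k)) t := by
    rw [ae_all_iff]
    intro k
    filter_upwards [coeFn_weightMap hT (x (a k)), coeFn_weightMap hK (x (a k))] with t e1 e2
    rw [e1, e2, one_mul]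
  filter_upwards [h3, h4, coeFn_weightMap hT y, coeFn_weightMap hK y] with t e1 e2 e3 e4
  have := e1.const_mul (w t)
  rw [e4, one_mul, ← e3] at this
  exact this.congr fun k => (e2 k).symm

lemma MemD12.toGrad_potential {hn : 3 ≤ n} {Ω : Set (E n)} (x : gradSpace hn Ω) :
    (memD12_potential x).toGrad hn = x := by
  ext1
  simp [MemD12.toGrad]

lemma MemD12.J_eq_norm (hn : 3 ≤ n) {Ω : Set (E n)} {γ s : ℝ} (hs2 : s ≤ 2)
    [Fact (1 ≤ ENNReal.ofReal (critExp n s))]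
    (hT : Controlled Ω (fun x => ‖x‖ ^ (-s / critExp n s)) (ENNReal.ofReal (critExp n s)))
    (hS : Controlled Ω (fun x => ‖x‖⁻¹) 2) {u : E n → ℝ} {g : E n → E n} (h : MemD12 Ω u g) :
    J Ω γ s u g = (‖h.toGrad hn‖ ^ 2 - γ * ‖weightMap hS (h.toGrad hn)‖ ^ 2) /
      ‖weightMap hT (h.toGrad hn)‖ ^ 2 := by
  rw [J_eq hn hs2 h, h.norm_hsMap_sq hn hs2 hT, h.norm_hardyMap_sq hn hS, h.norm_toGrad_sq hn]

lemma memD12NeZero_potential (hn : 3 ≤ n) {Ω : Set (E n)} {s : ℝ}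
    [Fact (1 ≤ ENNReal.ofReal (critExp n s))]
    (hT : Controlled Ω (fun x => ‖x‖ ^ (-s / critExp n s)) (ENNReal.ofReal (critExp n s)))
    {x : gradSpace hn Ω} (hx : weightMap hT x ≠ 0) :
    MemD12NeZero Ω (potential x) (x : Lp (E n) 2 (volume : Measure (E n))) := by
  refine ⟨memD12_potential x, fun h => hx ?_⟩
  have := ((memD12_potential x).weightMap_eq_zero_iff hn hT (ae_weight_ne_zero hn _)).2 h
  rwa [MemD12.toGrad_potential] at this

lemma bestConst_le_norm (hn : 3 ≤ n) {Ω : Set (E n)} {γ s : ℝ} (hs2 : s ≤ 2)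
    [Fact (1 ≤ ENNReal.ofReal (critExp n s))]
    (hT : Controlled Ω (fun x => ‖x‖ ^ (-s / critExp n s)) (ENNReal.ofReal (critExp n s)))
    (hS : Controlled Ω (fun x => ‖x‖⁻¹) 2) {x : gradSpace hn Ω} (hx : weightMap hT x ≠ 0) :
    bestConst Ω γ s ≤ (((‖x‖ ^ 2 - γ * ‖weightMap hS x‖ ^ 2) / ‖weightMap hT x‖ ^ 2 : ℝ) :
      EReal) := by
  refine sInf_le ⟨potential x, _, memD12NeZero_potential hn hT hx, ?_⟩
  rw [(memD12_potential x).J_eq_norm hn hs2 hT hS, MemD12.toGrad_potential]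

instance (hn : 3 ≤ n) (Ω : Set (E n)) : TopologicalSpace.SeparableSpace (gradSpace hn Ω) := by
  have : Fact ((2 : ℝ≥0∞) ≠ ⊤) := ⟨by simp⟩
  have : SecondCountableTopology (Lp (E n) 2 (volume : Measure (E n))) := inferInstance
  exact (inferInstance : TopologicalSpace.SeparableSpace
    (gradSpace hn Ω : Set (Lp (E n) 2 (volume : Measure (E n)))))

set_option maxHeartbeats 800000 in
/-- If `m > 0` is a lower bound for the Hardy-Schrödinger quotient of test functions in the
half-space, and the infimum over `Ω` is below `m`, then it is attained. -/
theorem exists_extremal [NeZero n] (hn : 3 ≤ n) {Ω : Set (E n)} (hΩ : IsOpen Ω)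
    (hb : Bornology.IsBounded Ω) (h0 : (0 : E n) ∈ frontier Ω) (hsm : SmoothBoundaryAt Ω 0)
    {γ s m : ℝ} (hγ : γ < (n : ℝ) ^ 2 / 4) (hs0 : 0 ≤ s) (hs2 : s ≤ 2) (hm0 : 0 < m)
    (hm : ∀ φ, IsTestFunction (halfSpace n) φ →
      m * hsTerm s φ ^ (2 / critExp n s) ≤ dirichletEnergy φ - γ * hardyTerm φ)
    (hlt : bestConst Ω γ s < (m : EReal)) : HasExtremal Ω γ s := by
  have hfact : Fact (1 ≤ ENNReal.ofReal (critExp n s)) := ⟨one_le_ofReal_critExp hn hs2⟩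
  have h0Ω : (0 : E n) ∉ Ω := fun h => (hΩ.frontier_eq ▸ h0).2 h
  have hp := critExp_pos hn hs2
  have hT := controlled_hardySobolev hn hΩ h0Ω hs0 hs2
  have hS := controlled_hardy hn hΩ h0Ω
  have hK := controlled_one hn hΩ h0Ω hb
  set T := weightMap (hn := hn) hT
  set S := weightMap (hn := hn) hS
  set K := weightMap (hn := hn) hK
  have hw0 := ae_weight_ne_zero hn (-s / critExp n s)
  have hJ : ∀ u g (h : MemD12 Ω u g), J Ω γ s u g =
      (‖h.toGrad hn‖ ^ 2 - γ * ‖S (h.toGrad hn)‖ ^ 2) / ‖T (h.toGrad hn)‖ ^ 2 :=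
    fun u g h => h.J_eq_norm hn hs2 hT hS
  have hJ' : ∀ x, T x ≠ 0 → bestConst Ω γ s ≤
      (((‖x‖ ^ 2 - γ * ‖S x‖ ^ 2) / ‖T x‖ ^ 2 : ℝ) : EReal) :=
    fun x hx => bestConst_le_norm hn hs2 hT hS hx
  obtain ⟨c, C₁, hc0, hC₁, hcoer⟩ := exists_coercive hn hΩ hb h0 hsm hγ
  have hcoer' : ∀ x, c * ‖x‖ ^ 2 ≤ ‖x‖ ^ 2 - γ * ‖S x‖ ^ 2 + C₁ * ‖K x‖ ^ 2 := by
    intro x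
    have := le_of_forall_test hn hs2 hT hS hK (a := 1 - c) (b := -γ) (c := C₁) (d := 0)
      (fun φ hφ => by linarith [hcoer φ hφ]) x
    change _ ≤ _ + -γ * ‖S x‖ ^ 2 + C₁ * ‖K x‖ ^ 2 at this
    linarith
  obtain ⟨C₂, hKT⟩ := exists_norm_massMap_le hn hΩ hb hs0 hs2 hT hK
  obtain ⟨μ, hμ⟩ : ∃ μ : ℝ, bestConst Ω γ s = (μ : EReal) := by
    have hbot : ((-(C₁ * C₂ ^ 2) : ℝ) : EReal) ≤ bestConst Ω γ s := by
      refine le_sInf ?_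
      rintro t ⟨u, g, h, rfl⟩
      rw [EReal.coe_le_coe_iff, hJ _ _ h.1]
      have hT0 : 0 < ‖T (h.1.toGrad hn)‖ := by
        rw [norm_pos_iff]
        exact fun h1 => h.2 ((h.1.weightMap_eq_zero_iff hn hT hw0).1 h1)
      rw [le_div_iff₀ (by positivity)]
      have h1 := hcoer' (h.1.toGrad hn)
      have h2 := pow_le_pow_left₀ (norm_nonneg _) (hKT (h.1.toGrad hn)) 2
      have h3 := mul_le_mul_of_nonneg_left h2 hC₁
      have h4 : 0 ≤ c * ‖h.1.toGrad hn‖ ^ 2 := by positivity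
      simp only [mul_pow] at h3
      change C₁ * ‖K _‖ ^ 2 ≤ C₁ * (C₂ ^ 2 * ‖T _‖ ^ 2) at h3
      linarith
    have h1 : bestConst Ω γ s ≠ ⊤ := (hlt.trans (EReal.coe_lt_top m)).ne
    have h2 : bestConst Ω γ s ≠ ⊥ := ((EReal.bot_lt_coe _).trans_le hbot).ne'
    exact ⟨_, (EReal.coe_toReal h1 h2).symm⟩
  rw [hμ, EReal.coe_lt_coe_iff] at hlt
  have hlow : ∀ x, μ * ‖T x‖ ^ 2 ≤ ‖x‖ ^ 2 - γ * ‖S x‖ ^ 2 := by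
    intro x
    by_cases hx : T x = 0
    · have h1 := hcoer' x
      have h2 : ‖K x‖ ≤ 0 := by simpa [T, hx] using hKT x
      have h3 : ‖K x‖ = 0 := le_antisymm h2 (norm_nonneg _)
      rw [hx, norm_zero]
      rw [h3] at h1
      have h4 : 0 ≤ c * ‖x‖ ^ 2 := by positivity
      linarith
    · have := hJ' x hx
      rw [hμ, EReal.coe_le_coe_iff, le_div_iff₀ (by positivity)] at this
      exact this
  obtain ⟨x, hx0, hx⟩ := exists_minimiser (two_le_critExp hn hs2) T S K (γ := γ) (m := m) (μ := μ)
    (fun x y R hR hx => exists_subseq_ae_of_weakly_convergent hn hb hK hT hR hx)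
    (fun x R hR hx => tendsto_massMap_of_weakly_null hn hb hK hR hx)
    (fun ε hε => by
      obtain ⟨C, hC0, hC⟩ := exists_localised_hardySobolev hn hΩ hb h0 hsm hs0 hs2 hm0 hm hε
      refine ⟨C, hC0, fun x => ?_⟩
      have := le_of_forall_test hn hs2 hT hS hK (a := 1 + ε) (b := -γ) (c := C) (d := m)
        (fun φ hφ => by linarith [hC φ hφ]) x
      change m * ‖T x‖ ^ 2 ≤ _ + -γ * ‖S x‖ ^ 2 + C * ‖K x‖ ^ 2 at this
      linarith)
    ⟨c, C₁, hc0, hC₁, hcoer'⟩ ⟨C₂, hKT⟩ hm0 hlt hlow (fun ε hε => by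
      have h1 : bestConst Ω γ s < ((μ + ε : ℝ) : EReal) := by
        rw [hμ, EReal.coe_lt_coe_iff]
        linarith
      obtain ⟨t, ⟨u, g, h, rfl⟩, h2⟩ := sInf_lt_iff.1 h1
      rw [EReal.coe_lt_coe_iff, hJ _ _ h.1] at h2
      have hT0 : ‖T (h.1.toGrad hn)‖ ≠ 0 := by
        rw [norm_ne_zero_iff]
        exact fun h1 => h.2 ((h.1.weightMap_eq_zero_iff hn hT hw0).1 h1)
      refine ⟨‖T (h.1.toGrad hn)‖⁻¹ • h.1.toGrad hn, ?_, ?_⟩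
      · rw [map_smul, norm_smul, norm_inv, norm_norm, inv_mul_cancel₀ hT0]
      · rw [map_smul, norm_smul, norm_smul, norm_inv, norm_norm]
        refine lt_of_eq_of_lt ?_ h2
        field_simp)
  refine ⟨potential x, _, memD12NeZero_potential hn hT hx0, ?_⟩
  refine le_antisymm ?_ ?_
  · rw [hμ, EReal.coe_le_coe_iff, hJ _ _ (memD12_potential x), MemD12.toGrad_potential,
      div_le_iff₀ (by positivity)]
    exact hx
  · rw [hJ _ _ (memD12_potential x), MemD12.toGrad_potential]
    exact hJ' x hx0

/-! ### Compositions and products in `D^{1,2}(Ω)` -/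

/-- Dominated convergence in `L^q`. -/
lemma tendsto_eLpNorm_zero_of_dominated {α F : Type*} [MeasurableSpace α] [NormedAddCommGroup F]
    {μ : Measure α} {q : ℝ≥0∞} (hq0 : q ≠ 0) (hq : q ≠ ⊤) {f : ℕ → α → F} {b : α → ℝ}
    (hf : ∀ k, AEStronglyMeasurable (f k) μ) (hb : MemLp b q μ)
    (hle : ∀ k, ∀ᵐ x ∂μ, ‖f k x‖ ≤ ‖b x‖)
    (hlim : ∀ᵐ x ∂μ, Tendsto (fun k => f k x) atTop (𝓝 0)) :
    Tendsto (fun k => eLpNorm (f k) q μ) atTop (𝓝 0) := by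
  have hq' := ENNReal.toReal_pos hq0 hq
  have h1 : Tendsto (fun k => ∫⁻ x, ‖f k x‖ₑ ^ q.toReal ∂μ) atTop (𝓝 (∫⁻ _, 0 ∂μ)) := by
    refine tendsto_lintegral_of_dominated_convergence' (fun x => ‖b x‖ₑ ^ q.toReal)
      (fun k => (hf k).enorm.pow_const _) (fun k => ?_)
      (lintegral_rpow_enorm_lt_top_of_eLpNorm_lt_top hq0 hq hb.2).ne ?_
    · filter_upwards [hle k] with x hx
      gcongr
      exact enorm_le_iff_norm_le.2 hx
    · filter_upwards [hlim] with x hx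
      have := (ENNReal.continuous_rpow_const (y := q.toReal)).tendsto _ |>.comp hx.enorm
      simpa [hq', Function.comp_def] using this
  rw [lintegral_zero] at h1
  have h2 := (ENNReal.continuous_rpow_const (y := 1 / q.toReal)).tendsto _ |>.comp h1
  simp only [ENNReal.zero_rpow_of_pos (one_div_pos.2 hq')] at h2
  refine h2.congr fun k => ?_
  rw [eLpNorm_eq_lintegral_rpow_enorm_toReal hq0 hq]
  rfl

lemma IsTestFunction.comp {Ω : Set (E n)} {φ : E n → ℝ} (hφ : IsTestFunction Ω φ) {F : ℝ → ℝ}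
    (hF : ContDiff ℝ ∞ F) (hF0 : F 0 = 0) : IsTestFunction Ω (fun x => F (φ x)) :=
  ⟨hF.comp hφ.smooth, hφ.compact.comp_left hF0,
    (closure_mono (Function.support_comp_subset hF0 φ)).trans hφ.support_subset⟩

lemma gradient_comp {φ : E n → ℝ} {x : E n} {F : ℝ → ℝ} (hF : DifferentiableAt ℝ F (φ x))
    (hφ : DifferentiableAt ℝ φ x) :
    gradient (fun y => F (φ y)) x = deriv F (φ x) • gradient φ x := by
  have := (hF.hasDerivAt.comp_hasFDerivAt x hφ.hasFDerivAt).fderiv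
  have h2 : fderiv ℝ (fun y => F (φ y)) x = deriv F (φ x) • fderiv ℝ φ x := this
  simp [gradient, h2]

lemma abs_sub_le_of_deriv_le {F : ℝ → ℝ} (hF : ContDiff ℝ ∞ F) {L : ℝ}
    (hL : ∀ t, |deriv F t| ≤ L) (a b : ℝ) : |F a - F b| ≤ L * |a - b| :=
  Convex.norm_image_sub_le_of_norm_deriv_le (s := Set.univ)
    (fun x _ => hF.differentiable (by simp) x) (fun x _ => hL x) convex_univ
    (Set.mem_univ b) (Set.mem_univ a)

/-- The chain rule in `D^{1,2}(Ω)`. -/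
lemma MemD12.comp (hn : 3 ≤ n) {Ω : Set (E n)} {u : E n → ℝ} {g : E n → E n} (h : MemD12 Ω u g)
    {F : ℝ → ℝ} (hF : ContDiff ℝ ∞ F) (hF0 : F 0 = 0) {L : ℝ} (hL : ∀ t, |deriv F t| ≤ L) :
    MemD12 Ω (fun x => F (u x)) (fun x => deriv F (u x) • g x) := by
  have hF' : Continuous (deriv F) := hF.continuous_deriv (by simp)
  have hL0 : 0 ≤ L := (abs_nonneg _).trans (hL 0)
  have hm : AEStronglyMeasurable (fun x => deriv F (u x)) volume :=
    hF'.comp_aestronglyMeasurable h.memLp.1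
  obtain ⟨φ, hφ, h1, h2, h3, -⟩ := h.exists_approx_ae hn
  have hgrad : ∀ k x, gradient (fun y => F (φ k y)) x = deriv F (φ k x) • gradient (φ k) x :=
    fun k x => gradient_comp (hF.differentiable (by simp) _) ((hφ k).differentiableAt x)
  have hmk : ∀ k, AEStronglyMeasurable (fun x => deriv F (φ k x)) volume := fun k =>
    (hF'.comp (hφ k).smooth.continuous).aestronglyMeasurable
  refine MemD12.of_tendsto hn (fun k => ((hφ k).comp hF hF0).memD12) ?_ ?_ ?_ ?_
  · refine h.memLp.of_le_mul (c := L) (hF.continuous.comp_aestronglyMeasurable h.memLp.1)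
      (ae_of_all _ fun x => ?_)
    simpa [hF0] using abs_sub_le_of_deriv_le hF hL (u x) 0
  · refine h.memLp_grad.of_le_mul (c := L) (hm.smul h.memLp_grad.1) (ae_of_all _ fun x => ?_)
    rw [norm_smul]
    gcongr
    exact hL _
  · refine tendsto_of_tendsto_of_tendsto_of_le_of_le tendsto_const_nhds
      (h := fun k => ENNReal.ofReal L * eLpNorm (fun x => u x - φ k x)
        (ENNReal.ofReal (critExp n 0)) volume) ?_
      (fun _ => zero_le) fun k => ?_
    · simpa using ENNReal.Tendsto.const_mul h1 (a := ENNReal.ofReal L) (Or.inr (by simp))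
    · exact eLpNorm_le_mul_eLpNorm_of_ae_le_mul (ae_of_all _ fun x =>
        abs_sub_le_of_deriv_le hF hL _ _) _
  · simp only [hgrad]
    have a1 : Tendsto (fun k => eLpNorm (fun x => (deriv F (u x) - deriv F (φ k x)) • g x) 2
        volume) atTop (𝓝 0) := by
      refine tendsto_eLpNorm_zero_of_dominated (by simp) (by simp)
        (b := fun x => (2 * L) * ‖g x‖) (fun k => (hm.sub (hmk k)).smul h.memLp_grad.1)
        (h.memLp_grad.norm.const_mul _) (fun k => ae_of_all _ fun x => ?_) ?_
      · rw [norm_smul, norm_mul, norm_norm]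
        refine mul_le_mul_of_nonneg_right ?_ (norm_nonneg _)
        rw [Real.norm_eq_abs, Real.norm_of_nonneg (by positivity), abs_le]
        have e1 := abs_le.1 (hL (u x))
        have e2 := abs_le.1 (hL (φ k x))
        constructor <;> linarith
      · filter_upwards [h3] with x hx
        have := (((hF'.tendsto _).comp hx).const_sub (deriv F (u x))).smul_const (g x)
        simpa using this
    have a2 : Tendsto (fun k => eLpNorm (fun x => deriv F (φ k x) • (g x - gradient (φ k) x)) 2
        volume) atTop (𝓝 0) := by
      refine tendsto_of_tendsto_of_tendsto_of_le_of_le tendsto_const_nhds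
        (h := fun k => ENNReal.ofReal L * eLpNorm (fun x => g x - gradient (φ k) x) 2 volume) ?_
        (fun _ => zero_le) fun k => ?_
      · simpa using ENNReal.Tendsto.const_mul h2 (a := ENNReal.ofReal L) (Or.inr (by simp))
      · refine eLpNorm_le_mul_eLpNorm_of_ae_le_mul (ae_of_all _ fun x => ?_) _
        rw [norm_smul]
        gcongr
        exact hL _
    refine tendsto_of_tendsto_of_tendsto_of_le_of_le tendsto_const_nhds
      (by simpa using a1.add a2) (fun _ => zero_le) fun k => ?_
    refine le_trans (le_of_eq ?_) (eLpNorm_add_le ((hm.sub (hmk k)).smul h.memLp_grad.1)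
      ((hmk k).smul (h.memLp_grad.1.sub ((hφ k).memLp_gradient 2).1)) (by norm_num))
    congr 1
    ext1 x
    simp only [Pi.add_apply]
    module

/-- `D^{1,2}(Ω)` is stable under multiplication by test functions. -/
lemma MemD12.smooth_mul (hn : 3 ≤ n) {Ω Ω' : Set (E n)} (hK : Controlled Ω (fun _ => 1) 2)
    {ζ : E n → ℝ} (hζ : IsTestFunction Ω' ζ) {u : E n → ℝ} {g : E n → E n} (h : MemD12 Ω u g) :
    MemD12 Ω (fun x => ζ x * u x) (fun x => ζ x • g x + u x • gradient ζ x) := by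
  obtain ⟨φ, hφ, h1, h2⟩ := h.approx
  have hmem : ∀ {v h}, MemD12 Ω v h → MemLp v 2 volume := fun hv => by
    simpa using hK.memLp hn hv
  obtain ⟨A, hA⟩ := hζ.smooth.continuous.bounded_above_of_compact_support hζ.compact
  obtain ⟨B, hB⟩ := hζ.continuous_gradient.bounded_above_of_compact_support
    hζ.hasCompactSupport_gradient
  have hζm := hζ.smooth.continuous.aestronglyMeasurable (μ := (volume : Measure (E n)))
  have hζm' := hζ.continuous_gradient.aestronglyMeasurable (μ := (volume : Measure (E n)))
  have hgrad : ∀ k x, gradient (fun y => ζ y * φ k y) x =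
      ζ x • gradient (φ k) x + φ k x • gradient ζ x :=
    fun k x => gradient_mul (hζ.differentiableAt x) ((hφ k).differentiableAt x)
  have h3 : Tendsto (fun k => eLpNorm (fun x => u x - φ k x) 2 volume) atTop (𝓝 0) := by
    obtain ⟨C, hC⟩ := hK.bound
    refine tendsto_of_tendsto_of_tendsto_of_le_of_le tendsto_const_nhds
      (h := fun k => C * eLpNorm (fun x => g x - gradient (φ k) x) 2 volume) ?_
      (fun _ => zero_le) fun k => ?_
    · simpa using ENNReal.Tendsto.const_mul h2 (a := (C : ℝ≥0∞)) (Or.inr (by simp))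
    · simpa using (h.sub hn (hφ k).memD12).eLpNorm_weight_le hn hK.meas hC
  have hA0 : ∀ {F : Type} [NormedAddCommGroup F] [NormedSpace ℝ F] (v : E n → F) (q : ℝ≥0∞),
      eLpNorm (fun x => ζ x • v x) q volume ≤ ENNReal.ofReal A * eLpNorm v q volume := by
    intro F _ _ v q
    refine eLpNorm_le_mul_eLpNorm_of_ae_le_mul (ae_of_all _ fun x => ?_) _
    rw [norm_smul]
    gcongr
    exact hA x
  have hB0 : ∀ (v : E n → ℝ) (q : ℝ≥0∞),
      eLpNorm (fun x => v x • gradient ζ x) q volume ≤ ENNReal.ofReal B * eLpNorm v q volume := by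
    intro v q
    refine eLpNorm_le_mul_eLpNorm_of_ae_le_mul (ae_of_all _ fun x => ?_) _
    rw [norm_smul, mul_comm]
    gcongr
    exact hB x
  have hlim : ∀ {f : ℕ → ℝ≥0∞} (C : ℝ), Tendsto f atTop (𝓝 0) →
      Tendsto (fun k => ENNReal.ofReal C * f k) atTop (𝓝 0) := by
    intro f C hf
    simpa using ENNReal.Tendsto.const_mul hf (a := ENNReal.ofReal C) (Or.inr (by simp))
  have i1 : MemLp (fun x => ζ x • g x) 2 volume := ⟨hζm.smul h.memLp_grad.1, (hA0 g 2).trans_lt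
    (ENNReal.mul_lt_top (by simp) h.memLp_grad.2)⟩
  have i2 : MemLp (fun x => u x • gradient ζ x) 2 volume := ⟨h.memLp.1.smul hζm',
    (hB0 u 2).trans_lt (ENNReal.mul_lt_top (by simp) (hmem h).2)⟩
  refine MemD12.of_tendsto hn (fun k => ((hφ k).smooth_mul hζ.smooth).memD12)
    ⟨hζm.mul h.memLp.1, (hA0 u _).trans_lt (ENNReal.mul_lt_top (by simp) h.memLp.2)⟩
    (i1.add i2) ?_ ?_
  · refine tendsto_of_tendsto_of_tendsto_of_le_of_le tendsto_const_nhds (hlim A h1)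
      (fun _ => zero_le) fun k => ?_
    refine le_trans (le_of_eq ?_) (hA0 _ _)
    congr 1
    ext1 x
    simp only [smul_eq_mul]
    ring
  · simp only [hgrad]
    refine tendsto_of_tendsto_of_tendsto_of_le_of_le tendsto_const_nhds
      (by simpa using (hlim A h2).add (hlim B h3)) (fun _ => zero_le) fun k => ?_
    refine le_trans (le_of_eq ?_) ((eLpNorm_add_le
      (hζm.smul (h.memLp_grad.1.sub ((hφ k).memLp_gradient 2).1))
      ((h.memLp.1.sub ((hφ k).memLp 2).1).smul hζm') (by norm_num)).trans
      (add_le_add (hA0 _ 2) (hB0 _ 2)))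
    congr 1
    ext1 x
    simp only [Pi.add_apply, Pi.sub_apply, Pi.smul_apply']
    module

lemma hasDerivAt_sqrt_sq_add {δ : ℝ} (hδ : 0 < δ) (t : ℝ) :
    HasDerivAt (fun t : ℝ => √(t ^ 2 + δ ^ 2)) (t / √(t ^ 2 + δ ^ 2)) t := by
  have h0 : t ^ 2 + δ ^ 2 ≠ 0 := by positivity
  have h1 : HasDerivAt (fun t : ℝ => t ^ 2 + δ ^ 2) (2 * t) t := by
    simpa using (hasDerivAt_pow 2 t).add_const (δ ^ 2)
  convert h1.sqrt h0 using 1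
  field_simp

lemma contDiff_sqrt_sq_add {δ : ℝ} (hδ : 0 < δ) :
    ContDiff ℝ ∞ (fun t : ℝ => √(t ^ 2 + δ ^ 2)) :=
  ContDiff.sqrt (by fun_prop) fun t => by positivity

lemma abs_le_sqrt_sq_add (t δ : ℝ) : |t| ≤ √(t ^ 2 + δ ^ 2) :=
  Real.abs_le_sqrt (by linarith [sq_nonneg δ])

/-- `D^{1,2}(Ω)` is stable under taking absolute values. -/
lemma MemD12.abs (hn : 3 ≤ n) {Ω : Set (E n)} {u : E n → ℝ} {g : E n → E n} (h : MemD12 Ω u g) :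
    MemD12 Ω (fun x => |u x|) (fun x => (SignType.sign (u x) : ℝ) • g x) := by
  -- `|t|` is the limit of the smooth functions `√(t² + δ²) - δ`.
  set δ : ℕ → ℝ := fun k => 1 / ((k : ℝ) + 1) with hδ
  have hδ0 : ∀ k, 0 < δ k := fun k => by positivity
  have hδlim : Tendsto δ atTop (𝓝 0) := tendsto_one_div_add_atTop_nhds_zero_nat
  have hder : ∀ k t, HasDerivAt (fun t : ℝ => √(t ^ 2 + δ k ^ 2) - δ k)
      (t / √(t ^ 2 + δ k ^ 2)) t := fun k t => (hasDerivAt_sqrt_sq_add (hδ0 k) t).sub_const _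
  have hquot : ∀ k t, |t / √(t ^ 2 + δ k ^ 2)| ≤ 1 := by
    intro k t
    have h0 : 0 < t ^ 2 + δ k ^ 2 := by positivity [hδ0 k]
    rw [abs_div, abs_of_pos (Real.sqrt_pos.2 h0), div_le_one (Real.sqrt_pos.2 h0)]
    exact abs_le_sqrt_sq_add _ _
  have hk : ∀ k, MemD12 Ω (fun x => √(u x ^ 2 + δ k ^ 2) - δ k)
      (fun x => (u x / √(u x ^ 2 + δ k ^ 2)) • g x) := by
    intro k
    have := h.comp hn (F := fun t => √(t ^ 2 + δ k ^ 2) - δ k)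
      ((contDiff_sqrt_sq_add (hδ0 k)).sub contDiff_const) (by simp [Real.sqrt_sq (hδ0 k).le])
      (L := 1) (fun t => by rw [(hder k t).deriv]; exact hquot k t)
    simpa only [(hder k _).deriv] using this
  have hF : ∀ k t, |(|t| - (√(t ^ 2 + δ k ^ 2) - δ k))| ≤ |t| := by
    intro k t
    have h1 := abs_le_sqrt_sq_add t (δ k)
    have h2 : δ k ≤ √(t ^ 2 + δ k ^ 2) := Real.le_sqrt_of_sq_le (by nlinarith [sq_nonneg t])
    have h3 : √(t ^ 2 + δ k ^ 2) ≤ |t| + δ k := by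
      rw [Real.sqrt_le_left (by have := hδ0 k; positivity)]
      nlinarith [sq_abs t, mul_nonneg (abs_nonneg t) (hδ0 k).le]
    rw [abs_le]
    constructor <;> linarith [abs_nonneg t]
  have hsq : ∀ t, Tendsto (fun k => √(t ^ 2 + δ k ^ 2)) atTop (𝓝 |t|) := by
    intro t
    have := ((hδlim.pow 2).const_add (t ^ 2)).sqrt
    simpa [Real.sqrt_sq_eq_abs] using this
  have hsign : Measurable fun t : ℝ => (SignType.sign t : ℝ) := by
    have : (fun t : ℝ => (SignType.sign t : ℝ)) =
        fun t => if 0 < t then 1 else if t < 0 then -1 else 0 := by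
      ext t
      rw [sign_apply]
      split_ifs <;> simp
    rw [this]
    exact Measurable.ite measurableSet_Ioi measurable_const
      (Measurable.ite measurableSet_Iio measurable_const measurable_const)
  have hsm : AEStronglyMeasurable (fun x => (SignType.sign (u x) : ℝ)) volume :=
    (hsign.comp_aemeasurable h.memLp.1.aemeasurable).aestronglyMeasurable
  have hs1 : ∀ t : ℝ, |(SignType.sign t : ℝ)| ≤ 1 := by
    intro t
    rcases lt_trichotomy t 0 with ht | ht | ht <;> simp [ht]
  refine MemD12.of_tendsto hn hk h.memLp.norm ?_ ?_ ?_
  · refine h.memLp_grad.mono (hsm.smul h.memLp_grad.1) (ae_of_all _ fun x => ?_)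
    rw [norm_smul]
    exact mul_le_of_le_one_left (norm_nonneg _) (hs1 _)
  · refine tendsto_eLpNorm_zero_of_dominated
      (one_pos.trans_le (one_le_ofReal_critExp hn (by norm_num))).ne' (by simp) (b := u)
      (fun k => h.memLp.norm.1.sub (hk k).memLp.1) h.memLp
      (fun k => ae_of_all _ fun x => hF k (u x)) (ae_of_all _ fun x => ?_)
    have := ((hsq (u x)).sub hδlim).const_sub |u x|
    simpa using this
  · refine tendsto_eLpNorm_zero_of_dominated (by simp) (by simp) (b := fun x => 2 * ‖g x‖)
      (fun k => (hsm.smul h.memLp_grad.1).sub (hk k).memLp_grad.1)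
      (h.memLp_grad.norm.const_mul 2) (fun k => ae_of_all _ fun x => ?_) (ae_of_all _ fun x => ?_)
    · rw [← sub_smul, norm_smul, norm_mul, norm_norm]
      refine mul_le_mul_of_nonneg_right ?_ (norm_nonneg _)
      rw [Real.norm_eq_abs, Real.norm_of_nonneg two_pos.le]
      have e1 := abs_le.1 (hs1 (u x))
      have e2 := abs_le.1 (hquot k (u x))
      rw [abs_le]
      constructor <;> linarith
    · simp only [← sub_smul]
      by_cases hx : u x = 0
      · simp [hx]
      · have h1 := ((tendsto_const_nhds (x := u x)).div (hsq (u x))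
          (abs_ne_zero.2 hx)).const_sub (SignType.sign (u x) : ℝ)
        have h2 : (SignType.sign (u x) : ℝ) - u x / |u x| = 0 := by
          rcases lt_or_gt_of_ne hx with ht | ht
          · simp [ht, abs_of_neg ht, hx]
          · simp [ht, abs_of_pos ht, hx]
        rw [h2] at h1
        simpa using h1.smul_const (g x)

/-! ### The Euler-Lagrange equation -/

lemma integrable_abs_rpow {α : Type*} [MeasurableSpace α] {μ : Measure α} {p : ℝ} (hp : 0 < p)
    {f : α → ℝ} (hf : MemLp f (ENNReal.ofReal p) μ) : Integrable (fun x => |f x| ^ p) μ := by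
  have := hf.integrable_norm_rpow (by simpa using hp) (by simp)
  simpa [ENNReal.toReal_ofReal hp.le] using this

lemma hasDerivAt_integral_abs_rpow {α : Type*} [MeasurableSpace α] {μ : Measure α} {p : ℝ}
    (hp : 1 < p) {f e : α → ℝ} (hf : MemLp f (ENNReal.ofReal p) μ)
    (he : MemLp e (ENNReal.ofReal p) μ) :
    HasDerivAt (fun t : ℝ => ∫ x, |f x + t * e x| ^ p ∂μ)
      (∫ x, p * |f x| ^ (p - 2) * f x * e x ∂μ) 0 := by
  have hp0 : 0 < p := by linarith
  have hmeas : Measurable fun t : ℝ => p * |t| ^ (p - 2) * t :=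
    ((measurable_norm.pow_const _).const_mul p).mul measurable_id
  have key := hasDerivAt_integral_of_dominated_loc_of_deriv_le (μ := μ) (𝕜 := ℝ)
    (F := fun t x => |f x + t * e x| ^ p)
    (F' := fun t x => p * |f x + t * e x| ^ (p - 2) * (f x + t * e x) * e x) (x₀ := 0)
    (s := Set.Icc (-1) 1) (bound := fun x => p * (|f x| + |e x|) ^ p)
    (Icc_mem_nhds (by norm_num) (by norm_num)) (Eventually.of_forall fun t =>
      (integrable_abs_rpow hp0 (hf.add (he.const_mul t))).1)
    (integrable_abs_rpow hp0 (hf.add (he.const_mul 0))) ?_ ?_ ?_ ?_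
  · simpa using key.2
  · exact (hmeas.comp_aemeasurable
      (hf.add (he.const_mul 0)).1.aemeasurable).aestronglyMeasurable.mul he.1
  · refine ae_of_all _ fun x t ht => ?_
    have h1 : |f x + t * e x| ≤ |f x| + |e x| := by
      refine (abs_add_le _ _).trans (add_le_add le_rfl ?_)
      rw [abs_mul]
      exact mul_le_of_le_one_left (abs_nonneg _) (abs_le.2 ht)
    have h2 : ∀ y : ℝ, 0 ≤ y → y ^ (p - 2) * y = y ^ (p - 1) := by
      intro y hy
      rw [← Real.rpow_add_one' hy (by linarith)]
      ring_nf
    have h3 : ∀ y : ℝ, 0 ≤ y → y ^ (p - 1) * y = y ^ p := by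
      intro y hy
      rw [← Real.rpow_add_one' hy (by linarith)]
      ring_nf
    rw [Real.norm_eq_abs, abs_mul, abs_mul, abs_mul, abs_of_pos hp0,
      abs_of_nonneg (by positivity : 0 ≤ |f x + t * e x| ^ (p - 2)), mul_assoc p,
      h2 _ (abs_nonneg _), mul_assoc, ← h3 _ (by positivity : 0 ≤ |f x| + |e x|)]
    have h4 : |e x| ≤ |f x| + |e x| := by linarith [abs_nonneg (f x)]
    have h5 : 0 ≤ p - 1 := by linarith
    gcongr
  · have := integrable_abs_rpow hp0 (hf.norm.add he.norm)
    refine (this.const_mul p).congr (ae_of_all _ fun x => ?_)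
    simp only [Pi.add_apply, Real.norm_eq_abs]
    rw [abs_of_nonneg (by positivity : 0 ≤ |f x| + |e x|)]
  · refine ae_of_all _ fun x t _ => ?_
    have h1 : HasDerivAt (fun t => f x + t * e x) (e x) t := by
      simpa using ((hasDerivAt_id t).mul_const (e x)).const_add (f x)
    exact (hasDerivAt_abs_rpow (f x + t * e x) hp).comp t h1

/-- The Euler-Lagrange equation of minimisers of `(‖x‖² - γ ‖S x‖²) / ‖T x‖²`. -/
lemma euler_lagrange {H F α : Type*} [NormedAddCommGroup H] [InnerProductSpace ℝ H]
    [NormedAddCommGroup F] [InnerProductSpace ℝ F] [MeasurableSpace α] {ν : Measure α} {p : ℝ}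
    [Fact (1 ≤ ENNReal.ofReal p)] (hp : 1 < p) (T : H →L[ℝ] Lp ℝ (ENNReal.ofReal p) ν)
    (S : H →L[ℝ] F) {γ μ : ℝ} {x : H} (hx : T x ≠ 0)
    (hlow : ∀ z, T z ≠ 0 → μ * ‖T z‖ ^ 2 ≤ ‖z‖ ^ 2 - γ * ‖S z‖ ^ 2)
    (heq : ‖x‖ ^ 2 - γ * ‖S x‖ ^ 2 = μ * ‖T x‖ ^ 2) (y : H) :
    ⟪x, y⟫_ℝ - γ * ⟪S x, S y⟫_ℝ =
      μ * ‖T x‖ ^ (2 - p) * ∫ t, |T x t| ^ (p - 2) * T x t * T y t ∂ν := by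
  have hp0 : 0 < p := by linarith
  have hTx : 0 < ‖T x‖ := norm_pos_iff.2 hx
  have hTp : ∀ t : ℝ, ‖T (x + t • y)‖ ^ p = ∫ a, |T x a + t * T y a| ^ p ∂ν := by
    intro t
    rw [Lp.norm_def, toReal_eLpNorm_rpow hp0 (Lp.memLp _)]
    refine integral_congr_ae ?_
    rw [map_add, map_smul]
    filter_upwards [Lp.coeFn_add (T x) (t • T y), Lp.coeFn_smul t (T y)] with a h1 h2
    rw [h1, Pi.add_apply, h2, Pi.smul_apply, smul_eq_mul, Real.norm_eq_abs]
  have hTsq : ∀ t : ℝ, ‖T (x + t • y)‖ ^ 2 = (∫ a, |T x a + t * T y a| ^ p ∂ν) ^ (2 / p) := by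
    intro t
    rw [← hTp, ← Real.rpow_mul (norm_nonneg _), mul_div_cancel₀ _ hp0.ne', Real.rpow_two]
  have hI0 : (∫ a, |T x a + 0 * T y a| ^ p ∂ν) = ‖T x‖ ^ p := by
    rw [← hTp]
    simp
  have hd1 := hasDerivAt_integral_abs_rpow hp (Lp.memLp (T x)) (Lp.memLp (T y))
  have hd2 := (hd1.rpow_const (p := 2 / p) (Or.inl (by rw [hI0]; positivity))).const_mul μ
  have hQ : ∀ t : ℝ, ‖x + t • y‖ ^ 2 - γ * ‖S (x + t • y)‖ ^ 2 =
      (‖x‖ ^ 2 - γ * ‖S x‖ ^ 2) + t * (2 * (⟪x, y⟫_ℝ - γ * ⟪S x, S y⟫_ℝ)) +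
        t ^ 2 * (‖y‖ ^ 2 - γ * ‖S y‖ ^ 2) := by
    intro t
    rw [map_add, map_smul, norm_add_sq_real, norm_add_sq_real, inner_smul_right, inner_smul_right,
      norm_smul, norm_smul, mul_pow, mul_pow, Real.norm_eq_abs, sq_abs]
    ring
  have hd3 : HasDerivAt (fun t : ℝ => ‖x + t • y‖ ^ 2 - γ * ‖S (x + t • y)‖ ^ 2)
      (2 * (⟪x, y⟫_ℝ - γ * ⟪S x, S y⟫_ℝ)) 0 := by
    simp only [hQ]
    have h1 := ((hasDerivAt_id (0 : ℝ)).mul_const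
      (2 * (⟪x, y⟫_ℝ - γ * ⟪S x, S y⟫_ℝ))).const_add (‖x‖ ^ 2 - γ * ‖S x‖ ^ 2)
    have h2 := (hasDerivAt_pow 2 (0 : ℝ)).mul_const (‖y‖ ^ 2 - γ * ‖S y‖ ^ 2)
    simpa using h1.fun_add h2
  have hmin : IsLocalMin (fun t : ℝ => (‖x + t • y‖ ^ 2 - γ * ‖S (x + t • y)‖ ^ 2) -
      μ * (∫ a, |T x a + t * T y a| ^ p ∂ν) ^ (2 / p)) 0 := by
    have hc : ContinuousAt (fun t : ℝ => T (x + t • y)) 0 := by fun_prop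
    have hne : ∀ᶠ t : ℝ in 𝓝 0, T (x + t • y) ≠ 0 :=
      hc.eventually_ne (by simpa using hx)
    filter_upwards [hne] with t ht
    have h1 := hlow _ ht
    rw [← hTsq, ← hTsq]
    simp only [zero_smul, add_zero, heq, sub_self]
    linarith
  have h0 := hmin.hasDerivAt_eq_zero (hd3.sub hd2)
  rw [hI0, ← Real.rpow_mul hTx.le] at h0
  have e1 : p * (2 / p - 1) = 2 - p := by field_simp
  have e2 : ∫ a, p * |T x a| ^ (p - 2) * T x a * T y a ∂ν =
      p * ∫ a, |T x a| ^ (p - 2) * T x a * T y a ∂ν := by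
    rw [← integral_const_mul]
    congr with a
    ring
  rw [e1, e2] at h0
  field_simp at h0
  linarith

lemma rpow_mul_self_mul {p : ℝ} (hp : 1 < p) {N v ψ s : ℝ} (hN : 0 < N) (hv : 0 ≤ v) :
    |N ^ (-s / p) * v| ^ (p - 2) * (N ^ (-s / p) * v) * (N ^ (-s / p) * ψ) =
      v ^ (p - 1) * ψ / N ^ s := by
  have hp0 : 0 < p := by linarith
  have hW : 0 < N ^ (-s / p) := Real.rpow_pos_of_pos hN _
  have h2 : ∀ y : ℝ, 0 ≤ y → y ^ (p - 2) * y = y ^ (p - 1) := by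
    intro y hy
    rw [← Real.rpow_add_one' hy (by linarith)]
    ring_nf
  rw [abs_of_nonneg (by positivity), h2 _ (by positivity), Real.mul_rpow hW.le hv]
  have h3 : (N ^ (-s / p)) ^ (p - 1) * N ^ (-s / p) = (N ^ s)⁻¹ := by
    rw [← Real.rpow_add_one' hW.le (by linarith), ← Real.rpow_mul hN.le, ← Real.rpow_neg hN.le]
    congr 1
    field_simp
    ring
  rw [div_eq_mul_inv _ (N ^ s), ← h3]
  ring

set_option maxHeartbeats 800000 in
/-- A nonnegative minimiser satisfies the Euler-Lagrange equation. -/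
lemma MemD12NeZero.euler_lagrange (hn : 3 ≤ n) {Ω : Set (E n)} (hΩ : IsOpen Ω)
    (h0 : (0 : E n) ∉ Ω) {γ s : ℝ} (hs0 : 0 ≤ s) (hs2 : s ≤ 2) {v : E n → ℝ} {g : E n → E n}
    (h : MemD12NeZero Ω v g) (hv : ∀ x, 0 ≤ v x)
    (hJ : (J Ω γ s v g : EReal) = bestConst Ω γ s) {ψ : E n → ℝ} {k : E n → E n}
    (hψ : MemD12 Ω ψ k) :
    (∫ x, ⟪g x, k x⟫_ℝ) - γ * ∫ x, v x * ψ x / ‖x‖ ^ 2 =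
      J Ω γ s v g * hsTerm s v ^ (2 / critExp n s - 1) *
        ∫ x, v x ^ (critExp n s - 1) * ψ x / ‖x‖ ^ s := by
  have hfact : Fact (1 ≤ ENNReal.ofReal (critExp n s)) := ⟨one_le_ofReal_critExp hn hs2⟩
  have hp := critExp_pos hn hs2
  have hp1 : 1 < critExp n s := by linarith [two_le_critExp hn hs2]
  have hT := controlled_hardySobolev hn hΩ h0 hs0 hs2
  have hS := controlled_hardy hn hΩ h0
  set x := h.1.toGrad hn
  set y := hψ.toGrad hn
  have hx : weightMap hT x ≠ 0 := fun h1 =>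
    h.2 ((h.1.weightMap_eq_zero_iff hn hT (ae_weight_ne_zero hn _)).1 h1)
  have hJn := h.1.J_eq_norm (γ := γ) hn hs2 hT hS
  have key := HardySchrodinger.euler_lagrange hp1 (weightMap hT) (weightMap hS) (γ := γ)
    (μ := J Ω γ s v g) hx (fun z hz => by
      have := bestConst_le_norm (γ := γ) hn hs2 hT hS hz
      rw [← hJ, EReal.coe_le_coe_iff, le_div_iff₀ (by positivity)] at this
      exact this) (by
      rw [hJn]
      exact (div_mul_cancel₀ _ (pow_ne_zero 2 (norm_ne_zero_iff.2 hx))).symm) y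
  have e1 : ⟪x, y⟫_ℝ = ∫ t, ⟪g t, k t⟫_ℝ := by
    rw [Submodule.coe_inner, L2.inner_def]
    refine integral_congr_ae ?_
    filter_upwards [h.1.coeFn_toGrad hn, hψ.coeFn_toGrad hn] with t h1 h2
    rw [h1, h2]
  have e2 : ⟪weightMap hS x, weightMap hS y⟫_ℝ = ∫ t, v t * ψ t / ‖t‖ ^ 2 := by
    rw [L2.inner_def]
    refine integral_congr_ae ?_
    filter_upwards [h.1.coeFn_weightMap hn hS, hψ.coeFn_weightMap hn hS] with t h1 h2
    rw [h1, h2, real_inner_eq_re_inner]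
    simp
    ring
  have e3 : ‖weightMap hT x‖ ^ (2 - critExp n s) = hsTerm s v ^ (2 / critExp n s - 1) := by
    have h1 := h.1.norm_weightMap_rpow hn hp hT
    simp only [hardySobolev_weight_rpow hp] at h1
    rw [hsTerm, ← h1, ← Real.rpow_mul (norm_nonneg _)]
    congr 1
    field_simp
  have e4 : ∫ t, |weightMap hT x t| ^ (critExp n s - 2) * weightMap hT x t * weightMap hT y t =
      ∫ x, v x ^ (critExp n s - 1) * ψ x / ‖x‖ ^ s := by
    refine integral_congr_ae ?_
    filter_upwards [h.1.coeFn_weightMap hn hT, hψ.coeFn_weightMap hn hT, ae_norm_pos hn]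
      with t h1 h2 h3
    rw [h1, h2]
    exact rpow_mul_self_mul hp1 h3 (hv t)
  rw [e1, e2, e3, e4] at key
  exact key

/-- If the extremal problem is solvable and `c = ±1` is the sign of the best constant, then there is
a nonnegative weak solution: the absolute value of an extremal, suitably scaled. -/
lemma exists_nonneg_solution (hn : 3 ≤ n) {Ω : Set (E n)} (hΩ : IsOpen Ω)
    (h0 : (0 : E n) ∉ Ω) {γ s : ℝ} (hs0 : 0 ≤ s) (hs2 : s < 2) (hext : HasExtremal Ω γ s)
    {c : ℝ} (hc : |c| = 1) (hsign : ∀ μ : ℝ, bestConst Ω γ s = (μ : EReal) → 0 < c * μ) :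
    ∃ u g, MemD12NeZero Ω u g ∧ (∀ x, 0 ≤ u x) ∧ ∀ ψ k, MemD12 Ω ψ k →
      (∫ x, ⟪g x, k x⟫_ℝ) - γ * ∫ x, u x * ψ x / ‖x‖ ^ 2 =
        c * ∫ x, u x ^ (critExp n s - 1) * ψ x / ‖x‖ ^ s := by
  obtain ⟨u₀, g₀, h₀, hJ₀⟩ := hext
  set p := critExp n s with hp_def
  have hp := critExp_pos hn hs2.le
  have hp2 := two_lt_critExp hn hs2
  set v : E n → ℝ := fun x => |u₀ x| with hv_def
  set g : E n → E n := fun x => (SignType.sign (u₀ x) : ℝ) • g₀ x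
  have hv : MemD12NeZero Ω v g := by
    refine ⟨h₀.1.abs hn, fun h => h₀.2 ?_⟩
    filter_upwards [h] with x hx
    simpa [hv_def] using hx
  have hJ : (J Ω γ s v g : EReal) = bestConst Ω γ s := by
    refine le_antisymm ?_ (sInf_le ⟨v, g, hv, rfl⟩)
    rw [← hJ₀, EReal.coe_le_coe_iff, J_eq hn hs2.le hv.1, J_eq hn hs2.le h₀.1]
    have e1 : hardyTerm v = hardyTerm u₀ := by simp [hardyTerm, hv_def]
    have e2 : hsTerm s v = hsTerm s u₀ := by simp [hsTerm, hv_def]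
    have e3 : ∫ x, ‖g x‖ ^ 2 ≤ ∫ x, ‖g₀ x‖ ^ 2 := by
      refine integral_mono (integrable_norm_sq hv.1.memLp_grad)
        (integrable_norm_sq h₀.1.memLp_grad) fun x => ?_
      have : ‖(SignType.sign (u₀ x) : ℝ)‖ ≤ 1 := by
        rcases lt_trichotomy (u₀ x) 0 with ht | ht | ht <;> simp [ht]
      simp only [g, norm_smul]
      gcongr
      exact mul_le_of_le_one_left (norm_nonneg _) this
    rw [e1, e2]
    gcongr
    exact Real.rpow_nonneg (hsTerm_nonneg _ _) _
  have hN := hsTerm_pos hn hΩ h0 hs0 hs2.le hv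
  set lam := J Ω γ s v g * hsTerm s v ^ (2 / p - 1) with hlam
  have hcl : 0 < c * lam := by
    rw [hlam, ← mul_assoc]
    exact mul_pos (hsign _ hJ.symm) (Real.rpow_pos_of_pos hN _)
  have hcc : c * c = 1 := by rw [← abs_mul_abs_self, hc, one_mul]
  set τ := (c * lam) ^ (1 / (p - 2)) with hτ
  have hτ0 : 0 < τ := Real.rpow_pos_of_pos hcl _
  have hτp : τ ^ (p - 1) = τ * (c * lam) := by
    have h1 : τ ^ (p - 2) = c * lam := by
      rw [hτ, ← Real.rpow_mul hcl.le, one_div_mul_cancel (by linarith), Real.rpow_one]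
    rw [← h1, ← Real.rpow_one_add' hτ0.le (by linarith)]
    ring_nf
  refine ⟨fun x => τ * v x, fun x => τ • g x, ⟨hv.1.const_mul τ, fun h => hv.2 ?_⟩,
    fun x => by positivity, fun ψ k hψ => ?_⟩
  · filter_upwards [h] with x hx
    simpa [hτ0.ne'] using hx
  · have hEL := hv.euler_lagrange hn hΩ h0 hs0 hs2.le (fun x => abs_nonneg _) hJ hψ
    have e1 : ∫ x, ⟪τ • g x, k x⟫_ℝ = τ * ∫ x, ⟪g x, k x⟫_ℝ := by
      rw [← integral_const_mul]
      simp only [inner_smul_left, RCLike.conj_to_real]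
    have e2 : ∫ x, τ * v x * ψ x / ‖x‖ ^ 2 = τ * ∫ x, v x * ψ x / ‖x‖ ^ 2 := by
      rw [← integral_const_mul]
      congr with x
      ring
    have e3 : ∫ x, (τ * v x) ^ (p - 1) * ψ x / ‖x‖ ^ s =
        τ ^ (p - 1) * ∫ x, v x ^ (p - 1) * ψ x / ‖x‖ ^ s := by
      rw [← integral_const_mul]
      congr with x
      rw [Real.mul_rpow hτ0.le (abs_nonneg _)]
      ring
    rw [e1, e2, e3, hτp]
    linear_combination τ * hEL -
      τ * lam * (∫ x, v x ^ (p - 1) * ψ x / ‖x‖ ^ s) * hcc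

/-! ### The strong maximum principle -/

/-- The function `1 / (t + √(t² + δ²))`, a smooth bounded substitute for `1 / (2 t)`, written in a
form without a denominator that depends on `t`. -/
noncomputable def regInv (δ t : ℝ) : ℝ := (√(t ^ 2 + δ ^ 2) - t) / δ ^ 2

lemma contDiff_regInv {δ : ℝ} (hδ : 0 < δ) : ContDiff ℝ ∞ (regInv δ) :=
  ((contDiff_sqrt_sq_add hδ).sub contDiff_id).div_const _

lemma deriv_regInv {δ : ℝ} (hδ : 0 < δ) (t : ℝ) :
    deriv (regInv δ) t = (t / √(t ^ 2 + δ ^ 2) - 1) / δ ^ 2 :=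
  (((hasDerivAt_sqrt_sq_add hδ t).sub (hasDerivAt_id t)).div_const (δ ^ 2)).deriv

lemma abs_deriv_regInv_le {δ : ℝ} (hδ : 0 < δ) (t : ℝ) : |deriv (regInv δ) t| ≤ 2 / δ ^ 2 := by
  rw [deriv_regInv hδ, abs_div, abs_of_pos (by positivity : 0 < δ ^ 2)]
  gcongr
  have h0 : 0 < √(t ^ 2 + δ ^ 2) := by positivity
  have h1 : |t / √(t ^ 2 + δ ^ 2)| ≤ 1 := by
    rw [abs_div, abs_of_pos h0, div_le_one h0]
    exact abs_le_sqrt_sq_add _ _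
  rw [abs_le] at h1 ⊢
  constructor <;> linarith

lemma regInv_eq {δ t : ℝ} (hδ : 0 < δ) (ht : 0 ≤ t) :
    regInv δ t = 1 / (t + √(t ^ 2 + δ ^ 2)) := by
  have h0 : 0 < √(t ^ 2 + δ ^ 2) := by positivity
  have h1 : √(t ^ 2 + δ ^ 2) ^ 2 = t ^ 2 + δ ^ 2 := Real.sq_sqrt (by positivity)
  rw [regInv, div_eq_div_iff (by positivity) (by positivity)]
  linear_combination h1

lemma neg_deriv_regInv_eq {δ t : ℝ} (hδ : 0 < δ) (ht : 0 ≤ t) :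
    -deriv (regInv δ) t = 1 / (√(t ^ 2 + δ ^ 2) * (t + √(t ^ 2 + δ ^ 2))) := by
  have h0 : 0 < √(t ^ 2 + δ ^ 2) := by positivity
  have h1 : √(t ^ 2 + δ ^ 2) ^ 2 = t ^ 2 + δ ^ 2 := Real.sq_sqrt (by positivity)
  rw [deriv_regInv hδ, ← neg_div, div_eq_div_iff (by positivity) (by positivity)]
  field_simp
  linear_combination h1

lemma regInv_nonneg {δ t : ℝ} (hδ : 0 < δ) (ht : 0 ≤ t) : 0 ≤ regInv δ t := by
  rw [regInv_eq hδ ht]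
  positivity

lemma mul_regInv_le_one {δ t : ℝ} (hδ : 0 < δ) (ht : 0 ≤ t) : t * regInv δ t ≤ 1 := by
  have h0 : 0 < √(t ^ 2 + δ ^ 2) := by positivity
  rw [regInv_eq hδ ht, mul_one_div, div_le_one (by positivity)]
  linarith

lemma regInv_sq_le {δ t : ℝ} (hδ : 0 < δ) (ht : 0 ≤ t) :
    regInv δ t ^ 2 ≤ -deriv (regInv δ) t := by
  have h0 : 0 < √(t ^ 2 + δ ^ 2) := by positivity
  rw [regInv_eq hδ ht, neg_deriv_regInv_eq hδ ht, div_pow, one_pow]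
  refine one_div_le_one_div_of_le (by positivity) ?_
  nlinarith [mul_nonneg ht (add_nonneg ht h0.le)]

lemma inv_le_neg_deriv_regInv {δ t : ℝ} (hδ : 0 < δ) (ht : 0 ≤ t) :
    (t ^ 2 + δ ^ 2)⁻¹ ≤ 2 * -deriv (regInv δ) t := by
  have h0 : 0 < √(t ^ 2 + δ ^ 2) := by positivity
  have h1 : √(t ^ 2 + δ ^ 2) ^ 2 = t ^ 2 + δ ^ 2 := Real.sq_sqrt (by positivity)
  have h2 := (le_abs_self t).trans (abs_le_sqrt_sq_add t δ)
  rw [neg_deriv_regInv_eq hδ ht]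
  generalize √(t ^ 2 + δ ^ 2) = r at h0 h1 h2 ⊢
  rw [← h1, mul_one_div, ← one_div, div_le_div_iff₀ (by positivity)
    (by positivity)]
  nlinarith

lemma integrable_inner_of_memLp {α F : Type*} [MeasurableSpace α] [NormedAddCommGroup F]
    [InnerProductSpace ℝ F] {μ : Measure α} {f g : α → F} (hf : MemLp f 2 μ) (hg : MemLp g 2 μ) :
    Integrable (fun x => ⟪f x, g x⟫_ℝ) μ := by
  refine Integrable.mono' ((integrable_norm_sq hf).add (integrable_norm_sq hg))
    (hf.1.inner hg.1) (ae_of_all _ fun x => ?_)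
  refine (norm_inner_le_norm _ _).trans ?_
  simp only [Pi.add_apply]
  nlinarith [sq_nonneg (‖f x‖ - ‖g x‖), sq_nonneg (‖f x‖), sq_nonneg (‖g x‖)]

lemma gradient_sq {η : E n → ℝ} {x : E n} (hη : DifferentiableAt ℝ η x) :
    gradient (fun x => η x * η x) x = (2 * η x) • gradient η x := by
  rw [gradient_mul hη hη, ← add_smul, two_mul]

/-- The logarithmic Caccioppoli estimate for nonnegative weak solutions: the solution is tested with
`η² G(u)`, where `G(u) = 1 / (u + √(u² + δ²))`. As `u G(u) ≤ 1`, the lower order terms are bounded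
uniformly in `δ`, and as `G² ≤ -G'`, the terms with `∇η` are absorbed. -/
lemma exists_log_caccioppoli (hn : 3 ≤ n) {Ω : Set (E n)} (hΩ : IsOpen Ω)
    (hb : Bornology.IsBounded Ω) (h0 : (0 : E n) ∉ Ω) {γ s c : ℝ} (hs0 : 0 ≤ s) (hs2 : s ≤ 2)
    {u : E n → ℝ} {g : E n → E n} (h : MemD12 Ω u g) (hu : ∀ x, 0 ≤ u x)
    (heq : ∀ ψ k, MemD12 Ω ψ k →
      (∫ x, ⟪g x, k x⟫_ℝ) - γ * ∫ x, u x * ψ x / ‖x‖ ^ 2 =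
        c * ∫ x, u x ^ (critExp n s - 1) * ψ x / ‖x‖ ^ s)
    {η : E n → ℝ} (hη : IsTestFunction Ω η) :
    ∃ C, ∀ δ > 0, ∫ x, η x ^ 2 * ((u x ^ 2 + δ ^ 2)⁻¹ * ‖g x‖ ^ 2) ≤ C := by
  have hp := critExp_pos hn hs2
  have hp2 := two_le_critExp hn hs2
  set p := critExp n s with hp_def
  have hK := controlled_one hn hΩ h0 hb
  have hT := controlled_hardySobolev hn hΩ h0 hs0 hs2
  have hζ : IsTestFunction Ω (fun x => η x * η x) := hη.smooth_mul hη.smooth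
  obtain ⟨A, hA⟩ := hζ.smooth.continuous.bounded_above_of_compact_support hζ.compact
  have hA0 : 0 ≤ A := (norm_nonneg _).trans (hA 0)
  have hup : Integrable (fun x => |u x| ^ p / ‖x‖ ^ s) := by
    refine (integrable_abs_rpow hp (hT.memLp hn h)).congr (ae_of_all _ fun x => ?_)
    exact hardySobolev_weight_rpow hp s (u x) x
  have hζs : ∀ t : ℝ, Integrable (fun x => η x * η x * ‖x‖ ^ (-t)) := fun t =>
    hη.integrable_mul hΩ (IsTestFunction.continuousOn_norm_rpow h0 (-t))
      hζ.smooth.continuous fun x hx => by simp [hx]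
  set b₁ : E n → ℝ := fun x => η x * η x * ‖x‖ ^ (-2 : ℝ)
  set b₂ : E n → ℝ := fun x => η x * η x * ‖x‖ ^ (-s) + A * (|u x| ^ p / ‖x‖ ^ s)
  have hb₁ : Integrable b₁ := hζs 2
  have hb₂ : Integrable b₂ := (hζs s).add (hup.const_mul A)
  set C₀ := |γ| * (∫ x, b₁ x) + |c| * ∫ x, b₂ x with hC₀
  refine ⟨4 * C₀ + 8 * ∫ x, ‖gradient η x‖ ^ 2, fun δ hδ => ?_⟩
  -- The test function `ψ = η² G(u)` and its gradient.
  set G := regInv δ with hG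
  have hG1 := contDiff_regInv hδ
  set ψ : E n → ℝ := fun x => η x * η x * G (u x) with hψ_def
  set k : E n → E n := fun x =>
    (η x * η x * deriv G (u x)) • g x + (2 * η x * G (u x)) • gradient η x with hk_def
  have hψ : MemD12 Ω ψ k := by
    have hd : ∀ t, deriv (fun t => G t - G 0) t = deriv G t := fun t => by
      rw [deriv_sub_const]
    have h1 := h.comp hn (F := fun t => G t - G 0) (hG1.sub contDiff_const) (sub_self _)
      (L := 2 / δ ^ 2) (fun t => by rw [hd]; exact abs_deriv_regInv_le hδ t)
    have h2 := (h1.smooth_mul hn hK hζ).add hn (hζ.memD12.const_mul (G 0))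
    refine h2.congr (ae_of_all _ fun x => ?_) (ae_of_all _ fun x => ?_)
    · simp only [hψ_def]
      ring
    · simp only [hk_def, hd, gradient_sq (hη.differentiableAt x)]
      module
  have key := heq ψ k hψ
  have hGu : ∀ x, 0 ≤ G (u x) := fun x => regInv_nonneg hδ (hu x)
  have hGu1 : ∀ x, u x * G (u x) ≤ 1 := fun x => mul_regInv_le_one hδ (hu x)
  have hηη : ∀ x, 0 ≤ η x * η x := fun x => mul_self_nonneg _
  have hI1 : |∫ x, u x * ψ x / ‖x‖ ^ 2| ≤ ∫ x, b₁ x := by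
    rw [← Real.norm_eq_abs]
    refine norm_integral_le_of_norm_le hb₁ (ae_of_all _ fun x => ?_)
    have e : u x * ψ x / ‖x‖ ^ 2 = b₁ x * (u x * G (u x)) := by
      simp only [hψ_def, b₁]
      rw [Real.rpow_neg (norm_nonneg _), Real.rpow_two]
      ring
    have hb0 : 0 ≤ b₁ x := mul_nonneg (hηη x) (by positivity)
    rw [e, Real.norm_of_nonneg (mul_nonneg hb0 (mul_nonneg (hu x) (hGu x)))]
    exact mul_le_of_le_one_right hb0 (hGu1 x)
  have hI2 : |∫ x, u x ^ (p - 1) * ψ x / ‖x‖ ^ s| ≤ ∫ x, b₂ x := by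
    rw [← Real.norm_eq_abs]
    refine norm_integral_le_of_norm_le hb₂ (ae_of_all _ fun x => ?_)
    have e0 : u x ^ (p - 1) = u x ^ (p - 2) * u x := by
      rw [← Real.rpow_add_one' (hu x) (by linarith)]
      ring_nf
    have e : u x ^ (p - 1) * ψ x / ‖x‖ ^ s =
        u x ^ (p - 2) * (η x * η x * (‖x‖ ^ s)⁻¹) * (u x * G (u x)) := by
      rw [e0]
      simp only [hψ_def]
      ring
    have h1 : u x ^ (p - 2) ≤ 1 + u x ^ p := by
      rcases le_or_gt (u x) 1 with h1 | h1
      · have := Real.rpow_le_one (hu x) h1 (by linarith : 0 ≤ p - 2)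
        have := Real.rpow_nonneg (hu x) p
        linarith
      · have := Real.rpow_le_rpow_of_exponent_le h1.le (by linarith : p - 2 ≤ p)
        linarith
    have h2 : 0 ≤ u x ^ (p - 2) := Real.rpow_nonneg (hu x) _
    have h3 : 0 ≤ η x * η x * (‖x‖ ^ s)⁻¹ := mul_nonneg (hηη x) (by positivity)
    rw [e, Real.norm_of_nonneg (mul_nonneg (mul_nonneg h2 h3) (mul_nonneg (hu x) (hGu x)))]
    refine (mul_le_of_le_one_right (mul_nonneg h2 h3) (hGu1 x)).trans ?_
    refine (mul_le_mul_of_nonneg_right h1 h3).trans ?_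
    simp only [b₂]
    rw [Real.rpow_neg (norm_nonneg _), abs_of_nonneg (hu x), add_mul, one_mul]
    have h4 : η x * η x ≤ A := (le_abs_self _).trans (hA x)
    have h5 : 0 ≤ u x ^ p / ‖x‖ ^ s := by
      have := Real.rpow_nonneg (hu x) p
      positivity
    have h6 := mul_le_mul_of_nonneg_right h4 h5
    have h7 : u x ^ p * (η x * η x * (‖x‖ ^ s)⁻¹) = η x * η x * (u x ^ p / ‖x‖ ^ s) := by ring
    linarith
  have hlow : -C₀ ≤ ∫ x, ⟪g x, k x⟫_ℝ := by
    have e : ∫ x, ⟪g x, k x⟫_ℝ = γ * (∫ x, u x * ψ x / ‖x‖ ^ 2) +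
        c * ∫ x, u x ^ (p - 1) * ψ x / ‖x‖ ^ s := by linarith
    have h1 := neg_mul_le_abs_mul hI1 (γ := γ)
    have h2 := neg_mul_le_abs_mul hI2 (γ := c)
    rw [e, hC₀]
    linarith
  have hpt : ∀ x, ⟪g x, k x⟫_ℝ ≤ 2 * ‖gradient η x‖ ^ 2 -
      (1 / 4) * (η x ^ 2 * ((u x ^ 2 + δ ^ 2)⁻¹ * ‖g x‖ ^ 2)) := by
    intro x
    have e : ⟪g x, k x⟫_ℝ = η x ^ 2 * deriv G (u x) * ‖g x‖ ^ 2 +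
        2 * η x * G (u x) * ⟪g x, gradient η x⟫_ℝ := by
      simp only [hk_def]
      rw [inner_add_right, inner_smul_right, inner_smul_right, real_inner_self_eq_norm_sq]
      ring
    have h1 : 2 * η x * G (u x) * ⟪g x, gradient η x⟫_ℝ ≤
        2 * |η x| * G (u x) * (‖g x‖ * ‖gradient η x‖) := by
      refine (le_abs_self _).trans ?_
      rw [abs_mul, abs_mul, abs_mul, abs_two, abs_of_nonneg (hGu x)]
      gcongr
      · exact mul_nonneg (by positivity) (hGu x)
      · exact abs_real_inner_le_norm _ _
    have h2 : 2 * |η x| * G (u x) * (‖g x‖ * ‖gradient η x‖) ≤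
        (1 / 2) * (η x ^ 2 * G (u x) ^ 2 * ‖g x‖ ^ 2) + 2 * ‖gradient η x‖ ^ 2 := by
      have := sq_nonneg (|η x| * G (u x) * ‖g x‖ - 2 * ‖gradient η x‖)
      rw [← sq_abs (η x)]
      nlinarith
    have h3 : 0 ≤ η x ^ 2 * ‖g x‖ ^ 2 := by positivity
    have h4 := mul_le_mul_of_nonneg_left (regInv_sq_le hδ (hu x)) h3
    have h5 := mul_le_mul_of_nonneg_left (inv_le_neg_deriv_regInv hδ (hu x)) h3
    rw [e]
    linarith
  have hi2 : Integrable (fun x => η x ^ 2 * ((u x ^ 2 + δ ^ 2)⁻¹ * ‖g x‖ ^ 2)) := by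
    refine Integrable.mono' ((integrable_norm_sq h.memLp_grad).const_mul (A * (δ ^ 2)⁻¹)) ?_
      (ae_of_all _ fun x => ?_)
    · refine (hη.smooth.continuous.pow 2).aestronglyMeasurable.mul (AEStronglyMeasurable.mul ?_
        (h.memLp_grad.1.norm.pow 2))
      exact (h.memLp.1.aemeasurable.pow_const 2 |>.add_const _).inv.aestronglyMeasurable
    · rw [Real.norm_of_nonneg (by positivity), mul_assoc]
      have h4 : η x ^ 2 ≤ A := by
        rw [sq]
        exact (le_abs_self _).trans (hA x)
      gcongr
      linarith [sq_nonneg (u x)]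
  have hη2 : Integrable (fun x => ‖gradient η x‖ ^ 2) := hη.integrable_dirichlet
  have h3 : ∫ x, ⟪g x, k x⟫_ℝ ≤ ∫ x, (2 * ‖gradient η x‖ ^ 2 -
      (1 / 4) * (η x ^ 2 * ((u x ^ 2 + δ ^ 2)⁻¹ * ‖g x‖ ^ 2))) :=
    integral_mono (integrable_inner_of_memLp h.memLp_grad hψ.memLp_grad)
      ((hη2.const_mul 2).sub (hi2.const_mul (1 / 4))) hpt
  rw [integral_sub (hη2.const_mul 2) (hi2.const_mul (1 / 4)), integral_const_mul,
    integral_const_mul] at h3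
  linarith

/-- The function `arsinh (t / δ)` is a smooth substitute for `log (2 t / δ)`. -/
lemma hasDerivAt_arsinh_div {δ : ℝ} (hδ : 0 < δ) (t : ℝ) :
    HasDerivAt (fun t => Real.arsinh (t / δ)) (√(t ^ 2 + δ ^ 2))⁻¹ t := by
  have h1 : HasDerivAt (fun t => t / δ) (1 / δ) t := (hasDerivAt_id t).div_const δ
  have h2 := (Real.hasDerivAt_arsinh (t / δ)).comp t h1
  have e : t ^ 2 + δ ^ 2 = (1 + (t / δ) ^ 2) * δ ^ 2 := by
    field_simp
    ring
  rw [e, Real.sqrt_mul (by positivity), Real.sqrt_sq hδ.le, mul_inv, ← one_div δ]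
  exact h2

/-- On balls compactly contained in the domain, a nonnegative weak solution vanishes almost
everywhere or is positive almost everywhere: `log u` has a finite Dirichlet integral there, so by
the Poincaré inequality it cannot be `-∞` on a set of positive measure unless `u = 0`. -/
lemma ae_eq_zero_or_ae_pos_on_ball (hn : 3 ≤ n) {Ω : Set (E n)} (hΩ : IsOpen Ω)
    (hb : Bornology.IsBounded Ω) (h0 : (0 : E n) ∉ Ω) {γ s c : ℝ} (hs0 : 0 ≤ s) (hs2 : s ≤ 2)
    {u : E n → ℝ} {g : E n → E n} (h : MemD12 Ω u g) (hu : ∀ x, 0 ≤ u x)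
    (heq : ∀ ψ k, MemD12 Ω ψ k →
      (∫ x, ⟪g x, k x⟫_ℝ) - γ * ∫ x, u x * ψ x / ‖x‖ ^ 2 =
        c * ∫ x, u x ^ (critExp n s - 1) * ψ x / ‖x‖ ^ s)
    {x₀ : E n} (hx₀ : x₀ ∈ Ω) :
    ∃ r > 0, Metric.ball x₀ r ⊆ Ω ∧ ((∀ᵐ y, y ∈ Metric.ball x₀ r → u y = 0) ∨
      (∀ᵐ y, y ∈ Metric.ball x₀ r → 0 < u y)) := by
  obtain ⟨R, hR0, hR⟩ := Metric.nhds_basis_closedBall.mem_iff.1 (hΩ.mem_nhds hx₀)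
  set χ : ContDiffBump x₀ := ⟨R / 2, R, by positivity, by linarith⟩ with hχ
  have hη : IsTestFunction Ω χ := ⟨χ.contDiff, χ.hasCompactSupport, by
    rw [χ.tsupport_eq]
    exact hR⟩
  set r := R / 2 with hr
  set B := Metric.ball x₀ r with hB
  have hBm : MeasurableSet B := Metric.isOpen_ball.measurableSet
  refine ⟨r, by positivity, (Metric.ball_subset_closedBall.trans
    (Metric.closedBall_subset_closedBall (by linarith))).trans hR, ?_⟩
  obtain ⟨C, hC⟩ := exists_log_caccioppoli hn hΩ hb h0 hs0 hs2 h hu heq hη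
  have hum : AEMeasurable u volume := h.memLp.1.aemeasurable
  by_contra hcon
  rw [not_or] at hcon
  obtain ⟨hz, hpos⟩ := hcon
  set D : ℝ≥0∞ := ENNReal.ofReal (2 * r) ^ 2 with hD
  set M : ℝ≥0∞ := D * (2 ^ n * volume B) * ENNReal.ofReal C with hM
  have hBtop : volume B ≠ ⊤ := measure_ball_lt_top.ne
  have hMtop : M ≠ ⊤ := by
    refine ENNReal.mul_ne_top (ENNReal.mul_ne_top
      (ENNReal.pow_ne_top ENNReal.ofReal_ne_top) (ENNReal.mul_ne_top ?_ hBtop))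
      (by simp)
    exact ENNReal.pow_ne_top (by simp)
  -- The Poincaré inequality for the regularised logarithm of `u`.
  have hkey : ∀ δ > 0, ∫⁻ x in B, ∫⁻ y in B,
      ‖Real.arsinh (u x / δ) - Real.arsinh (u y / δ)‖ₑ ^ 2 ≤ M := by
    intro δ hδ
    have hw := h.comp hn (F := fun t => Real.arsinh (t / δ))
      (Real.contDiff_arsinh.comp (contDiff_id.div_const δ)) (by simp) (L := δ⁻¹) (fun t => by
        rw [(hasDerivAt_arsinh_div hδ t).deriv, abs_of_nonneg (by positivity)]
        gcongr
        exact Real.le_sqrt_of_sq_le (by linarith [sq_nonneg t]))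
    refine (hw.lintegral_sub_sq_le hn hBm (convex_ball _ _) hBtop (D := D)
      (ENNReal.pow_ne_top ENNReal.ofReal_ne_top)
      fun x hx y hy => ?_).trans ?_
    · rw [hD]
      gcongr
      rw [← ofReal_norm]
      refine ENNReal.ofReal_le_ofReal ?_
      rw [← dist_eq_norm]
      have h1 := dist_triangle_right x y x₀
      rw [Metric.mem_ball] at hx hy
      linarith
    · rw [hM]
      gcongr
      have hi : ∀ x, ‖deriv (fun t => Real.arsinh (t / δ)) (u x) • g x‖ ^ 2 =
          (u x ^ 2 + δ ^ 2)⁻¹ * ‖g x‖ ^ 2 := by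
        intro x
        rw [(hasDerivAt_arsinh_div hδ _).deriv, norm_smul, mul_pow, norm_inv, inv_pow,
          Real.norm_of_nonneg (by positivity), Real.sq_sqrt (by positivity)]
      have hint := integrable_norm_sq hw.memLp_grad
      have e1 : ∫⁻ x in B, ‖deriv (fun t => Real.arsinh (t / δ)) (u x) • g x‖ₑ ^ 2 =
          ENNReal.ofReal (∫ x in B, (u x ^ 2 + δ ^ 2)⁻¹ * ‖g x‖ ^ 2) := by
        simp only [hi] at hint
        rw [ofReal_integral_eq_lintegral_ofReal hint.integrableOn
          (ae_of_all _ fun x => by positivity)]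
        refine lintegral_congr fun x => ?_
        rw [← hi, ENNReal.ofReal_pow (norm_nonneg _), ofReal_norm]
      rw [e1]
      refine ENNReal.ofReal_le_ofReal (le_trans ?_ (hC δ hδ))
      rw [← integral_indicator hBm]
      simp only [hi] at hint
      have hi2 : Integrable (fun x => χ x ^ 2 * ((u x ^ 2 + δ ^ 2)⁻¹ * ‖g x‖ ^ 2)) := by
        refine hint.mono' ((hη.smooth.continuous.pow 2).aestronglyMeasurable.mul hint.1)
          (ae_of_all _ fun x => ?_)
        rw [Real.norm_of_nonneg (by positivity)]
        exact mul_le_of_le_one_left (by positivity) (pow_le_one₀ χ.nonneg χ.le_one)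
      refine integral_mono (hint.indicator hBm) hi2 fun x => ?_
      by_cases hx : x ∈ B
      · rw [Set.indicator_of_mem hx, χ.one_of_mem_closedBall (Metric.ball_subset_closedBall hx)]
        simp
      · rw [Set.indicator_of_notMem hx]
        positivity
  -- A set where `u` vanishes and a set where `u ≥ τ > 0`, both of positive measure.
  set A : Set (E n) := B ∩ {x | u x = 0} with hA
  have hAm : NullMeasurableSet A :=
    hBm.nullMeasurableSet.inter (hum.nullMeasurableSet_preimage (measurableSet_singleton 0))
  have hApos : volume A ≠ 0 := by
    intro hA0
    refine hpos ?_
    filter_upwards [measure_eq_zero_iff_ae_notMem.1 hA0] with y hy hyB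
    exact lt_of_le_of_ne (hu y) fun e => hy ⟨hyB, e.symm⟩
  obtain ⟨τ, hτ0, hτ⟩ : ∃ τ > 0, volume (B ∩ {x | τ ≤ u x}) ≠ 0 := by
    by_contra! hall
    refine hz ?_
    have h1 : ∀ k : ℕ, ∀ᵐ y, y ∉ B ∩ {x | 1 / ((k : ℝ) + 1) ≤ u x} := fun k =>
      measure_eq_zero_iff_ae_notMem.1 (hall _ (by positivity))
    filter_upwards [ae_all_iff.2 h1] with y hy hyB
    by_contra hne
    obtain ⟨k, hk⟩ := exists_nat_one_div_lt (lt_of_le_of_ne (hu y) (Ne.symm hne))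
    exact hy k ⟨hyB, hk.le⟩
  set P : Set (E n) := B ∩ {x | τ ≤ u x} with hP
  have hPm : NullMeasurableSet P :=
    hBm.nullMeasurableSet.inter (hum.nullMeasurableSet_preimage measurableSet_Ici)
  have hbound : ∀ ρ : ℝ, 0 < ρ → ENNReal.ofReal ρ ^ 2 * volume P * volume A ≤ M := by
    intro ρ hρ
    have hsinh : 0 < Real.sinh ρ := Real.sinh_pos_iff.2 hρ
    refine le_trans ?_ (hkey (τ / Real.sinh ρ) (by positivity))
    have hlow : ∀ x ∈ A, ∀ y ∈ P, ENNReal.ofReal ρ ^ 2 ≤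
        ‖Real.arsinh (u x / (τ / Real.sinh ρ)) - Real.arsinh (u y / (τ / Real.sinh ρ))‖ₑ ^ 2 := by
      intro x hx y hy
      gcongr
      rw [show u x = 0 from hx.2, zero_div, Real.arsinh_zero, zero_sub, enorm_neg,
        ← ofReal_norm]
      refine ENNReal.ofReal_le_ofReal ((le_trans ?_ (le_abs_self _)))
      rw [← Real.arsinh_sinh ρ, Real.arsinh_le_arsinh, Real.arsinh_sinh,
        le_div_iff₀ (by positivity), mul_div_cancel₀ _ hsinh.ne']
      exact hy.2
    calc ENNReal.ofReal ρ ^ 2 * volume P * volume A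
        = ∫⁻ _ in A, ∫⁻ _ in P, ENNReal.ofReal ρ ^ 2 := by
          rw [setLIntegral_const, setLIntegral_const]
      _ ≤ ∫⁻ x in A, ∫⁻ y in P, ‖Real.arsinh (u x / (τ / Real.sinh ρ)) -
            Real.arsinh (u y / (τ / Real.sinh ρ))‖ₑ ^ 2 := by
          refine lintegral_mono_ae ((ae_restrict_iff'₀ hAm).2 (ae_of_all _ fun x hx => ?_))
          exact lintegral_mono_ae ((ae_restrict_iff'₀ hPm).2 (ae_of_all _ fun y hy =>
            hlow x hx y hy))
      _ ≤ _ := by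
          refine (lintegral_mono_set Set.inter_subset_left).trans ?_
          exact lintegral_mono fun x => lintegral_mono_set Set.inter_subset_left
  have hQ : volume P * volume A ≠ 0 := mul_ne_zero hτ hApos
  have hQtop : volume P * volume A ≠ ⊤ := ENNReal.mul_ne_top
    (measure_ne_top_of_subset Set.inter_subset_left hBtop)
    (measure_ne_top_of_subset Set.inter_subset_left hBtop)
  set q := (volume P * volume A).toReal with hq
  have hq0 : 0 < q := ENNReal.toReal_pos hQ hQtop
  set ρ := M.toReal / q + 1 with hρ
  have hρ1 : 1 ≤ ρ := by
    have : 0 ≤ M.toReal / q := by positivity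
    linarith
  have h1 := ENNReal.toReal_mono hMtop (hbound ρ (by linarith))
  rw [mul_assoc, ENNReal.toReal_mul, ENNReal.toReal_pow, ENNReal.toReal_ofReal (by linarith)] at h1
  have h2 : ρ * q = M.toReal + q := by
    rw [hρ]
    field_simp
  have h3 : ρ ^ 2 * q = ρ * (M.toReal + q) := by
    rw [← h2]
    ring
  rw [← hq, h3] at h1
  nlinarith [ENNReal.toReal_nonneg (a := M)]

lemma ae_of_forall_ball {Ω : Set (E n)} {P : E n → Prop}
    (h : ∀ x ∈ Ω, ∃ r > 0, ∀ᵐ y, y ∈ Metric.ball x r → P y) : ∀ᵐ y, y ∈ Ω → P y := by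
  have : volume {y | y ∈ Ω ∧ ¬ P y} = 0 := by
    refine measure_null_of_locally_null _ fun x hx => ?_
    obtain ⟨r, hr, hP⟩ := h x hx.1
    refine ⟨Metric.ball x r ∩ {y | y ∈ Ω ∧ ¬ P y}, inter_mem
      (mem_nhdsWithin_of_mem_nhds (Metric.ball_mem_nhds x hr)) self_mem_nhdsWithin, ?_⟩
    rw [measure_eq_zero_iff_ae_notMem]
    filter_upwards [hP] with y hy hyB
    exact hyB.2.2 (hy hyB.1)
  filter_upwards [measure_eq_zero_iff_ae_notMem.1 this] with y hy hyΩ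
  by_contra hP
  exact hy ⟨hyΩ, hP⟩

/-- The strong maximum principle for nonnegative weak solutions in a domain. -/
theorem ae_pos_of_solution (hn : 3 ≤ n) {Ω : Set (E n)} (hΩ : IsOpen Ω) (hc : IsPreconnected Ω)
    (hb : Bornology.IsBounded Ω) (h0 : (0 : E n) ∉ Ω) {γ s c : ℝ} (hs0 : 0 ≤ s) (hs2 : s ≤ 2)
    {u : E n → ℝ} {g : E n → E n} (h : MemD12NeZero Ω u g) (hu : ∀ x, 0 ≤ u x)
    (heq : ∀ ψ k, MemD12 Ω ψ k →
      (∫ x, ⟪g x, k x⟫_ℝ) - γ * ∫ x, u x * ψ x / ‖x‖ ^ 2 =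
        c * ∫ x, u x ^ (critExp n s - 1) * ψ x / ‖x‖ ^ s) :
    ∀ᵐ x, x ∈ Ω → 0 < u x := by
  set U : (ℝ → Prop) → Set (E n) := fun P =>
    {x | ∃ r > 0, ∀ᵐ y, y ∈ Metric.ball x r → P (u y)} with hU
  have hUo : ∀ P, IsOpen (U P) := by
    intro P
    refine Metric.isOpen_iff.2 fun x ⟨r, hr, hx⟩ => ⟨r, hr, fun y hy => ?_⟩
    refine ⟨r - dist y x, sub_pos.2 hy, ?_⟩
    filter_upwards [hx] with z hz hzy
    refine hz ?_
    rw [Metric.mem_ball] at hzy ⊢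
    linarith [dist_triangle z y x]
  have hdisj : Disjoint (U fun t => t = 0) (U fun t => 0 < t) := by
    rw [Set.disjoint_left]
    rintro x ⟨r, hr, h1⟩ ⟨r', hr', h2⟩
    refine (Metric.measure_ball_pos volume x (lt_min hr hr')).ne' ?_
    rw [measure_eq_zero_iff_ae_notMem]
    filter_upwards [h1, h2] with y h1 h2 hy
    have e1 := h1 (Metric.ball_subset_ball (min_le_left _ _) hy)
    have e2 := h2 (Metric.ball_subset_ball (min_le_right _ _) hy)
    exact e2.ne' e1
  have hcover : Ω ⊆ (U fun t => t = 0) ∪ (U fun t => 0 < t) := by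
    intro x hx
    obtain ⟨r, hr, -, h1 | h1⟩ := ae_eq_zero_or_ae_pos_on_ball hn hΩ hb h0 hs0 hs2 h.1 hu heq hx
    · exact Or.inl ⟨r, hr, h1⟩
    · exact Or.inr ⟨r, hr, h1⟩
  by_cases hne : (Ω ∩ U fun t => t = 0).Nonempty
  · have hsub := hc.subset_left_of_subset_union (hUo fun t => t = 0) (hUo fun t => 0 < t)
      hdisj hcover hne
    refine absurd ?_ h.2
    filter_upwards [ae_of_forall_ball fun x hx => hsub hx, h.1.ae_eq_zero hn] with x h1 h2
    by_cases hx : x ∈ Ω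
    · exact h1 hx
    · exact (h2 hx).1
  · refine ae_of_forall_ball fun x hx => ?_
    rcases hcover hx with h1 | h1
    · exact absurd ⟨x, hx, h1⟩ hne
    · exact h1

/-! ### Bounds for the best constants, and positive solutions -/

lemma hsTerm_two (hn : 3 ≤ n) (u : E n → ℝ) :
    hsTerm 2 u ^ (2 / critExp n 2) = hardyTerm u := by
  rw [hsTerm, hardyTerm, critExp_two hn, div_self two_ne_zero, Real.rpow_one]
  simp

lemma J_zero_two (hn : 3 ≤ n) {Ω : Set (E n)} (u : E n → ℝ) (g : E n → E n) :
    J Ω 0 2 u g = hardyQuotient Ω u g := by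
  rw [J, hardyQuotient, critExp_two hn, div_self two_ne_zero, Real.rpow_one, zero_mul, sub_zero]
  simp

lemma hardyTerm_pos (hn : 3 ≤ n) {Ω : Set (E n)} (hΩ : IsOpen Ω) (h0 : (0 : E n) ∉ Ω)
    {u : E n → ℝ} {g : E n → E n} (h : MemD12NeZero Ω u g) : 0 < hardyTerm u := by
  rw [← hsTerm_two hn]
  exact Real.rpow_pos_of_pos (hsTerm_pos hn hΩ h0 (by norm_num) le_rfl h) _

lemma hardyQuotient_eq (hn : 3 ≤ n) {Ω : Set (E n)} {u : E n → ℝ} {g : E n → E n}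
    (h : MemD12 Ω u g) : hardyQuotient Ω u g = (∫ x, ‖g x‖ ^ 2) / hardyTerm u := by
  rw [← J_zero_two hn, J_eq hn le_rfl h, hsTerm_two hn, zero_mul, sub_zero]

/-- The Hardy-Sobolev inequality in `D^{1,2}(Ω)`. -/
lemma exists_hardySobolev_memD12 (hn : 3 ≤ n) {Ω : Set (E n)} (hΩ : IsOpen Ω) (h0 : (0 : E n) ∉ Ω)
    (hb : Bornology.IsBounded Ω) {s : ℝ} (hs0 : 0 ≤ s) (hs2 : s ≤ 2) :
    ∃ C : ℝ, 0 < C ∧ ∀ u g, MemD12 Ω u g →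
      hsTerm s u ^ (2 / critExp n s) ≤ C * ∫ x, ‖g x‖ ^ 2 := by
  have hfact : Fact (1 ≤ ENNReal.ofReal (critExp n s)) := ⟨one_le_ofReal_critExp hn hs2⟩
  obtain ⟨C, hC0, hC⟩ := exists_hardySobolev hn hs0 hs2
  refine ⟨C, hC0, fun u g h => ?_⟩
  have := le_of_forall_test hn hs2 (controlled_hardySobolev hn hΩ h0 hs0 hs2)
    (controlled_hardy hn hΩ h0) (controlled_one hn hΩ h0 hb) (a := C) (b := 0) (c := 0) (d := 1)
    (fun φ hφ => by simpa using hC Ω φ hΩ h0 hφ) (h.toGrad hn)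
  rw [h.norm_hsMap_sq hn hs2, h.norm_toGrad_sq hn] at this
  simpa using this

/-- Any real lower bound of the best constant gives the inequality for test functions. -/
lemma le_of_coe_le_bestConst (hn : 3 ≤ n) {Ω : Set (E n)} (hΩ : IsOpen Ω) (h0 : (0 : E n) ∉ Ω)
    {γ s m : ℝ} (hs0 : 0 ≤ s) (hs2 : s ≤ 2) (hm : (m : EReal) ≤ bestConst Ω γ s) {φ : E n → ℝ}
    (hφ : IsTestFunction Ω φ) :
    m * hsTerm s φ ^ (2 / critExp n s) ≤ dirichletEnergy φ - γ * hardyTerm φ := by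
  have hp := critExp_pos hn hs2
  by_cases hz : φ =ᵐ[volume] 0
  · have h1 : φ = 0 := (Continuous.ae_eq_iff_eq volume hφ.smooth.continuous continuous_const).1 hz
    subst h1
    simp [hsTerm, hardyTerm, dirichletEnergy, gradient, hp.ne']
  · have h1 : MemD12NeZero Ω φ (gradient φ) := ⟨hφ.memD12, hz⟩
    have h2 : (m : EReal) ≤ (J Ω γ s φ (gradient φ) : EReal) :=
      hm.trans (sInf_le ⟨φ, _, h1, rfl⟩)
    rw [EReal.coe_le_coe_iff, J_eq hn hs2 h1.1, le_div_iff₀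
      (Real.rpow_pos_of_pos (hsTerm_pos hn hΩ h0 hs0 hs2 h1) _)] at h2
    exact h2

/-- Below the Hardy constant the quadratic form controls the Dirichlet energy. -/
lemma exists_mul_le_sub {γ κ : ℝ} (hγ : γ < κ) :
    ∃ c : ℝ, 0 < c ∧ ∀ A H : ℝ, 0 ≤ A → 0 ≤ H → κ * H ≤ A → c * A ≤ A - γ * H := by
  rcases le_or_gt γ 0 with h | h
  · refine ⟨1, one_pos, fun A H _ hH _ => ?_⟩
    nlinarith
  · have hκ : 0 < κ := h.trans hγ
    refine ⟨1 - γ / κ, by rw [sub_pos, div_lt_one hκ]; exact hγ, fun A H _ _ hAH => ?_⟩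
    have h1 : γ * H ≤ γ / κ * A := by
      rw [div_mul_eq_mul_div, le_div_iff₀ hκ]
      nlinarith
    linarith

/-- The best constant of the half-space is positive for `γ < n² / 4`. -/
lemma exists_halfSpace_lower_bound [NeZero n] (hn : 3 ≤ n) {γ s : ℝ} (hγ : γ < (n : ℝ) ^ 2 / 4)
    (hs0 : 0 ≤ s) (hs2 : s ≤ 2) : ∃ m : ℝ, 0 < m ∧ ∀ φ, IsTestFunction (halfSpace n) φ →
      m * hsTerm s φ ^ (2 / critExp n s) ≤ dirichletEnergy φ - γ * hardyTerm φ := by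
  obtain ⟨C, hC0, hC⟩ := exists_hardySobolev hn hs0 hs2
  obtain ⟨c, hc0, hc⟩ := exists_mul_le_sub hγ
  refine ⟨c / C, by positivity, fun φ hφ => ?_⟩
  refine le_trans ?_ (hc _ _ (dirichletEnergy_nonneg φ) (hardyTerm_nonneg φ) hφ.hardy_halfSpace)
  rw [div_mul_eq_mul_div, div_le_iff₀ hC0, mul_assoc, mul_comm _ C]
  exact mul_le_mul_of_nonneg_left
    (hC _ φ isOpen_halfSpace zero_notMem_halfSpace hφ) hc0.le

lemma bestConst_pos (hn : 3 ≤ n) {Ω : Set (E n)} (hΩ : IsOpen Ω) (h0 : (0 : E n) ∉ Ω)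
    (hb : Bornology.IsBounded Ω) {γ s : ℝ} (hs0 : 0 ≤ s) (hs2 : s ≤ 2)
    (hγ : (γ : EReal) < hardyConst Ω) : 0 < bestConst Ω γ s := by
  obtain ⟨κ, hγκ, hκ⟩ := EReal.lt_iff_exists_real_btwn.1 hγ
  obtain ⟨c, hc0, hc⟩ := exists_mul_le_sub (EReal.coe_lt_coe_iff.1 hγκ)
  obtain ⟨C, hC0, hC⟩ := exists_hardySobolev_memD12 hn hΩ h0 hb hs0 hs2
  refine (EReal.coe_pos.2 (div_pos hc0 hC0)).trans_le (le_sInf ?_)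
  rintro t ⟨u, g, h, rfl⟩
  have h1 : (κ : EReal) ≤ (hardyQuotient Ω u g : EReal) := hκ.le.trans (sInf_le ⟨u, g, h, rfl⟩)
  rw [EReal.coe_le_coe_iff, hardyQuotient_eq hn h.1, le_div_iff₀ (hardyTerm_pos hn hΩ h0 h)] at h1
  rw [EReal.coe_le_coe_iff, J_eq hn hs2 h.1, le_div_iff₀
    (Real.rpow_pos_of_pos (hsTerm_pos hn hΩ h0 hs0 hs2 h) _)]
  refine le_trans ?_ (hc _ _ (integral_nonneg fun _ => by positivity) (hardyTerm_nonneg u) h1)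
  rw [div_mul_eq_mul_div, div_le_iff₀ hC0, mul_assoc, mul_comm _ C]
  exact mul_le_mul_of_nonneg_left (hC u g h.1) hc0.le

lemma bestConst_neg (hn : 3 ≤ n) {Ω : Set (E n)} (hΩ : IsOpen Ω) (h0 : (0 : E n) ∉ Ω)
    {γ s : ℝ} (hs0 : 0 ≤ s) (hs2 : s ≤ 2) (hγ : hardyConst Ω < (γ : EReal)) :
    bestConst Ω γ s < 0 := by
  obtain ⟨t, ⟨u, g, h, rfl⟩, h1⟩ := sInf_lt_iff.1 hγ
  refine (sInf_le ⟨u, g, h, rfl⟩ : bestConst Ω γ s ≤ _).trans_lt ?_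
  rw [EReal.coe_lt_coe_iff, hardyQuotient_eq hn h.1, div_lt_iff₀ (hardyTerm_pos hn hΩ h0 h)] at h1
  rw [← EReal.coe_zero, EReal.coe_lt_coe_iff, J_eq hn hs2 h.1]
  exact div_neg_of_neg_of_pos (by linarith)
    (Real.rpow_pos_of_pos (hsTerm_pos hn hΩ h0 hs0 hs2 h) _)

/-- An extremal gives a positive weak solution, the sign of the right-hand side being that of the
best constant. -/
theorem exists_isPositiveSolution (hn : 3 ≤ n) {Ω : Set (E n)} (hΩ : IsOpen Ω)
    (hc : IsPreconnected Ω) (hb : Bornology.IsBounded Ω) (h0 : (0 : E n) ∉ Ω) {γ s : ℝ}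
    (hs0 : 0 ≤ s) (hs2 : s < 2) (hext : HasExtremal Ω γ s) {c : ℝ} (hc1 : |c| = 1)
    (hsign : ∀ μ : ℝ, bestConst Ω γ s = (μ : EReal) → 0 < c * μ) :
    ∃ u g, IsPositiveSolution Ω γ s c u g := by
  classical
  obtain ⟨u, g, h, hu, heq⟩ := exists_nonneg_solution hn hΩ h0 hs0 hs2 hext hc1 hsign
  have hpos := ae_pos_of_solution hn hΩ hc hb h0 hs0 hs2.le h hu heq
  -- The values of `u` on the null set where it vanishes are changed.
  set v : E n → ℝ := fun x => if x ∈ Ω ∧ u x = 0 then 1 else u x with hv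
  have huv : u =ᵐ[volume] v := by
    filter_upwards [hpos] with x hx
    simp only [hv]
    rw [if_neg]
    rintro ⟨h1, h2⟩
    exact (hx h1).ne' h2
  refine ⟨v, g, h.1.congr huv EventuallyEq.rfl, fun x hx => ?_, fun φ k hφ => ?_⟩
  · simp only [hv]
    split_ifs with h1
    · exact one_pos
    · exact lt_of_le_of_ne (hu x) fun e => h1 ⟨hx, e.symm⟩
  · rw [hφ.setIntegral_eq hn (by intro x _ h; simp [h]),
      hφ.setIntegral_eq hn (by intro x h _; simp [h]),
      hφ.setIntegral_eq hn (by intro x h _; simp [h])]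
    have e1 : ∫ x, v x * φ x / ‖x‖ ^ 2 = ∫ x, u x * φ x / ‖x‖ ^ 2 :=
      integral_congr_ae (huv.mono fun x hx => by simp only [hx])
    have e2 : ∫ x, v x ^ (critExp n s - 1) * φ x / ‖x‖ ^ s =
        ∫ x, u x ^ (critExp n s - 1) * φ x / ‖x‖ ^ s :=
      integral_congr_ae (huv.mono fun x hx => by simp only [hx])
    rw [e1, e2]
    exact heq φ k hφ

end HardySchrodinger
















open HardySchrodinger

theorem mainTheorem5 (n : ℕ) [NeZero n] (hn : 3 ≤ n)
    (Ω : Set (HardySchrodinger.E n))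
    (hΩ_open : IsOpen Ω) (hΩ_conn : IsConnected Ω) (hΩ_bdd : Bornology.IsBounded Ω)
    (h0 : (0 : HardySchrodinger.E n) ∈ frontier Ω)
    (hΩ_smooth : HardySchrodinger.SmoothBoundaryAt Ω 0)
    (γ s : ℝ) (hγ : γ < (n : ℝ) ^ 2 / 4) (hs0 : 0 ≤ s) (hs2 : s ≤ 2) :
    -- 1. existence of extremals, and attainment of the Hardy constant
    ((HardySchrodinger.bestConst Ω γ s
          < HardySchrodinger.bestConst (HardySchrodinger.halfSpace n) γ s →
        HardySchrodinger.HasExtremal Ω γ s) ∧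
      (HardySchrodinger.hardyConst Ω < (((n : ℝ) ^ 2 / 4 : ℝ) : EReal) →
        HardySchrodinger.HardyConstAttained Ω)) ∧
    -- 2. the case `γ < γ_H(Ω)`
    ((γ : EReal) < HardySchrodinger.hardyConst Ω →
      0 < HardySchrodinger.bestConst Ω γ s ∧
      (HardySchrodinger.bestConst Ω γ s
          < HardySchrodinger.bestConst (HardySchrodinger.halfSpace n) γ s →
        s < 2 → ∃ u g, HardySchrodinger.IsPositiveSolution Ω γ s 1 u g)) ∧
    -- 3. the case `γ_H(Ω) < γ`
    (HardySchrodinger.hardyConst Ω < (γ : EReal) →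
      HardySchrodinger.bestConst Ω γ s < 0 ∧
      (s < 2 → ∃ u g, HardySchrodinger.IsPositiveSolution Ω γ s (-1) u g)) := by
  have h0Ω : (0 : E n) ∉ Ω := fun h => (hΩ_open.frontier_eq ▸ h0).2 h
  obtain ⟨m₀, hm₀, hm₀'⟩ := exists_halfSpace_lower_bound hn hγ hs0 hs2
  have hext : bestConst Ω γ s < bestConst (halfSpace n) γ s → HasExtremal Ω γ s := by
    intro hlt
    obtain ⟨m₁, h1, h2⟩ := EReal.lt_iff_exists_real_btwn.1 hlt
    -- The threshold is enlarged to be positive, as the Hardy inequality on the half-space allows.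
    refine exists_extremal hn hΩ_open hΩ_bdd h0 hΩ_smooth hγ hs0 hs2 (m := max m₀ m₁)
      (lt_max_of_lt_left hm₀) (fun φ hφ => ?_)
      (h1.trans_le (EReal.coe_le_coe_iff.2 (le_max_right _ _)))
    rcases max_choice m₀ m₁ with h | h
    · rw [h]
      exact hm₀' φ hφ
    · rw [h]
      exact le_of_coe_le_bestConst hn isOpen_halfSpace zero_notMem_halfSpace hs0 hs2 h2.le hφ
  refine ⟨⟨hext, fun hH => ?_⟩, fun hH => ?_, fun hH => ?_⟩
  · -- The Hardy constant is the best constant for `γ = 0` and `s = 2`.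
    have hconst : bestConst Ω 0 2 = hardyConst Ω := by
      simp only [bestConst, hardyConst, J_zero_two hn]
    have hn0 : (0 : ℝ) < (n : ℝ) ^ 2 / 4 := by
      have : (n : ℝ) ≠ 0 := Nat.cast_ne_zero.2 (by omega)
      positivity
    obtain ⟨u, g, h, hJ⟩ := exists_extremal hn hΩ_open hΩ_bdd h0 hΩ_smooth hn0 (by norm_num) le_rfl
      hn0 (fun φ hφ => by
        rw [hsTerm_two hn, zero_mul, sub_zero]
        exact hφ.hardy_halfSpace) (hconst ▸ hH)
    rw [J_zero_two hn, hconst] at hJ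
    exact ⟨u, g, h, hJ⟩
  · have hpos := bestConst_pos hn hΩ_open h0Ω hΩ_bdd hs0 hs2 hH
    refine ⟨hpos, fun hlt hs => ?_⟩
    refine exists_isPositiveSolution hn hΩ_open hΩ_conn.isPreconnected hΩ_bdd h0Ω hs0 hs (hext hlt)
      abs_one fun μ hμ => ?_
    rw [hμ, EReal.coe_pos] at hpos
    linarith
  · have hneg := bestConst_neg hn hΩ_open h0Ω hs0 hs2 hH
    refine ⟨hneg, fun hs => ?_⟩
    refine exists_isPositiveSolution hn hΩ_open hΩ_conn.isPreconnected hΩ_bdd h0Ω hs0 hs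
      (exists_extremal hn hΩ_open hΩ_bdd h0 hΩ_smooth hγ hs0 hs2 hm₀ hm₀'
        (hneg.trans (EReal.coe_pos.2 hm₀))) (by simp) fun μ hμ => ?_
    rw [hμ, ← EReal.coe_zero, EReal.coe_lt_coe_iff] at hneg
    linarith
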